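/- Let $\mathcal F$ be the class of functions $f:\mathbb R\to\mathbb R\cup\{\infty\}$ such that: (1) $f(0)=0$ and $f$ is right continuous at $0$; (2) $f$ is finite and continuously differentiable on $(0,\infty)$ with $f'>0$ there, there are $a_1>0$ and $a_2\ge 0$ with $f'(x)\ge a_1$ for all $x>a_2$, and there are $1<q<2$ and $a_3>0$ with $\liminf_{x\searrow 0} f'(x)^q/f(x)\ge a_3$; (3) either $f\equiv\infty$ on $(-\infty,0)$, or $f(-x)=f(x)$ for all $x$. For $f\in\mathcal F$ put $R_n(x)=\sum_{i=1}^n f(x_i)$ and $S_n(t)=\{x\in\mathbb R^n: R_n(x)=nt\}$, and for $c>0$ put $Z_c=\int_{\mathbb R} e^{-cf(x)}\,dx$ and $g_{n,c}(x)=e^{-cR_n(x)}/Z_c^{\,n}$. For a density $q$ on $\mathbb R^n$ let $\varepsilon(q)=\int q(x)R_n(x)\,dx$. Let $\sigma_{n,t}$ be the Riemannian volume ($(n-1)$-dimensional Hausdorff measure) on $S_n(t)$. Let $A_{n,t}(r,s)$ be the Jacobian of the coordinates $(r,s)\mapsto x=\kappa s$, for $r>0$ and $s\in S_n(t)$, where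 $\kappa=\kappa(r,s)>0$ is determined by $R_n(\kappa s)=r$; that is, $dx=A_{n,t}(r,s)\,dr\,\sigma_{n,t}(ds)$. Put $h_{n,t}(v)=A_{n,t}(nt,v)/\int A_{n,t}(nt,s)\,\sigma_{n,t}(ds)$ for $v\in S_n(t)$ (so $h_{n,t}\propto 1/|\nabla R_n|$, the microcanonical "uniform" density). Write $D(\cdot\,\|\,\cdot)\in[0,\infty]$ for relative entropy and $\pi_{n,k}$ for the projection of $\mathbb R^n$ to the first $k$ coordinates. **Theorem.** Let $f\in\mathcal F$. There is an integer $r=r(f)\ge 1$ such that for every $t\in(0,\infty)$ and every $c>0$ with $\varepsilon(g_{1,c})=t$ there is a constant $C=C(f,t)>0$ with the following property. Let $n,k\ge 0$ be integers with $n-k\ge r$ and $\sqrt n>C$, and let $X$ be a random variable with density $p$ (with respect to $\sigma_{n,t}$) on $S_n(t)$. Then $\pi_{n,k}X$ has a density $p_{n,k,t}$ on $\mathbb R^k$, and $$D(p_{n,k,t}\,\|\,g_{k,c})\;\le\; D(p\,\|\,h_{n,t})+\log\frac{n}{n-k}+\frac{2}{\sqrt n/C-1}.$$ -/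

import Mathlib

open MeasureTheory ProbabilityTheory InformationTheory Filter Set
open scoped ENNReal Topology RealInnerProductSpace

namespace GibbsSurface

/-- The real-valued version of `f`, meaningful where `f` is finite. -/
noncomputable def realPart (f : ℝ → EReal) (x : ℝ) : ℝ := (f x).toReal

/-- The class `𝓕` of single-particle Hamiltonians `f : ℝ → ℝ ∪ {∞}`.
(The value `-∞` is excluded by the clauses below.) -/
structure ClassF (f : ℝ → EReal) : Prop where
  map_zero : f 0 = 0
  right_cont : ContinuousWithinAt f (Ici 0) 0
  finite_pos : ∀ x, 0 < x → f x ≠ ⊤ ∧ f x ≠ ⊥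
  /-- `f` is continuously differentiable on `(0, ∞)`. -/
  contDiff : ContDiffOn ℝ 1 (realPart f) (Ioi 0)
  deriv_pos : ∀ x, 0 < x → 0 < deriv (realPart f) x
  deriv_tail : ∃ a₁ a₂ : ℝ, 0 < a₁ ∧ 0 ≤ a₂ ∧ ∀ x, a₂ < x → a₁ ≤ deriv (realPart f) x
  /-- The lower limit is taken in the extended reals, since it may be `+∞`. -/
  deriv_zero : ∃ q a₃ : ℝ, 1 < q ∧ q < 2 ∧ 0 < a₃ ∧
    (a₃ : EReal) ≤
      liminf (fun x => ((deriv (realPart f) x ^ q / realPart f x : ℝ) : EReal)) (𝓝[>] 0)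
  half_line_or_even : (∀ x, x < 0 → f x = ⊤) ∨ (∀ x, f (-x) = f x)

/-- `R_n(x) = ∑ f(x_i)`. -/
noncomputable def energySum (f : ℝ → EReal) {n : ℕ} (x : EuclideanSpace ℝ (Fin n)) : EReal :=
  ∑ i, f (x i)

/-- The surface `S_n(t) = {x : R_n(x) = n t}`. -/
def surface (f : ℝ → EReal) (n : ℕ) (t : ℝ) : Set (EuclideanSpace ℝ (Fin n)) :=
  {x | energySum f x = ((n * t : ℝ) : EReal)}

/-- The partition function `Z_c = ∫ exp(-c f(x)) dx`. -/
noncomputable def partitionFn (f : ℝ → EReal) (c : ℝ) : ℝ≥0∞ :=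
  ∫⁻ x : ℝ, EReal.exp (-((c : EReal) * f x))

/-- The Gibbs density `g_{n,c}(x) = exp(-c R_n(x)) / Z_c ^ n`. -/
noncomputable def gibbs (f : ℝ → EReal) (c : ℝ) {n : ℕ} (x : EuclideanSpace ℝ (Fin n)) : ℝ≥0∞ :=
  EReal.exp (-((c : EReal) * energySum f x)) / partitionFn f c ^ n

/-- The energy `ε(q) = ∫ q(x) R_n(x) dx` of a density `q` on `ℝⁿ`, for `f ≥ 0`
(with `0 · ∞ = 0` where `f` is infinite and `q` vanishes). -/
noncomputable def energy (f : ℝ → EReal) {n : ℕ} (q : EuclideanSpace ℝ (Fin n) → ℝ≥0∞) : ℝ≥0∞ :=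
  ∫⁻ x, q x * (energySum f x).toENNReal

/-- The projection `π_{n,k} : ℝⁿ → ℝᵏ` to the first `k` coordinates. -/
def proj {n k : ℕ} (h : k ≤ n) (x : EuclideanSpace ℝ (Fin n)) : EuclideanSpace ℝ (Fin k) :=
  WithLp.toLp 2 fun i => x (Fin.castLE h i)

/-- The Riemannian volume `σ_{n,t}` of the hypersurface `S_n(t)`: the `(n-1)`-dimensional
Hausdorff measure, in the normalization that agrees with Lebesgue measure. -/
noncomputable def surfaceMeasure (f : ℝ → EReal) (n : ℕ) (t : ℝ) :
    Measure (EuclideanSpace ℝ (Fin n)) :=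
  Measure.euclideanHausdorffMeasure (n - 1) |>.restrict (surface f n t)

/-- The gradient `(f'(x_1), …, f'(x_n))` of `R_n`. -/
noncomputable def grad (f : ℝ → EReal) {n : ℕ} (x : EuclideanSpace ℝ (Fin n)) :
    EuclideanSpace ℝ (Fin n) :=
  WithLp.toLp 2 fun i => deriv (realPart f) (x i)

/-- The unit normal at `x` to the level surface of `R_n` through `x`. -/
noncomputable def normal (f : ℝ → EReal) {n : ℕ} (x : EuclideanSpace ℝ (Fin n)) :
    EuclideanSpace ℝ (Fin n) :=
  ‖grad f x‖⁻¹ • grad f x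

/-- The factor `κ > 0` with `R_n(κ s) = r`. It is unique for `r > 0` and `s ≠ 0` with
`R_n(s) < ∞`, so the infimum is that of a one-point set. -/
noncomputable def scale (f : ℝ → EReal) {n : ℕ} (r : ℝ) (s : EuclideanSpace ℝ (Fin n)) : ℝ :=
  sInf {κ : ℝ | 0 < κ ∧ energySum f (κ • s) = (r : EReal)}

/-- The point `x = κ s` of the ray through `s` with `R_n(x) = r`: the coordinate system
`(r, s) ↦ x` on the foliation by the surfaces, given by central projection. -/
noncomputable def foliation (f : ℝ → EReal) {n : ℕ} (r : ℝ) (s : EuclideanSpace ℝ (Fin n)) :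
    EuclideanSpace ℝ (Fin n) :=
  scale f r s • s

/-- The Jacobian `A_{n,t}(r, s)` of the coordinates `(r, s) ↦ x = foliation f r s` with respect
to Lebesgue measure in `r > 0` times the Riemannian volume in `s ∈ S_n(t)`, i.e.
`dx = A_{n,t}(r, s) dr σ_{n,t}(ds)`. A tangent vector `v` at `s` is mapped to `κ v` plus a
multiple of `s`, and `∂x/∂r` is a multiple of `s`; hence the determinant is `κ ^ (n-1)` times
the component of `∂x/∂r` along the unit normal to `S_n(t)` at `s`. -/
noncomputable def jacobian (f : ℝ → EReal) {n : ℕ} (r : ℝ) (s : EuclideanSpace ℝ (Fin n)) : ℝ :=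
  scale f r s ^ (n - 1) * |⟪deriv (fun r' => foliation f r' s) r, normal f s⟫|

/-- The density `h_{n,t}(v) = A_{n,t}(nt, v) / ∫ A_{n,t}(nt, s) σ_{n,t}(ds)` on `S_n(t)`. -/
noncomputable def uniformDensity (f : ℝ → EReal) (n : ℕ) (t : ℝ)
    (v : EuclideanSpace ℝ (Fin n)) : ℝ≥0∞ :=
  ENNReal.ofReal (jacobian f (n * t) v) /
    ∫⁻ s, ENNReal.ofReal (jacobian f (n * t) s) ∂(surfaceMeasure f n t)

end GibbsSurface

namespace GibbsSurface

/-! ### Hausdorff measure of graphs -/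

section Area

theorem hausdorffMeasure_image_le_of_dist_le {X Y Z : Type*} [MetricSpace Y] [MeasurableSpace Y]
    [BorelSpace Y] [MetricSpace Z] [MeasurableSpace Z] [BorelSpace Z] {g : X → Y} {h : X → Z}
    {A : Set X} {K : NNReal} (d : ℕ)
    (hgh : ∀ x ∈ A, ∀ y ∈ A, dist (g x) (g y) ≤ K * dist (h x) (h y)) :
    Measure.euclideanHausdorffMeasure d (g '' A) ≤
      (K : ℝ≥0∞) ^ d * Measure.euclideanHausdorffMeasure d (h '' A) := by
  rcases A.eq_empty_or_nonempty with rfl | ⟨x₀, hx₀⟩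
  · simp
  have : Nonempty X := ⟨x₀⟩
  have hinv : ∀ x ∈ A, g (Function.invFunOn h A (h x)) = g x := fun x hx => by
    have hex : ∃ a ∈ A, h a = h x := ⟨x, hx, rfl⟩
    have h1 := Function.invFunOn_mem hex
    have h2 := Function.invFunOn_eq hex
    have := hgh _ h1 _ hx
    rw [h2, dist_self, mul_zero] at this
    exact dist_le_zero.1 this
  have himg : g '' A = (fun z => g (Function.invFunOn h A z)) '' (h '' A) := by
    ext z
    simp only [mem_image, exists_exists_and_eq_and]
    exact exists_congr fun x => and_congr_right fun hx => by rw [hinv x hx]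
  have hlip : LipschitzOnWith K (fun z => g (Function.invFunOn h A z)) (h '' A) := by
    refine LipschitzOnWith.of_dist_le_mul ?_
    rintro _ ⟨x, hx, rfl⟩ _ ⟨y, hy, rfl⟩
    simp only [hinv x hx, hinv y hy]
    exact hgh x hx y hy
  have := hlip.hausdorffMeasure_image_le (d := d) (by positivity)
  rw [← himg, ENNReal.rpow_natCast] at this
  simp only [Measure.euclideanHausdorffMeasure_def, Measure.smul_apply, ENNReal.smul_def,
    smul_eq_mul]
  rw [mul_left_comm]
  gcongr

variable {d : ℕ}

/-- The point `(y, a)` of `ℝᵈ⁺¹`. -/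
noncomputable def snoc (y : EuclideanSpace ℝ (Fin d)) (a : ℝ) : EuclideanSpace ℝ (Fin (d + 1)) :=
  WithLp.toLp 2 (Fin.snoc (α := fun _ => ℝ) y a)

@[simp] theorem snoc_castSucc (y : EuclideanSpace ℝ (Fin d)) (a : ℝ) (i : Fin d) :
    snoc y a i.castSucc = y i := by simp [snoc]

@[simp] theorem snoc_last (y : EuclideanSpace ℝ (Fin d)) (a : ℝ) :
    snoc y a (Fin.last d) = a := by simp [snoc]

/-- The projection of `ℝᵈ⁺¹` to the first `d` coordinates. -/
noncomputable def dropLast (x : EuclideanSpace ℝ (Fin (d + 1))) : EuclideanSpace ℝ (Fin d) :=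
  WithLp.toLp 2 fun i => x i.castSucc

@[simp] theorem dropLast_apply (x : EuclideanSpace ℝ (Fin (d + 1))) (i : Fin d) :
    dropLast x i = x i.castSucc := rfl

@[simp] theorem dropLast_snoc (y : EuclideanSpace ℝ (Fin d)) (a : ℝ) : dropLast (snoc y a) = y := by
  ext i; simp

@[simp] theorem snoc_dropLast (x : EuclideanSpace ℝ (Fin (d + 1))) :
    snoc (dropLast x) (x (Fin.last d)) = x := by
  ext i
  refine Fin.lastCases ?_ (fun j => ?_) i <;> simp

theorem measurable_dropLast : Measurable (dropLast (d := d)) := by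
  have : Continuous (dropLast (d := d)) := by unfold dropLast; fun_prop
  exact this.measurable

theorem snoc_sub_snoc (x y : EuclideanSpace ℝ (Fin d)) (a b : ℝ) :
    snoc x a - snoc y b = snoc (x - y) (a - b) := by
  ext i
  refine Fin.lastCases ?_ (fun j => ?_) i <;> simp

theorem norm_snoc_sq (y : EuclideanSpace ℝ (Fin d)) (a : ℝ) :
    ‖snoc y a‖ ^ 2 = ‖y‖ ^ 2 + a ^ 2 := by
  simp [EuclideanSpace.norm_sq_eq, Fin.sum_univ_castSucc]

theorem norm_snoc (y : EuclideanSpace ℝ (Fin d)) (a : ℝ) :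
    ‖snoc y a‖ = √(‖y‖ ^ 2 + a ^ 2) := by
  rw [← norm_snoc_sq, Real.sqrt_sq (norm_nonneg _)]

/-- The linear automorphism `T` with `‖T u‖² = ‖u‖² + ⟪v, u⟫²`. -/
noncomputable def graphMap (v : EuclideanSpace ℝ (Fin d)) :
    EuclideanSpace ℝ (Fin d) →ₗ[ℝ] EuclideanSpace ℝ (Fin d) :=
  LinearMap.transvection (innerₛₗ ℝ v) ((1 + √(1 + ‖v‖ ^ 2))⁻¹ • v)

theorem det_graphMap (v : EuclideanSpace ℝ (Fin d)) :
    LinearMap.det (graphMap v) = √(1 + ‖v‖ ^ 2) := by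
  rw [graphMap, LinearMap.transvection.det]
  simp only [innerₛₗ_apply_apply, inner_smul_right, real_inner_self_eq_norm_sq]
  have hs : √(1 + ‖v‖ ^ 2) ^ 2 = 1 + ‖v‖ ^ 2 := Real.sq_sqrt (by positivity)
  have h0 : 0 ≤ √(1 + ‖v‖ ^ 2) := Real.sqrt_nonneg _
  field_simp
  nlinarith

theorem norm_graphMap (v u : EuclideanSpace ℝ (Fin d)) :
    ‖graphMap v u‖ = √(‖u‖ ^ 2 + ⟪v, u⟫ ^ 2) := by
  rw [eq_comm, Real.sqrt_eq_iff_mul_self_eq (by positivity) (norm_nonneg _), ← sq, graphMap,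
    LinearMap.transvection.apply, norm_add_sq_real]
  simp only [innerₛₗ_apply_apply, inner_smul_right, norm_smul, Real.norm_eq_abs, mul_pow, sq_abs]
  rw [real_inner_comm u v]
  have hs : √(1 + ‖v‖ ^ 2) ^ 2 = 1 + ‖v‖ ^ 2 := Real.sq_sqrt (by positivity)
  have h0 : 0 ≤ √(1 + ‖v‖ ^ 2) := Real.sqrt_nonneg _
  have hv : ‖v‖ ^ 2 = √(1 + ‖v‖ ^ 2) ^ 2 - 1 := by linarith
  set s := √(1 + ‖v‖ ^ 2)
  rw [hv]
  field_simp
  ring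

theorem le_norm_graphMap (v u : EuclideanSpace ℝ (Fin d)) : ‖u‖ ≤ ‖graphMap v u‖ := by
  rw [norm_graphMap]
  exact Real.le_sqrt_of_sq_le (by nlinarith [sq_nonneg ⟪v, u⟫])

theorem euclideanHausdorffMeasure_image_graphMap (v : EuclideanSpace ℝ (Fin d))
    (A : Set (EuclideanSpace ℝ (Fin d))) :
    Measure.euclideanHausdorffMeasure d (graphMap v '' A) =
      ENNReal.ofReal (√(1 + ‖v‖ ^ 2)) * volume A := by
  rw [EuclideanSpace.euclideanHausdorffMeasure_eq_volume, Measure.addHaar_image_linearMap,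
    det_graphMap, abs_of_nonneg (Real.sqrt_nonneg _)]

theorem dist_snoc_sub_norm_graphMap_le {v : EuclideanSpace ℝ (Fin d)} {a b ε : ℝ}
    {x y : EuclideanSpace ℝ (Fin d)} (h : |a - b - ⟪v, x - y⟫| ≤ ε * ‖x - y‖) (hε : 0 ≤ ε) :
    |dist (snoc x a) (snoc y b) - ‖graphMap v (x - y)‖| ≤ ε * ‖graphMap v (x - y)‖ := by
  have h1 : ‖graphMap v (x - y)‖ = ‖snoc (x - y) ⟪v, x - y⟫‖ := by rw [norm_graphMap, norm_snoc]
  have h2 : dist (snoc x a) (snoc y b) = ‖snoc (x - y) (a - b)‖ := by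
    rw [dist_eq_norm, snoc_sub_snoc]
  calc |dist (snoc x a) (snoc y b) - ‖graphMap v (x - y)‖|
      ≤ ‖snoc (x - y) (a - b) - snoc (x - y) ⟪v, x - y⟫‖ := by
        rw [h1, h2]; exact abs_norm_sub_norm_le _ _
    _ = |a - b - ⟪v, x - y⟫| := by
        rw [snoc_sub_snoc, norm_snoc, sub_self]
        simp [Real.sqrt_sq_eq_abs]
    _ ≤ ε * ‖x - y‖ := h
    _ ≤ _ := by gcongr; exact le_norm_graphMap _ _

theorem measure_graph_le {v : EuclideanSpace ℝ (Fin d)} {φ : EuclideanSpace ℝ (Fin d) → ℝ}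
    {A : Set (EuclideanSpace ℝ (Fin d))} {ε : ℝ} (hε : 0 ≤ ε) (hε1 : ε < 1)
    (h : ∀ x ∈ A, ∀ y ∈ A, |φ x - φ y - ⟪v, x - y⟫| ≤ ε * ‖x - y‖) :
    Measure.euclideanHausdorffMeasure d ((fun y => snoc y (φ y)) '' A) ≤
        ENNReal.ofReal (1 + ε) ^ d * (ENNReal.ofReal (√(1 + ‖v‖ ^ 2)) * volume A) ∧
      ENNReal.ofReal (√(1 + ‖v‖ ^ 2)) * volume A ≤ ENNReal.ofReal (1 - ε)⁻¹ ^ d *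
        Measure.euclideanHausdorffMeasure d ((fun y => snoc y (φ y)) '' A) := by
  have key := fun x hx y hy => abs_le.1 (dist_snoc_sub_norm_graphMap_le (h x hx y hy) hε)
  rw [← euclideanHausdorffMeasure_image_graphMap]
  have hd : ∀ x y, dist (graphMap v x) (graphMap v y) = ‖graphMap v (x - y)‖ := fun x y => by
    rw [dist_eq_norm, map_sub]
  constructor
  · refine hausdorffMeasure_image_le_of_dist_le (K := (1 + ε).toNNReal) d fun x hx y hy => ?_
    rw [hd, Real.coe_toNNReal _ (by linarith)]
    linarith [(key x hx y hy).2]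
  · refine hausdorffMeasure_image_le_of_dist_le (K := ((1 - ε)⁻¹).toNNReal) d fun x hx y hy => ?_
    have h1 : 0 < 1 - ε := by linarith
    rw [hd, Real.coe_toNNReal _ (by positivity), inv_mul_eq_div, le_div_iff₀ h1]
    linarith [(key x hx y hy).1]

theorem measure_le_of_locally_le {α : Type*} [TopologicalSpace α] [SecondCountableTopology α]
    [MeasurableSpace α] [OpensMeasurableSpace α] {μ ν : Measure α} {U : Set α} {c : ℝ≥0∞}
    (h : ∀ y ∈ U, ∃ N ∈ 𝓝 y, ∀ A ⊆ N ∩ U, MeasurableSet A → μ A ≤ c * ν A)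
    {A : Set α} (hA : MeasurableSet A) (hAU : A ⊆ U) : μ A ≤ c * ν A := by
  choose! N hN hNle using h
  obtain ⟨t, htU, htc, hcov⟩ := TopologicalSpace.countable_cover_nhdsWithin
    (f := fun y => interior (N y)) (s := U)
    (fun y hy => mem_nhdsWithin_of_mem_nhds (interior_mem_nhds.2 (hN y hy)))
  rcases t.eq_empty_or_nonempty with rfl | hne
  · have : A = ∅ := subset_eq_empty (hAU.trans (by simpa using hcov)) rfl
    simp [this]
  obtain ⟨e, rfl⟩ := htc.exists_eq_range hne
  set I : ℕ → Set α := fun n => interior (N (e n)) with hI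
  have hUI : U ⊆ ⋃ n, I n := by simpa [hI] using hcov
  have hIm : ∀ n, MeasurableSet (disjointed I n) :=
    MeasurableSet.disjointed fun n => isOpen_interior.measurableSet
  have hAeq : A = ⋃ n, A ∩ disjointed I n := by
    rw [← inter_iUnion, iUnion_disjointed, inter_eq_left.2 (hAU.trans hUI)]
  have hdis : Pairwise (Function.onFun Disjoint fun n => A ∩ disjointed I n) := fun i j hij =>
    (disjoint_disjointed I hij).mono inter_subset_right inter_subset_right
  rw [hAeq, measure_iUnion hdis fun n => hA.inter (hIm n),
    measure_iUnion hdis fun n => hA.inter (hIm n), ← ENNReal.tsum_mul_left]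
  refine ENNReal.tsum_le_tsum fun n => hNle (e n) (htU ⟨n, rfl⟩) _ ?_ (hA.inter (hIm n))
  exact fun x hx => ⟨interior_subset (disjointed_subset I n hx.2), hAU hx.1⟩

theorem measure_restrict_eq_of_locally {α : Type*} [TopologicalSpace α] [SecondCountableTopology α]
    [MeasurableSpace α] [OpensMeasurableSpace α] {μ ν : Measure α} {U : Set α}
    (hU : MeasurableSet U)
    (h : ∀ c : ℝ, 1 < c → ∀ y ∈ U, ∃ N ∈ 𝓝 y, ∀ A ⊆ N ∩ U, MeasurableSet A →
      μ A ≤ ENNReal.ofReal c * ν A ∧ ν A ≤ ENNReal.ofReal c * μ A) :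
    μ.restrict U = ν.restrict U := by
  have lim : ∀ a b : ℝ≥0∞, (∀ c : ℝ, 1 < c → a ≤ ENNReal.ofReal c * b) → a ≤ b := by
    intro a b hab
    have ht : Tendsto (fun c : ℝ => ENNReal.ofReal c * b) (𝓝[>] 1) (𝓝 (ENNReal.ofReal 1 * b)) := by
      refine ENNReal.Tendsto.mul_const ?_ (Or.inl (by simp))
      exact (ENNReal.continuous_ofReal.tendsto 1).mono_left nhdsWithin_le_nhds
    rw [ENNReal.ofReal_one, one_mul] at ht
    exact ge_of_tendsto ht (by filter_upwards [self_mem_nhdsWithin] with c hc using hab c hc)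
  ext A hA
  rw [Measure.restrict_apply hA, Measure.restrict_apply hA]
  refine le_antisymm (lim _ _ fun c hc => ?_) (lim _ _ fun c hc => ?_)
  · refine measure_le_of_locally_le (U := U) (fun y hy => ?_) (hA.inter hU) inter_subset_right
    obtain ⟨N, hN, H⟩ := h c hc y hy
    exact ⟨N, hN, fun A hA hm => (H A hA hm).1⟩
  · refine measure_le_of_locally_le (U := U) (fun y hy => ?_) (hA.inter hU) inter_subset_right
    obtain ⟨N, hN, H⟩ := h c hc y hy
    exact ⟨N, hN, fun A hA hm => (H A hA hm).2⟩

/-- The projection to `ℝᵈ` of the Hausdorff measure of the graph of a `C¹` function. -/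
theorem map_dropLast_graph {φ : EuclideanSpace ℝ (Fin d) → ℝ}
    {g : EuclideanSpace ℝ (Fin d) → EuclideanSpace ℝ (Fin d)} {U : Set (EuclideanSpace ℝ (Fin d))}
    (hU : IsOpen U) (hφ : ∀ y ∈ U, HasStrictFDerivAt φ (innerSL ℝ (g y)) y)
    (hg : ContinuousOn g U) :
    (((Measure.euclideanHausdorffMeasure d).restrict ((fun y => snoc y (φ y)) '' U)).map
      dropLast) =
      (volume.restrict U).withDensity fun y => ENNReal.ofReal (√(1 + ‖g y‖ ^ 2)) := by
  set Φ := (((Measure.euclideanHausdorffMeasure d).restrict ((fun y => snoc y (φ y)) '' U)).map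
      dropLast) with hΦ
  set J : EuclideanSpace ℝ (Fin d) → ℝ := fun y => √(1 + ‖g y‖ ^ 2) with hJ
  have hΦA : ∀ A, MeasurableSet A →
      Φ A = Measure.euclideanHausdorffMeasure d ((fun y => snoc y (φ y)) '' (A ∩ U)) := by
    intro A hA
    rw [hΦ, Measure.map_apply measurable_dropLast hA,
      Measure.restrict_apply (measurable_dropLast hA)]
    congr 1
    ext x
    simp only [mem_inter_iff, mem_preimage, mem_image]
    constructor
    · rintro ⟨h1, y, hy, rfl⟩
      exact ⟨y, ⟨by simpa using h1, hy⟩, rfl⟩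
    · rintro ⟨y, ⟨h1, h2⟩, rfl⟩
      exact ⟨by simpa using h1, y, h2, rfl⟩
  have hΦU : Φ.restrict U = Φ := by
    refine Measure.restrict_eq_self_of_ae_mem (?_ : ∀ᵐ y ∂Φ, y ∈ U)
    rw [ae_iff, show {a | a ∉ U} = Uᶜ from rfl, hΦA _ hU.measurableSet.compl]
    simp
  rw [← hΦU, ← restrict_withDensity hU.measurableSet]
  refine measure_restrict_eq_of_locally hU.measurableSet fun c hc y hy => ?_
  have hJc : ContinuousAt J y := by
    have := (hg.continuousAt (hU.mem_nhds hy))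
    fun_prop
  have hJpos : ∀ z, 0 < J z := fun z => by positivity
  obtain ⟨ε, hε0, hε1, hεc, hεc'⟩ : ∃ ε : ℝ, 0 < ε ∧ ε < 1 ∧ (1 + ε) ^ d * (1 + ε) ≤ c ∧
      (1 + ε) * ((1 - ε)⁻¹) ^ d ≤ c := by
    have h1 : Tendsto (fun ε : ℝ => (1 + ε) ^ d * (1 + ε)) (𝓝 0) (𝓝 ((1 + 0) ^ d * (1 + 0))) := by
      apply Continuous.tendsto; fun_prop
    have h2 : Tendsto (fun ε : ℝ => (1 + ε) * ((1 - ε)⁻¹) ^ d) (𝓝 0)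
        (𝓝 ((1 + 0) * ((1 - 0)⁻¹) ^ d)) := by
      apply ContinuousAt.tendsto
      have : (1 - (0 : ℝ)) ≠ 0 := by norm_num
      fun_prop (disch := assumption)
    norm_num at h1 h2
    have := ((h1.eventually (ge_mem_nhds hc)).and (h2.eventually (ge_mem_nhds hc))).filter_mono
      (nhdsWithin_le_nhds (s := Ioi 0))
    obtain ⟨ε, ⟨h3, h4⟩, h5, h6⟩ :=
      (this.and (Ioo_mem_nhdsGT (show (0 : ℝ) < 1 by norm_num))).exists
    exact ⟨ε, h5, h6, h3, by simpa using h4⟩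
  obtain ⟨N₁, hN₁, hlin⟩ : ∃ N₁ ∈ 𝓝 y, ∀ a ∈ N₁, ∀ b ∈ N₁,
      |φ a - φ b - ⟪g y, a - b⟫| ≤ ε * ‖a - b‖ := by
    have := (hφ y hy).isLittleO.def hε0
    rw [nhds_prod_eq, eventually_prod_self_iff'] at this
    obtain ⟨N₁, hN₁, h⟩ := this
    exact ⟨N₁, hN₁, fun a ha b hb => by simpa using h a ha b hb⟩
  have hN₂ : ∀ᶠ z in 𝓝 y, J y ≤ (1 + ε) * J z ∧ J z ≤ (1 + ε) * J y := by
    refine Eventually.and ?_ ?_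
    · have : Tendsto (fun z => (1 + ε) * J z) (𝓝 y) (𝓝 ((1 + ε) * J y)) := hJc.const_mul _
      exact this.eventually (le_mem_nhds (by nlinarith [hJpos y]))
    · exact hJc.eventually (ge_mem_nhds (by nlinarith [hJpos y]))
  refine ⟨N₁ ∩ {z | J y ≤ (1 + ε) * J z ∧ J z ≤ (1 + ε) * J y}, inter_mem hN₁ hN₂,
    fun A hA hAm => ?_⟩
  obtain ⟨ub, lb⟩ := measure_graph_le (v := g y) (φ := φ) (A := A) hε0.le hε1
    fun a ha b hb => hlin a (hA ha).1.1 b (hA hb).1.1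
  have hAU : A ∩ U = A := inter_eq_left.2 fun a ha => (hA ha).2
  rw [hΦA A hAm, hAU, withDensity_apply _ hAm]
  set m := Measure.euclideanHausdorffMeasure d ((fun y => snoc y (φ y)) '' A)
  have e1 : ENNReal.ofReal (J y) * volume A ≤
      ENNReal.ofReal (1 + ε) * ∫⁻ z in A, ENNReal.ofReal (J z) := by
    rw [← lintegral_const_mul' _ _ ENNReal.ofReal_ne_top, ← setLIntegral_const]
    refine setLIntegral_mono' hAm fun z hz => ?_
    rw [← ENNReal.ofReal_mul (by linarith)]
    exact ENNReal.ofReal_le_ofReal (hA hz).1.2.1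
  have e2 : ∫⁻ z in A, ENNReal.ofReal (J z) ≤
      ENNReal.ofReal (1 + ε) * (ENNReal.ofReal (J y) * volume A) := by
    rw [← mul_assoc, ← setLIntegral_const]
    refine setLIntegral_mono' hAm fun z hz => ?_
    rw [← ENNReal.ofReal_mul (by linarith)]
    exact ENNReal.ofReal_le_ofReal (hA hz).1.2.2
  constructor
  · calc m ≤ ENNReal.ofReal (1 + ε) ^ d * (ENNReal.ofReal (J y) * volume A) := ub
      _ ≤ ENNReal.ofReal (1 + ε) ^ d *
          (ENNReal.ofReal (1 + ε) * ∫⁻ z in A, ENNReal.ofReal (J z)) := by gcongr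
      _ = ENNReal.ofReal ((1 + ε) ^ d * (1 + ε)) * ∫⁻ z in A, ENNReal.ofReal (J z) := by
        rw [ENNReal.ofReal_mul (by positivity), ENNReal.ofReal_pow (by linarith), mul_assoc]
      _ ≤ _ := by gcongr
  · calc ∫⁻ z in A, ENNReal.ofReal (J z)
        ≤ ENNReal.ofReal (1 + ε) * (ENNReal.ofReal (J y) * volume A) := e2
      _ ≤ ENNReal.ofReal (1 + ε) * (ENNReal.ofReal (1 - ε)⁻¹ ^ d * m) := by gcongr
      _ = ENNReal.ofReal ((1 + ε) * ((1 - ε)⁻¹) ^ d) * m := by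
        rw [ENNReal.ofReal_mul (by positivity), ENNReal.ofReal_pow
          (inv_nonneg.2 (by linarith)), mul_assoc]
      _ ≤ _ := by gcongr

end Area

/-! ### A uniform Gaussian approximation for powers of characteristic functions -/

section Laplace

theorem norm_pow_sub_pow_le_of_norm_le {x y : ℂ} {R : ℝ} (hx : ‖x‖ ≤ R) (hy : ‖y‖ ≤ R) (M : ℕ) :
    ‖x ^ (M + 1) - y ^ (M + 1)‖ ≤ (M + 1) * R ^ M * ‖x - y‖ := by
  have hR : 0 ≤ R := (norm_nonneg x).trans hx
  induction M with
  | zero => simp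
  | succ M ih =>
    have : x ^ (M + 1 + 1) - y ^ (M + 1 + 1) =
        x * (x ^ (M + 1) - y ^ (M + 1)) + (x - y) * y ^ (M + 1) := by ring
    rw [this]
    calc _ ≤ ‖x‖ * ‖x ^ (M + 1) - y ^ (M + 1)‖ + ‖x - y‖ * ‖y‖ ^ (M + 1) := by
          refine (norm_add_le _ _).trans ?_
          rw [norm_mul, norm_mul, norm_pow]
      _ ≤ R * ((M + 1) * R ^ M * ‖x - y‖) + ‖x - y‖ * R ^ (M + 1) := by gcongr
      _ = _ := by push_cast; ring

theorem abs_cube_mul_exp_le {b : ℝ} (hb : 0 < b) (x : ℝ) :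
    |x| ^ 3 * Real.exp (-b * x ^ 2) ≤ 2 / (b * √b) * Real.exp (-(b / 2) * x ^ 2) := by
  have hs : √b ^ 2 = b := Real.sq_sqrt hb.le
  have hs0 : 0 < √b := Real.sqrt_pos.2 hb
  set y := √b * |x| with hy
  have hy0 : 0 ≤ y := by positivity
  have hy2 : y ^ 2 = b * x ^ 2 := by rw [hy, mul_pow, hs, sq_abs]
  have h1 : y ^ 3 ≤ 2 * Real.exp (y ^ 2 / 2) := by
    have := Real.quadratic_le_exp_of_nonneg (x := y ^ 2 / 2) (by positivity)
    nlinarith [mul_nonneg (sq_nonneg y) (sq_nonneg (y - 2)), sq_nonneg y]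
  have h2 : |x| ^ 3 = y ^ 3 / (b * √b) := by
    rw [hy, eq_div_iff (by positivity), mul_pow, show √b ^ 3 = √b ^ 2 * √b by ring, hs]; ring
  have h3 : Real.exp (-(b / 2) * x ^ 2) = Real.exp (y ^ 2 / 2) * Real.exp (-b * x ^ 2) := by
    rw [← Real.exp_add, hy2]; ring_nf
  rw [h2, h3]
  calc y ^ 3 / (b * √b) * Real.exp (-b * x ^ 2)
      ≤ 2 * Real.exp (y ^ 2 / 2) / (b * √b) * Real.exp (-b * x ^ 2) := by gcongr
    _ = _ := by ring

theorem integrable_abs_cube_mul_exp {b : ℝ} (hb : 0 < b) :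
    Integrable fun x : ℝ => |x| ^ 3 * Real.exp (-b * x ^ 2) := by
  refine ((integrable_exp_neg_mul_sq (half_pos hb)).const_mul (2 / (b * √b))).mono'
    (by fun_prop) (ae_of_all _ fun x => ?_)
  rw [Real.norm_of_nonneg (by positivity)]
  exact abs_cube_mul_exp_le hb x

theorem integral_abs_cube_mul_exp_le {b : ℝ} (hb : 0 < b) :
    ∫ x : ℝ, |x| ^ 3 * Real.exp (-b * x ^ 2) ≤ 2 * √(2 * Real.pi) / b ^ 2 := by
  calc ∫ x : ℝ, |x| ^ 3 * Real.exp (-b * x ^ 2)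
      ≤ ∫ x : ℝ, 2 / (b * √b) * Real.exp (-(b / 2) * x ^ 2) :=
        integral_mono (integrable_abs_cube_mul_exp hb)
          ((integrable_exp_neg_mul_sq (half_pos hb)).const_mul _) (abs_cube_mul_exp_le hb)
    _ = 2 * √(2 * Real.pi) / b ^ 2 := by
        rw [integral_const_mul, integral_gaussian,
          show Real.pi / (b / 2) = 2 * Real.pi / b by field_simp, Real.sqrt_div (by positivity)]
        have hs : √b ^ 2 = b := Real.sq_sqrt hb.le
        have hs0 : 0 < √b := Real.sqrt_pos.2 hb
        field_simp
        rw [hs]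

theorem exists_integral_pow_sub_gaussian_le {ψ : ℝ → ℂ} {a K : ℝ} {r : ℕ} (hr : 2 ≤ r)
    (ha : 0 < a) (hψm : Continuous ψ) (hψi : Integrable fun ξ => ‖ψ ξ‖ ^ r)
    (hψ1 : ∀ ξ, ‖ψ ξ - (1 - a * ξ ^ 2 : ℝ)‖ ≤ K * |ξ| ^ 3)
    (hψ2 : ∀ δ > 0, ∃ ρ < 1, 0 ≤ ρ ∧ ∀ ξ, δ ≤ |ξ| → ‖ψ ξ‖ ≤ ρ) :
    ∃ C > 0, ∀ M : ℕ, r ≤ M →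
      Integrable (fun ξ => ψ ξ ^ M - (Real.exp (-(a * M) * ξ ^ 2) : ℂ)) ∧
      ∫ ξ, ‖ψ ξ ^ M - (Real.exp (-(a * M) * ξ ^ 2) : ℂ)‖ ≤ C / M := by
  have hK : 0 ≤ K := by simpa using (norm_nonneg _).trans (hψ1 1)
  obtain ⟨δ, hδ0, hδ1, hδa, hδK⟩ : ∃ δ : ℝ, 0 < δ ∧ δ ≤ 1 ∧ a * δ ≤ 1 ∧ K * δ ≤ a / 2 := by
    refine ⟨min 1 (min (1 / a) (a / 2 / (K + 1))), by positivity, min_le_left _ _, ?_, ?_⟩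
    · rw [← le_div_iff₀' ha]
      exact (min_le_right _ _).trans (min_le_left _ _)
    · have : min 1 (min (1 / a) (a / 2 / (K + 1))) ≤ a / 2 / (K + 1) :=
        (min_le_right _ _).trans (min_le_right _ _)
      rw [le_div_iff₀ (by positivity)] at this
      have h0 : 0 ≤ min 1 (min (1 / a) (a / 2 / (K + 1))) := by positivity
      nlinarith
  obtain ⟨ρ, hρ1, hρ0, hρ⟩ := hψ2 δ hδ0
  set I := ∫ ξ, ‖ψ ξ‖ ^ r
  have hI : 0 ≤ I := integral_nonneg fun ξ => by positivity
  obtain ⟨B, hB⟩ : ∃ B : ℝ, ∀ M : ℕ, M * ρ ^ M ≤ B := by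
    have := (tendsto_self_mul_const_pow_of_lt_one hρ0 hρ1).bddAbove_range
    obtain ⟨B, hB⟩ := this
    exact ⟨B, fun M => hB ⟨M, rfl⟩⟩
  have near : ∀ M : ℕ, r ≤ M → ∀ ξ, |ξ| ≤ δ →
      ‖ψ ξ ^ M - (Real.exp (-(a * M) * ξ ^ 2) : ℂ)‖ ≤
        M * (K + a ^ 2) * (|ξ| ^ 3 * Real.exp (-(a * M / 4) * ξ ^ 2)) := by
    intro M hM ξ hξ
    have hξ0 := abs_nonneg ξ
    have hsq : ξ ^ 2 = |ξ| ^ 2 := (sq_abs ξ).symm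
    have hax : a * ξ ^ 2 ≤ 1 := by
      rw [hsq]; nlinarith [mul_nonneg ha.le hξ0]
    have hax0 : 0 ≤ a * ξ ^ 2 := by positivity
    have e1 : ‖ψ ξ‖ ≤ Real.exp (-(a / 2) * ξ ^ 2) := by
      have h1 : ‖ψ ξ‖ ≤ (1 - a * ξ ^ 2) + K * |ξ| ^ 3 := by
        have := norm_add_le (ψ ξ - (1 - a * ξ ^ 2 : ℝ)) ((1 - a * ξ ^ 2 : ℝ) : ℂ)
        rw [sub_add_cancel, Complex.norm_real, Real.norm_of_nonneg (by linarith)] at this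
        linarith [hψ1 ξ]
      have h2 : K * |ξ| ^ 3 ≤ a / 2 * ξ ^ 2 := by
        rw [hsq]
        have : K * |ξ| ≤ a / 2 := (mul_le_mul_of_nonneg_left hξ hK).trans hδK
        nlinarith [sq_nonneg |ξ|]
      have := Real.add_one_le_exp (-(a / 2) * ξ ^ 2)
      linarith
    have e2 : ‖(Real.exp (-a * ξ ^ 2) : ℂ)‖ ≤ Real.exp (-(a / 2) * ξ ^ 2) := by
      rw [Complex.norm_real, Real.norm_of_nonneg (Real.exp_nonneg _)]
      exact Real.exp_le_exp.2 (by linarith)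
    have e3 : ‖ψ ξ - (Real.exp (-a * ξ ^ 2) : ℂ)‖ ≤ (K + a ^ 2) * |ξ| ^ 3 := by
      have h1 : |Real.exp (-a * ξ ^ 2) - 1 - (-a * ξ ^ 2)| ≤ (-a * ξ ^ 2) ^ 2 :=
        Real.abs_exp_sub_one_sub_id_le (by rw [neg_mul, abs_neg, abs_of_nonneg hax0]; exact hax)
      have h2 : ψ ξ - (Real.exp (-a * ξ ^ 2) : ℂ) = (ψ ξ - (1 - a * ξ ^ 2 : ℝ)) -
          ((Real.exp (-a * ξ ^ 2) - 1 - (-a * ξ ^ 2) : ℝ) : ℂ) := by push_cast; ring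
      rw [h2]
      refine (norm_sub_le _ _).trans ?_
      rw [Complex.norm_real, Real.norm_eq_abs]
      have h3 : (-a * ξ ^ 2) ^ 2 ≤ a ^ 2 * |ξ| ^ 3 := by
        rw [hsq]
        have : |ξ| ^ 4 ≤ |ξ| ^ 3 := pow_le_pow_of_le_one hξ0 (hξ.trans hδ1) (by norm_num)
        nlinarith [sq_nonneg a]
      linarith [hψ1 ξ]
    obtain ⟨N, rfl⟩ : ∃ N, M = N + 1 := ⟨M - 1, by omega⟩
    have e4 : (Real.exp (-(a * (N + 1 : ℕ)) * ξ ^ 2) : ℂ) = (Real.exp (-a * ξ ^ 2) : ℂ) ^ (N + 1) := by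
      rw [← Complex.ofReal_pow, ← Real.exp_nat_mul]; push_cast; ring_nf
    have e5 : Real.exp (-(a / 2) * ξ ^ 2) ^ N ≤ Real.exp (-(a * (N + 1 : ℕ) / 4) * ξ ^ 2) := by
      rw [← Real.exp_nat_mul]
      refine Real.exp_le_exp.2 ?_
      have : (1 : ℝ) ≤ N := by exact_mod_cast (by omega : 1 ≤ N)
      push_cast
      nlinarith
    rw [e4]
    refine (norm_pow_sub_pow_le_of_norm_le e1 e2 N).trans ?_
    calc (N + 1) * Real.exp (-(a / 2) * ξ ^ 2) ^ N * ‖ψ ξ - (Real.exp (-a * ξ ^ 2) : ℂ)‖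
        ≤ (N + 1) * Real.exp (-(a * (N + 1 : ℕ) / 4) * ξ ^ 2) * ((K + a ^ 2) * |ξ| ^ 3) := by gcongr
      _ = _ := by push_cast; ring
  have far : ∀ M : ℕ, r ≤ M → ∀ ξ, δ ≤ |ξ| →
      ‖ψ ξ ^ M - (Real.exp (-(a * M) * ξ ^ 2) : ℂ)‖ ≤
        (1 / δ ^ 3) * (|ξ| ^ 3 * Real.exp (-(a * M / 4) * ξ ^ 2)) + ρ ^ (M - r) * ‖ψ ξ‖ ^ r := by
    intro M hM ξ hξ
    refine (norm_sub_le _ _).trans ?_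
    rw [add_comm]
    gcongr
    · rw [Complex.norm_real, Real.norm_of_nonneg (Real.exp_nonneg _)]
      have h1 : Real.exp (-(a * M) * ξ ^ 2) ≤ Real.exp (-(a * M / 4) * ξ ^ 2) := by
        refine Real.exp_le_exp.2 ?_
        have : 0 ≤ a * M * ξ ^ 2 := by positivity
        nlinarith
      have h2 : 1 ≤ 1 / δ ^ 3 * |ξ| ^ 3 := by
        rw [one_div, inv_mul_eq_div, one_le_div (by positivity)]
        gcongr
      calc _ ≤ 1 * Real.exp (-(a * M / 4) * ξ ^ 2) := by rw [one_mul]; exact h1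
        _ ≤ (1 / δ ^ 3 * |ξ| ^ 3) * Real.exp (-(a * M / 4) * ξ ^ 2) := by gcongr
        _ = _ := by ring
    · rw [norm_pow, ← Nat.sub_add_cancel hM, pow_add, Nat.add_sub_cancel]
      gcongr
      exact hρ ξ hξ
  have all : ∀ M : ℕ, r ≤ M → ∀ ξ,
      ‖ψ ξ ^ M - (Real.exp (-(a * M) * ξ ^ 2) : ℂ)‖ ≤
        (M * (K + a ^ 2) + 1 / δ ^ 3) * (|ξ| ^ 3 * Real.exp (-(a * M / 4) * ξ ^ 2)) +
          ρ ^ (M - r) * ‖ψ ξ‖ ^ r := by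
    intro M hM ξ
    have p1 : 0 ≤ |ξ| ^ 3 * Real.exp (-(a * M / 4) * ξ ^ 2) := by positivity
    have p2 : 0 ≤ ρ ^ (M - r) * ‖ψ ξ‖ ^ r := by positivity
    have p3 : 0 ≤ 1 / δ ^ 3 := by positivity
    have p4 : 0 ≤ M * (K + a ^ 2) := by positivity
    rcases le_total |ξ| δ with h | h
    · nlinarith [near M hM ξ h]
    · nlinarith [far M hM ξ h]
  set D := (K + a ^ 2 + 1 / δ ^ 3) * (2 * √(2 * Real.pi)) * (16 / a ^ 2) with hD
  have hB0 : 0 ≤ B := by simpa using hB 0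
  refine ⟨D + (B / ρ ^ r + r) * I + 1, ?_, fun M hM => ?_⟩
  · positivity
  have hM1 : (1 : ℝ) ≤ M := by exact_mod_cast (by omega : 1 ≤ M)
  have hb : 0 < a * M / 4 := by positivity
  have hint := ((integrable_abs_cube_mul_exp hb).const_mul (M * (K + a ^ 2) + 1 / δ ^ 3)).add
    (hψi.const_mul (ρ ^ (M - r)))
  refine ⟨hint.mono' (by fun_prop) (ae_of_all _ (all M hM)), ?_⟩
  refine (integral_mono_of_nonneg (ae_of_all _ fun ξ => norm_nonneg _) hint
    (ae_of_all _ (all M hM))).trans ?_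
  simp only [Pi.add_apply]
  rw [integral_add ((integrable_abs_cube_mul_exp hb).const_mul _) (hψi.const_mul _),
    integral_const_mul, integral_const_mul]
  have t1 : (M * (K + a ^ 2) + 1 / δ ^ 3) * ∫ ξ : ℝ, |ξ| ^ 3 * Real.exp (-(a * M / 4) * ξ ^ 2) ≤
      D / M := by
    calc _ ≤ (M * (K + a ^ 2) + M * (1 / δ ^ 3)) * (2 * √(2 * Real.pi) / (a * M / 4) ^ 2) := by
          gcongr
          · exact le_mul_of_one_le_left (by positivity) hM1
          · exact integral_abs_cube_mul_exp_le hb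
      _ = D / M := by rw [hD]; field_simp; ring
  have t2 : ρ ^ (M - r) ≤ (B / ρ ^ r + r) / M := by
    rw [le_div_iff₀ (by positivity)]
    rcases hρ0.eq_or_lt with rfl | hρpos
    · rcases hM.eq_or_lt with rfl | h
      · simp only [tsub_self, pow_zero, one_mul]
        have : 0 ≤ B / 0 ^ r := by positivity
        linarith
      · rw [zero_pow (by omega)]
        simp only [zero_mul]
        positivity
    · have : ρ ^ (M - r) * M = M * ρ ^ M / ρ ^ r := by
        rw [eq_div_iff (by positivity), mul_right_comm, ← pow_add, Nat.sub_add_cancel hM, mul_comm]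
      rw [this]
      have h2 : M * ρ ^ M / ρ ^ r ≤ B / ρ ^ r := by gcongr; exact hB M
      have : (0 : ℝ) ≤ r := by positivity
      linarith
  calc _ ≤ D / M + (B / ρ ^ r + r) / M * I := by gcongr
    _ = (D + (B / ρ ^ r + r) * I) / M := by ring
    _ ≤ _ := div_le_div_of_nonneg_right (by linarith) (by positivity)

end Laplace

/-! ### Convolution powers of a density on the line -/

section ConvPow

/-- The `(m + 1)`-fold convolution power of `w`. -/
noncomputable def convPow (w : ℝ → ℝ≥0∞) : ℕ → ℝ → ℝ≥0∞
  | 0 => w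
  | m + 1 => w ⋆ₗ convPow w m

variable {w : ℝ → ℝ≥0∞}

theorem measurable_convPow (hw : Measurable w) (m : ℕ) : Measurable (convPow w m) := by
  induction m with
  | zero => exact hw
  | succ m ih => exact measurable_lconvolution _ hw ih

theorem convPow_add (hw : Measurable w) (i m : ℕ) :
    convPow w (i + m + 1) = convPow w i ⋆ₗ convPow w m := by
  induction i with
  | zero => simp [convPow]
  | succ i ih =>
    rw [show i + 1 + m + 1 = (i + m + 1) + 1 by ring, convPow, ih, convPow,
      lconvolution_assoc hw (measurable_convPow hw i) (measurable_convPow hw m)]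

theorem lintegral_convPow (hw : Measurable w) (h1 : ∫⁻ x, w x = 1) (m : ℕ) :
    ∫⁻ x, convPow w m x = 1 := by
  induction m with
  | zero => exact h1
  | succ m ih =>
    have := congrArg (fun μ : Measure ℝ => μ univ)
      (conv_withDensity_eq_lconvolution (μ := volume) hw (measurable_convPow hw m))
    simp only [withDensity_apply _ MeasurableSet.univ, Measure.restrict_univ] at this
    rw [convPow, ← this, Measure.conv, Measure.map_apply (by fun_prop) MeasurableSet.univ,
      preimage_univ, ← univ_prod_univ, Measure.prod_prod,
      withDensity_apply _ MeasurableSet.univ, withDensity_apply _ MeasurableSet.univ,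
      Measure.restrict_univ, h1, ih, one_mul]

theorem isProbabilityMeasure_convPow (hw : Measurable w) (h1 : ∫⁻ x, w x = 1) (m : ℕ) :
    IsProbabilityMeasure (volume.withDensity (convPow w m)) :=
  ⟨by rw [withDensity_apply _ MeasurableSet.univ, Measure.restrict_univ, lintegral_convPow hw h1]⟩

theorem charFun_convPow (hw : Measurable w) (h1 : ∫⁻ x, w x = 1) (m : ℕ) (ξ : ℝ) :
    charFun (volume.withDensity (convPow w m)) ξ = charFun (volume.withDensity w) ξ ^ (m + 1) := by
  have := isProbabilityMeasure_convPow hw h1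
  have h0 : IsProbabilityMeasure (volume.withDensity w) := this 0
  induction m with
  | zero => simp [convPow]
  | succ m ih =>
    have := this m
    rw [convPow, ← conv_withDensity_eq_lconvolution hw (measurable_convPow hw m), charFun_conv, ih,
      pow_succ' _ (m + 1)]

theorem lconvolution_le {u v : ℝ → ℝ≥0∞} {B : ℝ≥0∞} (hB : B ≠ ⊤) (hv : ∀ x, v x ≤ B) (x : ℝ) :
    (u ⋆ₗ v) x ≤ (∫⁻ y, u y) * B := by
  rw [lconvolution_def, ← lintegral_mul_const' _ _ hB]
  exact lintegral_mono fun y => mul_le_mul_right (hv _) _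

theorem convPow_le_of_le (h1 : ∫⁻ x, w x = 1) {B : ℝ≥0∞} (hB : B ≠ ⊤)
    {J : ℕ} (hJ : ∀ x, convPow w J x ≤ B) {m : ℕ} (hm : J ≤ m) (x : ℝ) : convPow w m x ≤ B := by
  induction m, hm using Nat.le_induction generalizing x with
  | base => exact hJ x
  | succ m _ ih => simpa [convPow, h1] using lconvolution_le (u := w) hB ih x

/-- The kernel `u^(α-1) (s-u)^(β-1)` on `0 < u < s` integrates to a multiple of `s^(α+β-1)`. -/
theorem exists_lintegral_rpow_mul_rpow_le {α β : ℝ} (hα : 0 < α) (hβ : 0 < β) :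
    ∃ B : ℝ, 0 ≤ B ∧ ∀ s : ℝ, 0 < s →
      ∫⁻ u in Ioo 0 s, ENNReal.ofReal (u ^ (α - 1) * (s - u) ^ (β - 1)) ≤
        ENNReal.ofReal (B * s ^ (α + β - 1)) := by
  refine ⟨beta α β, (beta_pos hα hβ).le, fun s hs => ?_⟩
  have hbp := beta_pos hα hβ
  have himg : (fun x : ℝ => s * x) '' Ioo 0 1 = Ioo 0 s := by
    rw [image_mul_left_Ioo hs]; simp
  rw [← himg, lintegral_image_eq_lintegral_abs_deriv_mul measurableSet_Ioo
    (f' := fun _ => s) (fun x _ => by simpa using ((hasDerivAt_id x).const_mul s).hasDerivWithinAt)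
    (fun x _ y _ h => mul_left_cancel₀ hs.ne' h)]
  have heq : ∀ x ∈ Ioo (0 : ℝ) 1, ENNReal.ofReal |s| *
      ENNReal.ofReal ((s * x) ^ (α - 1) * (s - s * x) ^ (β - 1)) =
      ENNReal.ofReal (beta α β * s ^ (α + β - 1)) *
        ENNReal.ofReal (1 / beta α β * x ^ (α - 1) * (1 - x) ^ (β - 1)) := by
    intro x hx
    rw [← ENNReal.ofReal_mul (abs_nonneg _), ← ENNReal.ofReal_mul (by positivity),
      abs_of_pos hs, Real.mul_rpow hs.le hx.1.le, show s - s * x = s * (1 - x) by ring,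
      Real.mul_rpow hs.le (by linarith [hx.2]),
      show α + β - 1 = 1 + (α - 1) + (β - 1) by ring, Real.rpow_add hs, Real.rpow_add hs,
      Real.rpow_one]
    congr 1
    field_simp
  rw [setLIntegral_congr_fun measurableSet_Ioo heq, lintegral_const_mul' _ _ ENNReal.ofReal_ne_top,
    ← lintegral_betaPDF, lintegral_betaPDF_eq_one hα hβ, mul_one]

theorem exists_convPow_le_rpow {α K : ℝ} (hα : 0 < α) (hK : 0 ≤ K)
    (hwn : ∀ x ≤ 0, w x = 0) (hwp : ∀ x > 0, w x ≤ ENNReal.ofReal (K * x ^ (α - 1))) (m : ℕ) :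
    ∃ B : ℝ, 0 ≤ B ∧ (∀ x ≤ 0, convPow w m x = 0) ∧
      ∀ x > 0, convPow w m x ≤ ENNReal.ofReal (B * x ^ ((m + 1) * α - 1)) := by
  induction m with
  | zero => exact ⟨K, hK, hwn, by simpa [convPow] using hwp⟩
  | succ m ih =>
    obtain ⟨B, hB, hn, hp⟩ := ih
    obtain ⟨b, hb, hbeta⟩ := exists_lintegral_rpow_mul_rpow_le hα
      (show 0 < (m + 1) * α by positivity)
    refine ⟨K * B * b, by positivity, fun x hx => ?_, fun x hx => ?_⟩
    · rw [convPow, lconvolution_def]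
      refine (lintegral_congr fun y => ?_).trans lintegral_zero
      rcases le_or_gt y 0 with hy | hy
      · rw [hwn y hy, zero_mul]
      · rw [hn _ (by linarith), mul_zero]
    · rw [convPow, lconvolution_def]
      calc ∫⁻ y, w y * convPow w m (-y + x)
          = ∫⁻ y in Ioo 0 x, w y * convPow w m (-y + x) := by
            refine (setLIntegral_eq_of_support_subset fun y hy => ?_).symm
            by_contra hcon
            refine hy ?_
            rcases le_or_gt y 0 with hy0 | hy0
            · simp [hwn y hy0]
            · have : x ≤ y := by by_contra h'; exact hcon ⟨hy0, not_le.1 h'⟩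
              simp [hn (-y + x) (by linarith)]
        _ ≤ ∫⁻ y in Ioo 0 x, ENNReal.ofReal (K * B) *
              ENNReal.ofReal (y ^ (α - 1) * (x - y) ^ ((m + 1) * α - 1)) := by
            refine setLIntegral_mono' measurableSet_Ioo fun y hy => ?_
            refine (mul_le_mul' (hwp y hy.1) (hp (-y + x) (by linarith [hy.2]))).trans_eq ?_
            have h1 : 0 ≤ y ^ (α - 1) := Real.rpow_nonneg hy.1.le _
            rw [← ENNReal.ofReal_mul (by positivity), ← ENNReal.ofReal_mul (by positivity),
              neg_add_eq_sub]
            congr 1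
            ring
        _ ≤ ENNReal.ofReal (K * B) * ENNReal.ofReal (b * x ^ (α + (m + 1) * α - 1)) := by
            rw [lintegral_const_mul' _ _ ENNReal.ofReal_ne_top]
            gcongr
            exact hbeta x hx
        _ = _ := by
            rw [← ENNReal.ofReal_mul (by positivity)]
            push_cast
            ring_nf

theorem exists_convPow_le {j : ℕ} {K : ℝ} (hK : 0 ≤ K)
    (hwn : ∀ x ≤ 0, w x = 0)
    (hwp : ∀ x > 0, w x ≤ ENNReal.ofReal (K * x ^ (1 / (j + 1 : ℝ) - 1))) :
    ∃ B : ℝ, 0 ≤ B ∧ ∀ x, convPow w j x ≤ ENNReal.ofReal B := by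
  obtain ⟨B, hB, hn, hp⟩ := exists_convPow_le_rpow (by positivity) hK hwn hwp j
  refine ⟨B, hB, fun x => ?_⟩
  rcases le_or_gt x 0 with hx | hx
  · simp [hn x hx]
  · have := hp x hx
    rwa [mul_one_div_cancel (by positivity), sub_self, Real.rpow_zero, mul_one] at this

end ConvPow

section FourierInversion

theorem integral_charFun_comm (μ ν : Measure ℝ) [IsFiniteMeasure μ] [IsFiniteMeasure ν] :
    ∫ ξ, charFun μ ξ ∂ν = ∫ x, charFun ν x ∂μ := by
  simp_rw [charFun_apply_real]
  rw [integral_integral_swap]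
  · simp_rw [mul_comm]
  · refine Integrable.mono' (g := fun _ => (1 : ℝ)) (integrable_const _) (by fun_prop)
      (ae_of_all _ fun p => ?_)
    simp only [Function.uncurry]
    rw [← Complex.ofReal_mul, Complex.norm_exp_ofReal_mul_I]

/-- A finite measure with bounded density and nonnegative characteristic function has an
integrable characteristic function. -/
theorem integrable_of_charFun_eq {μ : Measure ℝ} [IsFiniteMeasure μ] {B : NNReal}
    (hμ : μ ≤ (B : ℝ≥0∞) • volume) {ρ : ℝ → ℝ} (hρ0 : ∀ ξ, 0 ≤ ρ ξ) (hρc : Continuous ρ)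
    (hρ : ∀ ξ, charFun μ ξ = ρ ξ) : Integrable ρ := by
  refine ⟨hρc.aestronglyMeasurable, ?_⟩
  rw [hasFiniteIntegral_iff_ofReal (ae_of_all _ hρ0)]
  have key : ∀ n : ℕ, ∫⁻ ξ, ENNReal.ofReal (ρ ξ * Real.exp (-(ξ ^ 2) / (2 * (n + 1)))) ≤
      ENNReal.ofReal (2 * Real.pi * B) := by
    intro n
    set v : NNReal := n + 1 with hv
    have hv0 : v ≠ 0 := by positivity
    have hvR : (v : ℝ) = n + 1 := by simp [hv]
    have hvp : (0 : ℝ) < v := by rw [hvR]; positivity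
    have e1 : ∫ ξ, ρ ξ ∂(gaussianReal 0 v) ≤ B * √(2 * Real.pi / v) := by
      have h1 : ∫ ξ, charFun μ ξ ∂(gaussianReal 0 v) = ∫ x, charFun (gaussianReal 0 v) x ∂μ :=
        integral_charFun_comm _ _
      have h2 : ∀ x : ℝ, charFun (gaussianReal 0 v) x = (Real.exp (-(v / 2) * x ^ 2) : ℝ) := by
        intro x
        rw [charFun_gaussianReal]
        push_cast
        congr 1
        ring
      simp_rw [hρ, h2, integral_complex_ofReal] at h1
      norm_cast at h1
      rw [h1]
      have hi := integrable_exp_neg_mul_sq (b := (v : ℝ) / 2) (by positivity)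
      calc ∫ x, Real.exp (-(v / 2) * x ^ 2) ∂μ
          ≤ ∫ x, Real.exp (-(v / 2) * x ^ 2) ∂((B : ℝ≥0∞) • volume) :=
            integral_mono_measure hμ (ae_of_all _ fun x => (Real.exp_pos _).le)
              (hi.smul_measure (by simp))
        _ = _ := by
            rw [integral_smul_measure, integral_gaussian]
            simp only [ENNReal.coe_toReal, smul_eq_mul]
            congr 2
            field_simp
    have e2 : ∫ ξ, ρ ξ ∂(gaussianReal 0 v) =
        (√(2 * Real.pi * v))⁻¹ * ∫ ξ, ρ ξ * Real.exp (-(ξ ^ 2) / (2 * (n + 1))) := by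
      rw [integral_gaussianReal_eq_integral_smul hv0, ← integral_const_mul]
      congr 1
      ext ξ
      simp only [gaussianPDFReal, smul_eq_mul, sub_zero, hvR]
      ring
    have hI : Integrable fun ξ => ρ ξ * Real.exp (-(ξ ^ 2) / (2 * (n + 1))) := by
      have hg := integrable_exp_neg_mul_sq (b := 1 / (2 * ((n : ℝ) + 1))) (by positivity)
      refine (hg.const_mul (μ.real univ)).mono' (by fun_prop) (ae_of_all _ fun ξ => ?_)
      rw [norm_mul, Real.norm_of_nonneg (Real.exp_nonneg _)]
      have hb : ‖ρ ξ‖ ≤ μ.real univ := by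
        rw [← Complex.norm_real, ← hρ]; exact norm_charFun_le ξ
      rw [show -(1 / (2 * ((n : ℝ) + 1))) * ξ ^ 2 = -(ξ ^ 2) / (2 * (n + 1)) by ring]
      gcongr
    rw [← ofReal_integral_eq_lintegral_ofReal hI
      (ae_of_all _ fun ξ => mul_nonneg (hρ0 ξ) (Real.exp_nonneg _))]
    refine ENNReal.ofReal_le_ofReal ?_
    rw [e2, inv_mul_le_iff₀ (by positivity)] at e1
    refine e1.trans_eq ?_
    rw [mul_left_comm, ← Real.sqrt_mul (by positivity),
      show 2 * Real.pi * v * (2 * Real.pi / v) = (2 * Real.pi) ^ 2 by field_simp,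
      Real.sqrt_sq (by positivity), mul_comm]
  have hlim : ∀ ξ, Tendsto (fun n : ℕ => ENNReal.ofReal
      (ρ ξ * Real.exp (-(ξ ^ 2) / (2 * (n + 1))))) atTop (𝓝 (ENNReal.ofReal (ρ ξ))) := by
    intro ξ
    refine ENNReal.tendsto_ofReal ?_
    have h1 : Tendsto (fun n : ℕ => 2 * ((n : ℝ) + 1)) atTop atTop :=
      (tendsto_natCast_atTop_atTop.atTop_add tendsto_const_nhds).const_mul_atTop (by norm_num)
    have h2 := h1.const_div_atTop (-(ξ ^ 2))
    have h3 := ((Real.continuous_exp.tendsto 0).comp h2).const_mul (ρ ξ)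
    simpa using h3
  calc ∫⁻ ξ, ENNReal.ofReal (ρ ξ)
      = ∫⁻ ξ, liminf (fun n : ℕ => ENNReal.ofReal
          (ρ ξ * Real.exp (-(ξ ^ 2) / (2 * (n + 1))))) atTop := by
        simp_rw [fun ξ => (hlim ξ).liminf_eq]
    _ ≤ liminf (fun n : ℕ => ∫⁻ ξ, ENNReal.ofReal
          (ρ ξ * Real.exp (-(ξ ^ 2) / (2 * (n + 1))))) atTop :=
        lintegral_liminf_le fun n => by fun_prop
    _ ≤ liminf (fun _ : ℕ => ENNReal.ofReal (2 * Real.pi * B)) atTop :=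
        liminf_le_liminf (Eventually.of_forall key)
    _ < ⊤ := by simp

theorem integrable_norm_charFun_sq {v : ℝ → ℝ≥0∞} {B : NNReal} (hv : Measurable v)
    (hvB : ∀ x, v x ≤ B) [IsFiniteMeasure (volume.withDensity v)] :
    Integrable fun ξ => ‖charFun (volume.withDensity v) ξ‖ ^ 2 := by
  set ν := volume.withDensity v with hν
  set ν' := volume.withDensity fun x => v (-x) with hν'
  have hv' : Measurable fun x => v (-x) := hv.comp measurable_neg
  have hmap : ν' = ν.map (fun x => -1 * x) := by
    refine Measure.ext_of_lintegral _ fun g hg => ?_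
    rw [lintegral_map hg (by fun_prop), hν, hν', lintegral_withDensity_eq_lintegral_mul _ hv' hg,
      lintegral_withDensity_eq_lintegral_mul _ hv (by fun_prop), ← lintegral_neg_eq_self]
    simp
  have : IsFiniteMeasure ν' := by rw [hmap]; infer_instance
  have hfin : ∫⁻ y, v y ≠ ⊤ := by
    have := measure_ne_top ν univ
    rwa [hν, withDensity_apply _ MeasurableSet.univ, Measure.restrict_univ] at this
  refine integrable_of_charFun_eq (μ := ν ∗ ν')
    (B := (∫⁻ y, v y).toNNReal * B) ?_ (fun ξ => by positivity) (by fun_prop) fun ξ => ?_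
  · rw [hν, hν', conv_withDensity_eq_lconvolution hv hv', ← withDensity_const]
    refine withDensity_mono (ae_of_all _ fun x => ?_)
    rw [ENNReal.coe_mul, ENNReal.coe_toNNReal hfin]
    exact lconvolution_le ENNReal.coe_ne_top (fun x => hvB (-x)) x
  · rw [charFun_conv, hmap, charFun_map_mul, neg_one_mul, charFun_neg, Complex.mul_conj,
      Complex.normSq_eq_norm_sq]

theorem continuous_lconvolution_toReal {u v : ℝ → ℝ≥0∞} {B : NNReal} (hu : Measurable u)
    (hv : Measurable v) (hui : ∫⁻ x, u x ≠ ⊤) (hvB : ∀ x, v x ≤ B) :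
    Continuous fun x => ((u ⋆ₗ v) x).toReal := by
  have hu' : Integrable fun x => (u x).toReal := integrable_toReal_of_lintegral_ne_top
    hu.aemeasurable hui
  have hvt : ∀ x, v x ≠ ⊤ := fun x => ((hvB x).trans_lt ENNReal.coe_lt_top).ne
  have hvb : ∀ x, |(v x).toReal| ≤ B := fun x => by
    rw [abs_of_nonneg ENNReal.toReal_nonneg]
    exact ENNReal.toReal_le_of_le_ofReal B.2 (by simpa using hvB x)
  have hvm : Measurable fun x => (v x).toReal := hv.ennreal_toReal
  have hvl : LocallyIntegrable fun x => (v x).toReal :=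
    (memLp_top_of_bound hvm.aestronglyMeasurable B (ae_of_all _ hvb)).locallyIntegrable (by simp)
  have hut : ∀ᵐ x, u x ≠ ⊤ := (ae_lt_top hu hui).mono fun x h => h.ne
  have heq : ∀ x, ((u ⋆ₗ v) x).toReal = ∫ y, (u y).toReal * (v (x - y)).toReal := by
    intro x
    rw [lconvolution_def, integral_eq_lintegral_of_nonneg_ae (ae_of_all _ fun y => by positivity)
      (by fun_prop)]
    congr 1
    refine lintegral_congr_ae ?_
    filter_upwards [hut] with y hy
    rw [ENNReal.ofReal_mul ENNReal.toReal_nonneg, ENNReal.ofReal_toReal hy,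
      ENNReal.ofReal_toReal (hvt _), neg_add_eq_sub]
  simp_rw [heq]
  refine continuous_of_uniform_approx_of_continuous fun s hs => ?_
  obtain ⟨ε, hε, hεs⟩ := Metric.mem_uniformity_dist.1 hs
  obtain ⟨g, hgc, hgi, hgcont, hgint⟩ :=
    hu'.exists_hasCompactSupport_integral_sub_le (ε := ε / (2 * (B + 1))) (by positivity)
  refine ⟨fun x => ∫ y, g y * (v (x - y)).toReal, ?_, fun x => hεs ?_⟩
  · exact hgc.continuous_convolution_left (ContinuousLinearMap.mul ℝ ℝ) hgcont hvl
  · have i1 : ∀ {h : ℝ → ℝ}, Integrable h → Integrable fun y => h y * (v (x - y)).toReal :=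
      fun {h} hh => by
        exact hh.mul_bdd (c := B)
          (hvm.comp (measurable_const.sub measurable_id)).aestronglyMeasurable (ae_of_all _ fun y => hvb (x - y))
    have i2 : Integrable fun y => (u y).toReal - g y := hu'.sub hgint
    rw [Real.dist_eq, ← integral_sub (i1 hu') (i1 hgint)]
    calc |∫ y, ((u y).toReal * (v (x - y)).toReal - g y * (v (x - y)).toReal)|
        ≤ ∫ y, ‖(u y).toReal - g y‖ * B := by
          rw [← Real.norm_eq_abs]
          refine norm_integral_le_of_norm_le (i2.norm.mul_const _) (ae_of_all _ fun y => ?_)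
          rw [← sub_mul, norm_mul]
          gcongr
          exact hvb _
      _ ≤ ε / (2 * (B + 1)) * B := by rw [integral_mul_const]; gcongr
      _ < ε := by
          rw [div_mul_eq_mul_div, div_lt_iff₀ (by positivity)]
          nlinarith [B.2]

end FourierInversion

section LocalLimit

open scoped FourierTransform in
theorem fourier_toReal {v : ℝ → ℝ≥0∞} (hv : Measurable v) (hvt : ∀ᵐ x, v x < ⊤) (ξ : ℝ) :
    𝓕 (fun x => ((v x).toReal : ℂ)) ξ = charFun (volume.withDensity v) (-(2 * Real.pi * ξ)) := by
  rw [Real.fourier_real_eq_integral_exp_smul, charFun_apply_real,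
    integral_withDensity_eq_integral_toReal_smul hv hvt]
  congr 1
  ext x
  rw [Complex.real_smul, smul_eq_mul, mul_comm]
  congr 2
  push_cast
  ring

open scoped FourierTransform in
theorem toReal_eq_integral_charFun {v : ℝ → ℝ≥0∞} (hv : Measurable v) (hvi : ∫⁻ x, v x ≠ ⊤)
    (hvc : Continuous fun x => (v x).toReal)
    (hi : Integrable fun ξ => charFun (volume.withDensity v) (-(2 * Real.pi * ξ))) (x : ℝ) :
    ((v x).toReal : ℂ) = ∫ ξ : ℝ, Complex.exp ((2 * Real.pi * ξ * x : ℝ) * Complex.I) *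
      charFun (volume.withDensity v) (-(2 * Real.pi * ξ)) := by
  have hF : 𝓕 (fun x => ((v x).toReal : ℂ)) =
      fun ξ => charFun (volume.withDensity v) (-(2 * Real.pi * ξ)) :=
    funext fun ξ => fourier_toReal hv (ae_lt_top hv hvi) ξ
  have hf : Integrable fun x => ((v x).toReal : ℂ) :=
    (integrable_toReal_of_lintegral_ne_top hv.aemeasurable hvi).ofReal
  have := hf.fourierInv_fourier_eq (by rw [hF]; exact hi)
    (v := x) (Complex.continuous_ofReal.comp hvc).continuousAt
  rw [hF, Real.fourierInv_eq'] at this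
  rw [← this]
  congr 1
  ext ξ
  rw [smul_eq_mul]
  congr 3
  simp
  ring

theorem norm_charFun_lt_one {w : ℝ → ℝ≥0∞} [IsProbabilityMeasure (volume.withDensity w)]
    {ξ : ℝ} (hξ : ξ ≠ 0) : ‖charFun (volume.withDensity w) ξ‖ < 1 := by
  set ν := volume.withDensity w with hν
  refine lt_of_le_of_ne (norm_charFun_le_one ξ) fun h => ?_
  set θ := Complex.arg (charFun ν ξ)
  have hz : charFun ν ξ = Complex.exp (θ * Complex.I) := by
    conv_lhs => rw [← Complex.norm_mul_exp_arg_mul_I (charFun ν ξ), h, Complex.ofReal_one, one_mul]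
  have hi : Integrable (fun x : ℝ => Complex.exp ((ξ * x - θ : ℝ) * Complex.I)) ν := by
    refine Integrable.mono' (g := fun _ => (1 : ℝ)) (integrable_const _) (by fun_prop)
      (ae_of_all _ fun p => ?_)
    rw [Complex.norm_exp_ofReal_mul_I]
  have h1 : ∫ x, Complex.exp ((ξ * x - θ : ℝ) * Complex.I) ∂ν = 1 := by
    have : ∀ x : ℝ, Complex.exp ((ξ * x - θ : ℝ) * Complex.I) =
        Complex.exp (-(θ * Complex.I)) * Complex.exp (ξ * x * Complex.I) := fun x => by
      rw [← Complex.exp_add]; push_cast; ring_nf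
    simp_rw [this]
    rw [integral_const_mul, ← charFun_apply_real, hz, ← Complex.exp_add]
    simp
  have hre : ∀ x : ℝ, (Complex.exp ((ξ * x - θ : ℝ) * Complex.I)).re = Real.cos (ξ * x - θ) :=
    fun x => Complex.exp_ofReal_mul_I_re _
  have hi' : Integrable (fun x => Real.cos (ξ * x - θ)) ν :=
    Integrable.mono' (g := fun _ => (1 : ℝ)) (integrable_const _) (by fun_prop)
      (ae_of_all _ fun p => Real.abs_cos_le_one _)
  have h2 : ∫ x, (1 - Real.cos (ξ * x - θ)) ∂ν = 0 := by
    rw [integral_sub (integrable_const _) hi']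
    have := congrArg Complex.re h1
    have h3 : (∫ x, Complex.exp ((ξ * x - θ : ℝ) * Complex.I) ∂ν).re =
        ∫ x, (Complex.exp ((ξ * x - θ : ℝ) * Complex.I)).re ∂ν := (integral_re hi).symm
    rw [h3] at this
    simp_rw [hre] at this
    rw [this]
    simp
  have hi2 : Integrable (fun x => 1 - Real.cos (ξ * x - θ)) ν :=
    (integrable_const _).sub hi'
  have h3 := (integral_eq_zero_iff_of_nonneg (fun x => by simp [Real.cos_le_one]) hi2).1 h2
  have hcount : (⋃ k : ℤ, {x : ℝ | (k : ℝ) * (2 * Real.pi) = ξ * x - θ}).Countable := by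
    refine countable_iUnion fun k => Set.Subsingleton.countable ?_
    intro x hx y hy
    have : ξ * x = ξ * y := by
      have hx : (k : ℝ) * (2 * Real.pi) = ξ * x - θ := hx
      have hy : (k : ℝ) * (2 * Real.pi) = ξ * y - θ := hy
      linarith
    exact mul_left_cancel₀ hξ this
  have hnull : ν (⋃ k : ℤ, {x : ℝ | (k : ℝ) * (2 * Real.pi) = ξ * x - θ}) = 0 :=
    withDensity_absolutelyContinuous _ _ (hcount.measure_zero volume)
  have hae : ∀ᵐ x ∂ν, x ∈ ⋃ k : ℤ, {x : ℝ | (k : ℝ) * (2 * Real.pi) = ξ * x - θ} := by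
    filter_upwards [h3] with x hx
    have : Real.cos (ξ * x - θ) = 1 := by simp at hx; linarith
    obtain ⟨k, hk⟩ := (Real.cos_eq_one_iff _).1 this
    exact mem_iUnion.2 ⟨k, hk⟩
  have : ν univ = 0 := by
    rw [ae_iff] at hae
    refine measure_mono_null ?_ (measure_union_null hnull hae)
    intro x _
    exact em _
  simp at this

theorem exists_norm_charFun_le {w : ℝ → ℝ≥0∞} (hw : Measurable w)
    [IsProbabilityMeasure (volume.withDensity w)] {δ : ℝ} (hδ : 0 < δ) :
    ∃ ρ < 1, 0 ≤ ρ ∧ ∀ ξ, δ ≤ |ξ| → ‖charFun (volume.withDensity w) (-(2 * Real.pi * ξ))‖ ≤ ρ := by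
  set g : ℝ → ℝ := fun ξ => ‖charFun (volume.withDensity w) (-(2 * Real.pi * ξ))‖ with hg
  have hgc : Continuous g := by fun_prop
  have hwi : ∫⁻ x, w x ≠ ⊤ := by
    have := measure_ne_top (volume.withDensity w) univ
    rwa [withDensity_apply _ MeasurableSet.univ, Measure.restrict_univ] at this
  have hlim : Tendsto g (cocompact ℝ) (𝓝 0) := by
    have := (Real.zero_at_infty_fourier fun x => ((w x).toReal : ℂ)).norm
    rw [norm_zero] at this
    exact this.congr fun ξ => by rw [fourier_toReal hw (ae_lt_top hw hwi)]
  have hev : ∀ᶠ ξ in cocompact ℝ, g ξ ≤ 1 / 2 := hlim.eventually (ge_mem_nhds (by norm_num))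
  rw [Metric.cobounded_eq_cocompact.symm, ← comap_norm_atTop] at hev
  obtain ⟨R, hR⟩ := eventually_atTop.1 (eventually_comap.1 hev)
  set S := {ξ : ℝ | δ ≤ |ξ| ∧ |ξ| ≤ max R δ} with hS
  have hSc : IsCompact S := by
    refine Metric.isCompact_of_isClosed_isBounded ?_ ?_
    · exact (isClosed_le continuous_const continuous_abs).inter
        (isClosed_le continuous_abs continuous_const)
    · refine (Metric.isBounded_closedBall (x := (0 : ℝ)) (r := max R δ)).subset fun ξ hξ => ?_
      simpa [Metric.mem_closedBall, Real.dist_eq] using hξ.2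
  obtain ⟨ξ₀, hξ₀, hmax⟩ := hSc.exists_isMaxOn
    ⟨δ, by simp [hS, abs_of_pos hδ]⟩ hgc.continuousOn
  have hlt : g ξ₀ < 1 := by
    refine norm_charFun_lt_one ?_
    have : ξ₀ ≠ 0 := by
      rintro rfl
      have := hξ₀.1
      simp at this
      linarith
    simp [this, Real.pi_ne_zero]
  refine ⟨max (1 / 2) (g ξ₀), max_lt (by norm_num) hlt, by positivity, fun ξ hξ => ?_⟩
  rcases le_total |ξ| (max R δ) with h | h
  · exact (hmax ⟨hξ, h⟩).trans (le_max_right _ _)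
  · exact (hR |ξ| ((le_max_left _ _).trans h) ξ rfl).trans (le_max_left _ _)

theorem norm_exp_mul_I_sub_le (x : ℝ) :
    ‖Complex.exp (x * Complex.I) - (1 + x * Complex.I - (x : ℂ) ^ 2 / 2)‖ ≤ 4 * |x| ^ 3 := by
  have hn : ‖(x : ℂ) * Complex.I‖ = |x| := by simp
  rcases le_total |x| 1 with h | h
  · have := Complex.exp_bound (x := (x : ℂ) * Complex.I) (by rw [hn]; exact h) (n := 3) (by norm_num)
    rw [hn] at this
    have e : ∑ m ∈ Finset.range 3, ((x : ℂ) * Complex.I) ^ m / (m.factorial : ℂ) =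
        1 + x * Complex.I - (x : ℂ) ^ 2 / 2 := by
      simp [Finset.sum_range_succ, mul_pow]
      ring
    rw [e] at this
    refine this.trans ?_
    norm_num [Nat.factorial]
    nlinarith [pow_nonneg (abs_nonneg x) 3]
  · have h1 : ‖(1 + x * Complex.I - (x : ℂ) ^ 2 / 2)‖ ≤ 1 + |x| + |x| ^ 2 / 2 := by
      refine (norm_sub_le _ _).trans (add_le_add ((norm_add_le _ _).trans ?_) ?_)
      · rw [hn]; simp
      · simp
    refine (norm_sub_le _ _).trans ?_
    rw [Complex.norm_exp_ofReal_mul_I]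
    have : 1 ≤ |x| ^ 3 := one_le_pow₀ h
    have h2 : |x| ≤ |x| ^ 3 := le_self_pow₀ h (by norm_num)
    have h3 : |x| ^ 2 ≤ |x| ^ 3 := pow_le_pow_right₀ h (by norm_num)
    linarith

/-- Second-order expansion at `0` of the characteristic function of a centred variable. -/
theorem exists_norm_charFun_sub_le {ν : Measure ℝ} [IsProbabilityMeasure ν] {t : ℝ}
    (h3 : Integrable (fun u => |u - t| ^ 3) ν) (hi : Integrable (fun u => u) ν)
    (hi2 : Integrable (fun u => (u - t) ^ 2) ν) (ht : ∫ u, u ∂ν = t) :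
    ∃ K, ∀ ξ : ℝ, ‖Complex.exp ((2 * Real.pi * ξ * t : ℝ) * Complex.I) *
      charFun ν (-(2 * Real.pi * ξ)) -
        (1 - 2 * Real.pi ^ 2 * (∫ u, (u - t) ^ 2 ∂ν) * ξ ^ 2 : ℝ)‖ ≤ K * |ξ| ^ 3 := by
  refine ⟨4 * (2 * Real.pi) ^ 3 * ∫ u, |u - t| ^ 3 ∂ν, fun ξ => ?_⟩
  have e1 : Complex.exp ((2 * Real.pi * ξ * t : ℝ) * Complex.I) * charFun ν (-(2 * Real.pi * ξ)) =
      ∫ u, Complex.exp ((-(2 * Real.pi * ξ) * (u - t) : ℝ) * Complex.I) ∂ν := by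
    rw [charFun_apply_real, ← integral_const_mul]
    congr 1
    ext u
    rw [← Complex.exp_add]
    push_cast
    ring_nf
  have hit : Integrable (fun u => u - t) ν := hi.sub (integrable_const _)
  have hmean : ∫ u, (u - t) ∂ν = 0 := by
    rw [integral_sub hi (integrable_const _), ht]; simp
  have hp : ∀ u : ℝ, (1 + ((-(2 * Real.pi * ξ) * (u - t) : ℝ) : ℂ) * Complex.I -
      ((-(2 * Real.pi * ξ) * (u - t) : ℝ) : ℂ) ^ 2 / 2) =
      1 + (-(2 * Real.pi * ξ) * Complex.I) * ((u - t : ℝ) : ℂ) -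
        ((2 * Real.pi ^ 2 * ξ ^ 2 : ℝ) : ℂ) * (((u - t) ^ 2 : ℝ) : ℂ) := fun u => by
    push_cast; ring
  have j1 : Integrable (fun u : ℝ => (-(2 * Real.pi * ξ) * Complex.I) * ((u - t : ℝ) : ℂ)) ν :=
    hit.ofReal.const_mul _
  have j2 : Integrable (fun u : ℝ => ((2 * Real.pi ^ 2 * ξ ^ 2 : ℝ) : ℂ) *
      (((u - t) ^ 2 : ℝ) : ℂ)) ν := hi2.ofReal.const_mul _
  have j0 : Integrable (fun u : ℝ => (1 : ℂ) +
      (-(2 * Real.pi * ξ) * Complex.I) * ((u - t : ℝ) : ℂ)) ν := (integrable_const _).add j1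
  have e2 : ((1 - 2 * Real.pi ^ 2 * (∫ u, (u - t) ^ 2 ∂ν) * ξ ^ 2 : ℝ) : ℂ) =
      ∫ u, (1 + ((-(2 * Real.pi * ξ) * (u - t) : ℝ) : ℂ) * Complex.I -
      ((-(2 * Real.pi * ξ) * (u - t) : ℝ) : ℂ) ^ 2 / 2) ∂ν := by
    simp_rw [hp]
    rw [integral_sub j0 j2, integral_add (integrable_const _) j1, integral_const_mul,
      integral_const_mul, integral_complex_ofReal, integral_complex_ofReal, hmean]
    simp
    ring
  have j3 : Integrable (fun u : ℝ =>
      Complex.exp ((-(2 * Real.pi * ξ) * (u - t) : ℝ) * Complex.I)) ν := by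
    refine Integrable.mono' (g := fun _ => (1 : ℝ)) (integrable_const _) (by fun_prop)
      (ae_of_all _ fun p => ?_)
    rw [Complex.norm_exp_ofReal_mul_I]
  rw [e1, e2, ← integral_sub j3 (by simp_rw [hp]; exact j0.sub j2)]
  calc _ ≤ ∫ u, 4 * (2 * Real.pi * |ξ|) ^ 3 * |u - t| ^ 3 ∂ν := by
        refine norm_integral_le_of_norm_le (h3.const_mul _) (ae_of_all _ fun u => ?_)
        refine (norm_exp_mul_I_sub_le _).trans_eq ?_
        rw [abs_mul, abs_neg, abs_mul, abs_of_pos (by positivity : 0 < 2 * Real.pi)]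
        ring
    _ = _ := by rw [integral_const_mul]; ring

theorem variance_pos_of_withDensity {w : ℝ → ℝ≥0∞} [IsProbabilityMeasure (volume.withDensity w)]
    {t : ℝ} (hi : Integrable (fun u => (u - t) ^ 2) (volume.withDensity w)) :
    0 < ∫ u, (u - t) ^ 2 ∂(volume.withDensity w) := by
  refine lt_of_le_of_ne (integral_nonneg fun u => sq_nonneg _) fun h => ?_
  have h0 := (integral_eq_zero_iff_of_nonneg (fun u => sq_nonneg _) hi).1 h.symm
  have h1 : ∀ᵐ u ∂(volume.withDensity w), u = t := by
    filter_upwards [h0] with u hu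
    have : (u - t) ^ 2 = 0 := hu
    exact sub_eq_zero.1 (pow_eq_zero_iff (two_ne_zero) |>.1 this)
  have h2 : (volume.withDensity w) {t} = 0 :=
    withDensity_absolutelyContinuous _ _ (measure_singleton t)
  have : (volume.withDensity w) univ = 0 := by
    rw [ae_iff] at h1
    refine measure_mono_null (fun x _ => ?_) (measure_union_null h2 h1)
    exact em (x = t)
  simp at this

/-- Local central limit theorem with rate for the convolution powers of a density on the half-line
with a power singularity at `0`. -/
theorem exists_convPow_localLimit {w : ℝ → ℝ≥0∞} (hw : Measurable w) (h1 : ∫⁻ x, w x = 1)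
    {j : ℕ} {K : ℝ} (hK : 0 ≤ K) (hwn : ∀ x ≤ 0, w x = 0)
    (hwp : ∀ x > 0, w x ≤ ENNReal.ofReal (K * x ^ (1 / (j + 1 : ℝ) - 1)))
    {t : ℝ} (hmom : Integrable (fun u => |u| ^ 3) (volume.withDensity w))
    (ht : ∫ u, u ∂(volume.withDensity w) = t) :
    ∃ S > 0, ∃ C > 0, ∀ m : ℕ, 2 * j + 1 ≤ m →
      (∀ s, convPow w m s ≤ ENNReal.ofReal (S / √(m + 1) * (1 + C / √(m + 1)))) ∧
      ENNReal.ofReal (S / √(m + 1) * (1 - C / √(m + 1))) ≤ convPow w m ((m + 1) * t) := by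
  have hprob := isProbabilityMeasure_convPow hw h1
  set ν := volume.withDensity w with hν
  have hνp : IsProbabilityMeasure ν := hprob 0
  have hLp : MemLp (fun u : ℝ => u) 3 ν := by
    rw [← integrable_norm_rpow_iff (by fun_prop) (by norm_num) (by norm_num)]
    simpa using hmom
  have hLpt : MemLp (fun u : ℝ => u - t) 3 ν := hLp.sub (memLp_const t)
  have hi : Integrable (fun u : ℝ => u) ν := hLp.integrable (by norm_num)
  have hi2 : Integrable (fun u => (u - t) ^ 2) ν :=
    (hLpt.mono_exponent (p := 2) (by norm_num)).integrable_sq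
  have hi3 : Integrable (fun u => |u - t| ^ 3) ν := by
    simpa using hLpt.integrable_norm_rpow (by norm_num) (by norm_num)
  set v := ∫ u, (u - t) ^ 2 ∂ν with hv
  have hvpos : 0 < v := variance_pos_of_withDensity hi2
  set a := 2 * Real.pi ^ 2 * v with ha
  have hapos : 0 < a := by positivity
  obtain ⟨Kψ, hψ1⟩ := exists_norm_charFun_sub_le hi3 hi hi2 ht
  set ψ : ℝ → ℂ := fun ξ => Complex.exp ((2 * Real.pi * ξ * t : ℝ) * Complex.I) *
      charFun ν (-(2 * Real.pi * ξ)) with hψ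
  have hψn : ∀ ξ, ‖ψ ξ‖ = ‖charFun ν (-(2 * Real.pi * ξ))‖ := fun ξ => by
    rw [hψ]; simp only [norm_mul]; rw [Complex.norm_exp_ofReal_mul_I, one_mul]
  have hψc : Continuous ψ := by fun_prop
  obtain ⟨B, hB0, hB⟩ := exists_convPow_le hK hwn hwp
  have hBm : ∀ m, j ≤ m → ∀ x, convPow w m x ≤ ENNReal.ofReal B :=
    fun m hm x => convPow_le_of_le h1 ENNReal.ofReal_ne_top hB hm x
  have hφint : Integrable fun ξ => ‖charFun ν ξ‖ ^ (2 * j + 2) := by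
    have := integrable_norm_charFun_sq (B := B.toNNReal) (measurable_convPow hw j) hB
    simp_rw [charFun_convPow hw h1, norm_pow, ← pow_mul] at this
    exact this.congr (ae_of_all _ fun ξ => by rw [hν]; ring_nf)
  have hψint : Integrable fun ξ => ‖ψ ξ‖ ^ (2 * j + 2) := by
    simp_rw [hψn]
    have := hφint.comp_mul_left' (R := -(2 * Real.pi)) (by simp [Real.pi_ne_zero])
    simpa only [neg_mul] using this
  obtain ⟨C₀, hC₀, hmain⟩ := exists_integral_pow_sub_gaussian_le (r := 2 * j + 2) (by omega) hapos
    hψc hψint hψ1 (fun δ hδ => by simp_rw [hψn]; exact exists_norm_charFun_le hw hδ)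
  set S := √(Real.pi / a) with hS
  have hSpos : 0 < S := by positivity
  refine ⟨S, hSpos, C₀ / S, by positivity, fun m hm => ?_⟩
  set M : ℕ := m + 1 with hM
  have hMR : (m : ℝ) + 1 = M := by simp [hM]
  have hMpos : (0 : ℝ) < M := by rw [← hMR]; positivity
  have hsq : √(M : ℝ) ^ 2 = M := Real.sq_sqrt hMpos.le
  have hsqpos : 0 < √(M : ℝ) := Real.sqrt_pos.2 hMpos
  rw [hMR]
  obtain ⟨hint, hbound⟩ := hmain M (by omega)
  have hgi : Integrable fun ξ : ℝ => Real.exp (-(a * M) * ξ ^ 2) :=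
    integrable_exp_neg_mul_sq (by positivity)
  have hgv : ∫ ξ : ℝ, Real.exp (-(a * M) * ξ ^ 2) = S / √M := by
    rw [integral_gaussian, ← div_div, Real.sqrt_div (by positivity)]
  have hψMi : Integrable fun ξ => ψ ξ ^ M := by
    have := hint.add hgi.ofReal
    refine this.congr (ae_of_all _ fun ξ => ?_)
    simp
  have hinv : ∀ s, ((convPow w m s).toReal : ℂ) = ∫ ξ : ℝ,
      Complex.exp ((2 * Real.pi * ξ * (s - M * t) : ℝ) * Complex.I) * ψ ξ ^ M := by
    intro s
    have hc : Continuous fun x => (convPow w m x).toReal := by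
      obtain ⟨i, rfl⟩ : ∃ i, m = i + j + 1 := ⟨m - j - 1, by omega⟩
      rw [convPow_add hw]
      refine continuous_lconvolution_toReal (B := B.toNNReal) (measurable_convPow hw i)
        (measurable_convPow hw j) ?_ hB
      rw [lintegral_convPow hw h1]; simp
    have hsplit : ∀ ξ : ℝ, charFun (volume.withDensity (convPow w m)) (-(2 * Real.pi * ξ)) =
        Complex.exp ((-(2 * Real.pi * ξ * (M * t)) : ℝ) * Complex.I) * ψ ξ ^ M := fun ξ => by
      rw [charFun_convPow hw h1]
      simp only [hψ]
      rw [mul_pow, ← Complex.exp_nat_mul, ← mul_assoc, ← Complex.exp_add, show (((-(2 * Real.pi * ξ * (M * t)) : ℝ) : ℂ) * Complex.I +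
        (M : ℂ) * (((2 * Real.pi * ξ * t : ℝ) : ℂ) * Complex.I)) = 0 by push_cast; ring]
      simp [hν, hM]
    rw [toReal_eq_integral_charFun (measurable_convPow hw m)
      (by rw [lintegral_convPow hw h1]; simp) hc]
    · congr 1
      ext ξ
      rw [hsplit, ← mul_assoc, ← Complex.exp_add]
      congr 2
      push_cast
      ring
    · refine hψMi.norm.mono' (by fun_prop) (ae_of_all _ fun ξ => ?_)
      rw [hsplit, norm_mul, Complex.norm_exp_ofReal_mul_I, one_mul]
  have hfin : ∀ s, convPow w m s ≠ ⊤ := fun s =>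
    ((hBm m (by omega) s).trans_lt ENNReal.ofReal_lt_top).ne
  have hnorm : ∫ ξ, ‖ψ ξ ^ M‖ ≤ S / √M + C₀ / M := by
    rw [← hgv]
    refine le_trans ?_ (add_le_add_right hbound _)
    rw [← integral_add hgi hint.norm]
    refine integral_mono hψMi.norm (hgi.add hint.norm) fun ξ => ?_
    have := norm_add_le ((Real.exp (-(a * M) * ξ ^ 2) : ℂ))
      (ψ ξ ^ M - (Real.exp (-(a * M) * ξ ^ 2) : ℂ))
    rwa [add_sub_cancel, Complex.norm_real, Real.norm_of_nonneg (Real.exp_nonneg _)] at this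
  have halg : C₀ / M = S / √M * (C₀ / S / √M) := by
    rw [show S / √M * (C₀ / S / √M) = C₀ / (√M ^ 2) by field_simp, hsq]
  constructor
  · intro s
    rw [← ENNReal.ofReal_toReal (hfin s)]
    refine ENNReal.ofReal_le_ofReal ?_
    rw [mul_add, mul_one, ← halg]
    refine le_trans ?_ hnorm
    have : (convPow w m s).toReal = ‖((convPow w m s).toReal : ℂ)‖ := by
      rw [Complex.norm_real, Real.norm_of_nonneg ENNReal.toReal_nonneg]
    rw [this, hinv s]
    refine norm_integral_le_of_norm_le hψMi.norm (ae_of_all _ fun ξ => ?_)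
    rw [norm_mul, Complex.norm_exp_ofReal_mul_I, one_mul]
  · rw [← ENNReal.ofReal_toReal (hfin (M * t))]
    refine ENNReal.ofReal_le_ofReal ?_
    rw [mul_sub, mul_one, ← halg]
    have e := hinv (M * t)
    simp only [sub_self, mul_zero, Complex.ofReal_zero, zero_mul, Complex.exp_zero, one_mul] at e
    have e2 : ((convPow w m (M * t)).toReal : ℂ) - ((S / √M : ℝ) : ℂ) =
        ∫ ξ, (ψ ξ ^ M - (Real.exp (-(a * M) * ξ ^ 2) : ℂ)) := by
      have hgiC : Integrable fun ξ : ℝ => (Real.exp (-(a * M) * ξ ^ 2) : ℂ) := hgi.ofReal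
      rw [integral_sub hψMi hgiC, e, integral_complex_ofReal, hgv]
    have e3 : |(convPow w m (M * t)).toReal - S / √M| ≤ C₀ / M := by
      rw [← Real.norm_eq_abs, ← Complex.norm_real, Complex.ofReal_sub, e2]
      exact (norm_integral_le_integral_norm _).trans hbound
    linarith [(abs_le.1 e3).1]

end LocalLimit

/-! ### Single-particle Hamiltonians -/

/-- The nonzero points where `f` is finite. -/
def finSupport (f : ℝ → EReal) : Set ℝ := {x | x ≠ 0 ∧ f x ≠ ⊤}

open Classical in
/-- The signs of the points where `f` is finite. -/
noncomputable def signs (f : ℝ → EReal) : Finset ℝ := if f (-1) = ⊤ then {1} else {1, -1}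

/-- The inverse of `f` on `(0, ∞)`, extended by `0`. -/
noncomputable def branchInv (f : ℝ → EReal) : ℝ → ℝ :=
  (Ioi 0).indicator (Function.invFunOn (realPart f) (Ioi 0))

namespace ClassF

variable {f : ℝ → EReal} (hf : ClassF f)
include hf

theorem realPart_zero : realPart f 0 = 0 := by simp [realPart, hf.map_zero]

theorem coe_realPart_of_pos {x : ℝ} (hx : 0 < x) : (realPart f x : EReal) = f x :=
  EReal.coe_toReal (hf.finite_pos x hx).1 (hf.finite_pos x hx).2

theorem hasStrictDerivAt_of_pos {x : ℝ} (hx : 0 < x) :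
    HasStrictDerivAt (realPart f) (deriv (realPart f) x) x :=
  (hf.contDiff.contDiffAt (Ioi_mem_nhds hx)).hasStrictDerivAt one_ne_zero

theorem continuousOn_deriv : ContinuousOn (deriv (realPart f)) (Ioi 0) :=
  hf.contDiff.continuousOn_deriv_of_isOpen isOpen_Ioi le_rfl

theorem continuousOn_Ici : ContinuousOn (realPart f) (Ici 0) := by
  intro x hx
  rcases (mem_Ici.1 hx).eq_or_lt with rfl | h
  · have h1 : ContinuousAt EReal.toReal (f 0) := by
      rw [hf.map_zero]
      exact EReal.tendsto_toReal EReal.zero_ne_top EReal.zero_ne_bot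
    exact h1.comp_continuousWithinAt hf.right_cont
  · exact (hf.hasStrictDerivAt_of_pos h).hasDerivAt.continuousAt.continuousWithinAt

theorem strictMonoOn : StrictMonoOn (realPart f) (Ici 0) := by
  refine strictMonoOn_of_deriv_pos (convex_Ici 0) hf.continuousOn_Ici fun x hx => ?_
  rw [interior_Ici] at hx
  exact hf.deriv_pos x hx

theorem realPart_pos_of_pos {x : ℝ} (hx : 0 < x) : 0 < realPart f x := by
  have := hf.strictMonoOn self_mem_Ici hx.le hx
  rwa [hf.realPart_zero] at this

theorem tendsto_realPart_atTop : Tendsto (realPart f) atTop atTop := by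
  obtain ⟨a₁, a₂, h1, h2, h⟩ := hf.deriv_tail
  have key : ∀ x, a₂ + 1 ≤ x → a₁ * (x - (a₂ + 1)) ≤ realPart f x - realPart f (a₂ + 1) := by
    intro x hx
    refine (convex_Ici (a₂ + 1)).mul_sub_le_image_sub_of_le_deriv ?_ ?_ ?_ (a₂ + 1) self_mem_Ici x
      hx hx
    · exact hf.continuousOn_Ici.mono fun y hy => by
        simp only [mem_Ici] at hy ⊢; linarith
    · intro y hy
      rw [interior_Ici, mem_Ioi] at hy
      exact (hf.hasStrictDerivAt_of_pos (by linarith)).hasDerivAt.differentiableAt.differentiableWithinAt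
    · intro y hy
      rw [interior_Ici, mem_Ioi] at hy
      exact h y (by linarith)
  have ht : Tendsto (fun x : ℝ => a₁ * (x - (a₂ + 1)) + realPart f (a₂ + 1)) atTop atTop :=
    tendsto_atTop_add_const_right _ _ ((tendsto_atTop_add_const_right _ _ tendsto_id).const_mul_atTop h1)
  refine tendsto_atTop_mono' _ ?_ ht
  filter_upwards [eventually_ge_atTop (a₂ + 1)] with x hx
  linarith [key x hx]

theorem surjOn : SurjOn (realPart f) (Ioi 0) (Ioi 0) := by
  intro u hu
  obtain ⟨b, hb⟩ := (hf.tendsto_realPart_atTop.eventually (eventually_ge_atTop u)).and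
    (eventually_ge_atTop 0) |>.exists
  obtain ⟨x, hx, rfl⟩ := intermediate_value_Icc hb.2
    (hf.continuousOn_Ici.mono Icc_subset_Ici_self) ⟨hf.realPart_zero.trans_le (mem_Ioi.1 hu).le, hb.1⟩
  refine ⟨x, lt_of_le_of_ne hx.1 ?_, rfl⟩
  rintro rfl
  rw [hf.realPart_zero] at hu
  exact lt_irrefl _ (mem_Ioi.1 hu)

theorem branchInv_pos {u : ℝ} (hu : 0 < u) : 0 < branchInv f u := by
  rw [branchInv, indicator_of_mem (mem_Ioi.2 hu)]
  exact Function.invFunOn_mem (hf.surjOn hu)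

theorem realPart_branchInv {u : ℝ} (hu : 0 < u) : realPart f (branchInv f u) = u := by
  rw [branchInv, indicator_of_mem (mem_Ioi.2 hu)]
  exact Function.invFunOn_eq (hf.surjOn hu)

theorem branchInv_realPart {x : ℝ} (hx : 0 < x) : branchInv f (realPart f x) = x :=
  hf.strictMonoOn.injOn (hf.branchInv_pos (hf.realPart_pos_of_pos hx)).le hx.le
    (hf.realPart_branchInv (hf.realPart_pos_of_pos hx))

theorem hasStrictDerivAt_branchInv {u : ℝ} (hu : 0 < u) :
    HasStrictDerivAt (branchInv f) (deriv (realPart f) (branchInv f u))⁻¹ u := by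
  have hx := hf.branchInv_pos hu
  have := (hf.hasStrictDerivAt_of_pos hx).to_local_left_inverse (hf.deriv_pos _ hx).ne'
    (g := branchInv f) (by
      filter_upwards [Ioi_mem_nhds hx] with y hy using hf.branchInv_realPart hy)
  rwa [hf.realPart_branchInv hu] at this

theorem continuousOn_branchInv : ContinuousOn (branchInv f) (Ioi 0) := fun _ hu =>
  (hf.hasStrictDerivAt_branchInv hu).hasDerivAt.continuousAt.continuousWithinAt

theorem measurable_branchInv : Measurable (branchInv f) := by
  classical
  have h : ContinuousOn (Function.invFunOn (realPart f) (Ioi 0)) (Ioi 0) :=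
    hf.continuousOn_branchInv.congr fun u hu => by rw [branchInv, indicator_of_mem hu]
  rw [branchInv, ← piecewise_eq_indicator]
  exact h.measurable_piecewise continuousOn_const measurableSet_Ioi

theorem image_branchInv : branchInv f '' Ioi 0 = Ioi 0 := by
  ext x
  exact ⟨fun ⟨u, hu, h⟩ => h ▸ hf.branchInv_pos hu, fun hx =>
    ⟨realPart f x, hf.realPart_pos_of_pos hx, hf.branchInv_realPart hx⟩⟩

theorem continuousOn_deriv_branchInv :
    ContinuousOn (fun u => deriv (realPart f) (branchInv f u)) (Ioi 0) :=
  hf.continuousOn_deriv.comp hf.continuousOn_branchInv fun _ hu => hf.branchInv_pos hu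

theorem deriv_branchInv_pos {u : ℝ} (hu : 0 < u) : 0 < deriv (realPart f) (branchInv f u) :=
  hf.deriv_pos _ (hf.branchInv_pos hu)

theorem half_line_or_even' : ((∀ x, x < 0 → f x = ⊤) ∧ signs f = {1}) ∨
    ((∀ x, f (-x) = f x) ∧ signs f = {1, -1}) := by
  rcases hf.half_line_or_even with h | h
  · exact Or.inl ⟨h, by simp [signs, h (-1) (by norm_num)]⟩
  · refine Or.inr ⟨h, ?_⟩
    rw [signs, if_neg]
    rw [h]
    exact (hf.finite_pos 1 one_pos).1

theorem card_signs_ne_zero : ((signs f).card : ℝ≥0∞) ≠ 0 := by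
  rcases hf.half_line_or_even' with ⟨-, h⟩ | ⟨-, h⟩ <;> rw [h] <;> simp

theorem mem_finSupport_iff {x : ℝ} : x ∈ finSupport f ↔ ∃ s ∈ signs f, ∃ y > 0, x = s * y := by
  rcases hf.half_line_or_even' with ⟨h, hs⟩ | ⟨h, hs⟩
  · rw [hs]
    simp only [finSupport, mem_ofPred_eq, Finset.mem_singleton, exists_eq_left, one_mul]
    constructor
    · rintro ⟨h0, h1⟩
      refine ⟨x, lt_of_le_of_ne (not_lt.1 fun hx => h1 (h x hx)) h0.symm, rfl⟩
    · rintro ⟨y, hy, rfl⟩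
      exact ⟨hy.ne', (hf.finite_pos _ hy).1⟩
  · rw [hs]
    simp only [finSupport, mem_ofPred_eq, Finset.mem_insert, Finset.mem_singleton, exists_eq_or_imp,
      exists_eq_left, one_mul, neg_one_mul]
    constructor
    · rintro ⟨h0, h1⟩
      rcases lt_or_gt_of_ne h0 with hx | hx
      · exact Or.inr ⟨-x, neg_pos.2 hx, by simp⟩
      · exact Or.inl ⟨x, hx, rfl⟩
    · rintro (⟨y, hy, rfl⟩ | ⟨y, hy, rfl⟩)
      · exact ⟨hy.ne', (hf.finite_pos _ hy).1⟩
      · exact ⟨neg_ne_zero.2 hy.ne', by rw [h]; exact (hf.finite_pos _ hy).1⟩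

theorem signs_eq {s : ℝ} (hs : s ∈ signs f) : s = 1 ∨ (s = -1 ∧ ∀ x, f (-x) = f x) := by
  rcases hf.half_line_or_even' with ⟨h, h'⟩ | ⟨h, h'⟩
  · rw [h'] at hs; exact Or.inl (by simpa using hs)
  · rw [h'] at hs
    simp only [Finset.mem_insert, Finset.mem_singleton] at hs
    exact hs.imp id fun h1 => ⟨h1, h⟩

theorem apply_sign_mul {s : ℝ} (hs : s ∈ signs f) (y : ℝ) : f (s * y) = f y := by
  rcases hf.signs_eq hs with rfl | ⟨rfl, h⟩
  · rw [one_mul]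
  · rw [neg_one_mul, h]

theorem realPart_sign_mul {s : ℝ} (hs : s ∈ signs f) (y : ℝ) :
    realPart f (s * y) = realPart f y := by rw [realPart, hf.apply_sign_mul hs, realPart]

theorem deriv_sign_mul {s : ℝ} (hs : s ∈ signs f) (y : ℝ) :
    deriv (realPart f) (s * y) = s * deriv (realPart f) y := by
  rcases hf.signs_eq hs with rfl | ⟨rfl, h⟩
  · simp
  · have heq : realPart f = fun x => realPart f (-x) := by
      ext x; rw [realPart, realPart, h]
    rw [neg_one_mul, neg_one_mul]
    conv_lhs => rw [heq, deriv_comp_neg, neg_neg]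

theorem hasStrictDerivAt {x : ℝ} (hx : x ∈ finSupport f) :
    HasStrictDerivAt (realPart f) (deriv (realPart f) x) x := by
  obtain ⟨s, hs, y, hy, rfl⟩ := hf.mem_finSupport_iff.1 hx
  have hss : s * s = 1 := by rcases hf.signs_eq hs with rfl | ⟨rfl, -⟩ <;> norm_num
  have heq : (realPart f ∘ fun x => s * x) = realPart f := funext fun x =>
    hf.realPart_sign_mul hs x
  have h1 : HasStrictDerivAt (fun x : ℝ => s * x) s (s * y) := by
    simpa using (hasStrictDerivAt_id (s * y)).const_mul s
  have h2 : HasStrictDerivAt (realPart f) (deriv (realPart f) y) (s * (s * y)) := by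
    rw [← mul_assoc, hss, one_mul]
    exact hf.hasStrictDerivAt_of_pos hy
  have := h2.comp (s * y) h1
  rw [heq] at this
  rwa [hf.deriv_sign_mul hs, mul_comm]

theorem coe_realPart {x : ℝ} (hx : x ∈ finSupport f) : (realPart f x : EReal) = f x := by
  obtain ⟨s, hs, y, hy, rfl⟩ := hf.mem_finSupport_iff.1 hx
  rw [hf.realPart_sign_mul hs, hf.apply_sign_mul hs, hf.coe_realPart_of_pos hy]

theorem realPart_pos {x : ℝ} (hx : x ∈ finSupport f) : 0 < realPart f x := by
  obtain ⟨s, hs, y, hy, rfl⟩ := hf.mem_finSupport_iff.1 hx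
  rw [hf.realPart_sign_mul hs]
  exact hf.realPart_pos_of_pos hy

theorem deriv_mul_self_pos {x : ℝ} (hx : x ∈ finSupport f) : 0 < deriv (realPart f) x * x := by
  obtain ⟨s, hs, y, hy, rfl⟩ := hf.mem_finSupport_iff.1 hx
  have hss : s * s = 1 := by rcases hf.signs_eq hs with rfl | ⟨rfl, -⟩ <;> norm_num
  rw [hf.deriv_sign_mul hs, show s * deriv (realPart f) y * (s * y) =
    (s * s) * (deriv (realPart f) y * y) by ring, hss, one_mul]
  exact mul_pos (hf.deriv_pos y hy) hy

theorem apply_nonneg (x : ℝ) : 0 ≤ f x := by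
  by_cases h0 : x = 0
  · rw [h0, hf.map_zero]
  by_cases h1 : f x = ⊤
  · rw [h1]; exact le_top
  · have hx : x ∈ finSupport f := ⟨h0, h1⟩
    rw [← hf.coe_realPart hx]
    exact_mod_cast (hf.realPart_pos hx).le

theorem smul_mem_finSupport {x κ : ℝ} (hx : x ∈ finSupport f) (hκ : 0 < κ) :
    κ * x ∈ finSupport f := by
  obtain ⟨s, hs, y, hy, rfl⟩ := hf.mem_finSupport_iff.1 hx
  exact hf.mem_finSupport_iff.2 ⟨s, hs, κ * y, by positivity, by ring⟩

theorem finSupport_eq : finSupport f = Ioi 0 ∨ finSupport f = {0}ᶜ := by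
  rcases hf.half_line_or_even' with ⟨h, hs⟩ | ⟨h, hs⟩
  · left
    ext x
    rw [hf.mem_finSupport_iff, hs]
    simp
  · right
    ext x
    rw [hf.mem_finSupport_iff, hs]
    simp only [Finset.mem_insert, Finset.mem_singleton, exists_eq_or_imp, exists_eq_left, one_mul,
      neg_one_mul, mem_compl_iff, mem_singleton_iff]
    constructor
    · rintro (⟨y, hy, rfl⟩ | ⟨y, hy, rfl⟩)
      · exact hy.ne'
      · exact neg_ne_zero.2 hy.ne'
    · intro h0
      rcases lt_or_gt_of_ne h0 with hx | hx
      · exact Or.inr ⟨-x, neg_pos.2 hx, by simp⟩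
      · exact Or.inl ⟨x, hx, rfl⟩

theorem isOpen_finSupport : IsOpen (finSupport f) := by
  rcases hf.finSupport_eq with h | h <;> rw [h]
  exacts [isOpen_Ioi, isOpen_compl_singleton]

theorem continuousOn_realPart : ContinuousOn (realPart f) (finSupport f) := fun _ hx =>
  (hf.hasStrictDerivAt hx).hasDerivAt.continuousAt.continuousWithinAt

theorem continuousOn_deriv_finSupport : ContinuousOn (deriv (realPart f)) (finSupport f) := by
  intro x hx
  refine ContinuousAt.continuousWithinAt ?_
  obtain ⟨s, hs, y, hy, rfl⟩ := hf.mem_finSupport_iff.1 hx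
  have hss : s * s = 1 := by rcases hf.signs_eq hs with rfl | ⟨rfl, -⟩ <;> norm_num
  have heq : deriv (realPart f) = fun x => s * deriv (realPart f) (s * x) := funext fun x => by
    rw [hf.deriv_sign_mul hs, ← mul_assoc, hss, one_mul]
  rw [heq]
  have h2 : ContinuousAt (deriv (realPart f)) (s * (s * y)) := by
    rw [← mul_assoc, hss, one_mul]
    exact hf.continuousOn_deriv.continuousAt (Ioi_mem_nhds hy)
  exact continuousAt_const.mul (ContinuousAt.comp (f := fun x => s * x) h2 (by fun_prop))

theorem measurable_realPart : Measurable (realPart f) := by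
  classical
  have : realPart f = (finSupport f).piecewise (realPart f) fun _ => 0 := by
    ext x
    by_cases hx : x ∈ finSupport f
    · rw [piecewise_eq_of_mem _ _ _ hx]
    · rw [piecewise_eq_of_notMem _ _ _ hx]
      by_cases h0 : x = 0
      · rw [h0, hf.realPart_zero]
      · have : f x = ⊤ := by by_contra h; exact hx ⟨h0, h⟩
        simp [realPart, this]
  rw [this]
  exact hf.continuousOn_realPart.measurable_piecewise continuousOn_const
    hf.isOpen_finSupport.measurableSet

theorem measurable_apply : Measurable f := by
  classical
  have hset : MeasurableSet (finSupport f) := hf.isOpen_finSupport.measurableSet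
  have : f = (finSupport f).piecewise (fun x => (realPart f x : EReal))
      fun x => if x = 0 then 0 else ⊤ := by
    ext x
    by_cases hx : x ∈ finSupport f
    · rw [piecewise_eq_of_mem _ _ _ hx, hf.coe_realPart hx]
    · rw [piecewise_eq_of_notMem _ _ _ hx]
      split_ifs with h0
      · rw [h0, hf.map_zero]
      · by_contra h; exact hx ⟨h0, h⟩
  rw [this]
  refine Measurable.piecewise hset hf.measurable_realPart.coe_real_ereal ?_
  exact Measurable.ite (measurableSet_singleton 0) measurable_const measurable_const

theorem exists_inv_deriv_le : ∃ j : ℕ, ∃ K : ℝ, 0 ≤ K ∧ ∀ u > 0,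
    (deriv (realPart f) (branchInv f u))⁻¹ ≤ K * (u ^ (1 / (j + 1 : ℝ) - 1) + 1) := by
  obtain ⟨q, a₃, hq1, hq2, ha₃, hlim⟩ := hf.deriv_zero
  obtain ⟨a₁, a₂, ha₁, ha₂, htail⟩ := hf.deriv_tail
  obtain ⟨j, hj⟩ := exists_nat_one_div_lt (show 0 < 1 - 1 / q by
    rw [sub_pos, div_lt_one (by linarith)]; exact hq1)
  have hev : ∀ᶠ x in 𝓝[>] (0 : ℝ), a₃ / 2 < deriv (realPart f) x ^ q / realPart f x := by
    have : ((a₃ / 2 : ℝ) : EReal) < liminf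
        (fun x => ((deriv (realPart f) x ^ q / realPart f x : ℝ) : EReal)) (𝓝[>] 0) :=
      lt_of_lt_of_le (by exact_mod_cast half_lt_self ha₃) hlim
    filter_upwards [eventually_lt_of_lt_liminf this] with x hx
    exact_mod_cast hx
  obtain ⟨δ, hδ, hδP⟩ := mem_nhdsGT_iff_exists_Ioo_subset.1 hev
  have hδ : 0 < δ := hδ
  set u₀ := min 1 (realPart f δ) with hu₀
  have hu₀pos : 0 < u₀ := lt_min one_pos (hf.realPart_pos_of_pos hδ)
  set u₁ := realPart f (a₂ + 1) with hu₁
  have hlt_iff : ∀ {u x : ℝ}, 0 < u → 0 < x → (branchInv f u < x ↔ u < realPart f x) := by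
    intro u x hu hx
    have := hf.strictMonoOn.lt_iff_lt (hf.branchInv_pos hu).le hx.le
    rw [hf.realPart_branchInv hu] at this
    exact this.symm
  obtain ⟨K₁, hK₁⟩ : ∃ K₁, ∀ u ∈ Icc u₀ u₁, (deriv (realPart f) (branchInv f u))⁻¹ ≤ K₁ := by
    have hc : ContinuousOn (fun u => (deriv (realPart f) (branchInv f u))⁻¹) (Icc u₀ u₁) := by
      refine ContinuousOn.inv₀ (hf.continuousOn_deriv_branchInv.mono fun u hu => ?_) fun u hu => ?_
      · exact hu₀pos.trans_le hu.1
      · exact (hf.deriv_branchInv_pos (hu₀pos.trans_le hu.1)).ne'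
    obtain ⟨K₁, hK₁⟩ := (isCompact_Icc.image_of_continuousOn hc).bddAbove
    exact ⟨K₁, fun u hu => hK₁ ⟨u, hu, rfl⟩⟩
  set K₀ := ((a₃ / 2) ^ (1 / q))⁻¹ with hK₀
  have hK₀0 : 0 ≤ K₀ := by positivity
  refine ⟨j, K₀ + |K₁| + a₁⁻¹, by positivity, fun u hu => ?_⟩
  have hup : 0 ≤ u ^ (1 / (j + 1 : ℝ) - 1) := by positivity
  have hai : 0 ≤ a₁⁻¹ := by positivity
  have hKa := abs_nonneg K₁
  have hfinish : ∀ y, 0 ≤ y → (y ≤ K₀ * u ^ (1 / (j + 1 : ℝ) - 1) ∨ y ≤ |K₁| ∨ y ≤ a₁⁻¹) →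
      y ≤ (K₀ + |K₁| + a₁⁻¹) * (u ^ (1 / (j + 1 : ℝ) - 1) + 1) := by
    intro y _ h
    have e1 := mul_nonneg hK₀0 hup
    have e2 := mul_nonneg hKa hup
    have e3 := mul_nonneg hai hup
    rcases h with h | h | h <;> nlinarith
  refine hfinish _ (inv_nonneg.2 (hf.deriv_branchInv_pos hu).le) ?_
  rcases lt_or_ge u u₀ with h | h
  · left
    have hx := hf.branchInv_pos hu
    have hxδ : branchInv f u < δ := (hlt_iff hu hδ).2 (h.trans_le (min_le_right _ _))
    have hP : a₃ / 2 < deriv (realPart f) (branchInv f u) ^ q / realPart f (branchInv f u) :=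
      hδP ⟨hx, hxδ⟩
    rw [hf.realPart_branchInv hu, lt_div_iff₀ hu] at hP
    have hd := hf.deriv_branchInv_pos hu
    have h3 : (a₃ / 2) ^ (1 / q) * u ^ (1 / q) ≤ deriv (realPart f) (branchInv f u) := by
      rw [← Real.mul_rpow (by positivity) hu.le]
      calc (a₃ / 2 * u) ^ (1 / q) ≤ (deriv (realPart f) (branchInv f u) ^ q) ^ (1 / q) :=
            Real.rpow_le_rpow (by positivity) hP.le (by positivity)
        _ = _ := by
            rw [← Real.rpow_mul hd.le, mul_one_div_cancel (by linarith), Real.rpow_one]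
    calc (deriv (realPart f) (branchInv f u))⁻¹ ≤ ((a₃ / 2) ^ (1 / q) * u ^ (1 / q))⁻¹ :=
          inv_anti₀ (by positivity) h3
      _ = K₀ * u ^ (-(1 / q)) := by rw [mul_inv, Real.rpow_neg hu.le]
      _ ≤ K₀ * u ^ (1 / (j + 1 : ℝ) - 1) := by
          refine mul_le_mul_of_nonneg_left ?_ hK₀0
          exact Real.rpow_le_rpow_of_exponent_ge hu (h.le.trans (min_le_left _ _)) (by linarith)
  · rcases le_or_gt u u₁ with h' | h'
    · exact Or.inr (Or.inl ((hK₁ u ⟨h, h'⟩).trans (le_abs_self _)))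
    · right; right
      refine inv_anti₀ ha₁ (htail _ ?_)
      have : ¬ branchInv f u < a₂ + 1 := fun hc =>
        absurd ((hlt_iff hu (by linarith)).1 hc) (not_lt.2 h'.le)
      linarith [not_lt.1 this]

end ClassF

/-! ### The Gibbs measure on the line and the law of the energy under it -/

theorem volume_preserving_snoc (d : ℕ) :
    MeasurePreserving fun p : ℝ × EuclideanSpace ℝ (Fin d) => snoc p.2 p.1 := by
  have h1 := (volume_preserving_piFinSuccAbove (fun _ : Fin (d + 1) => ℝ) (Fin.last d)).symm
  have h2 : MeasurePreserving (Prod.map (id : ℝ → ℝ) (@WithLp.ofLp 2 (Fin d → ℝ))) :=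
    (MeasurePreserving.id volume).prod (PiLp.volume_preserving_ofLp (Fin d))
  have h3 := (PiLp.volume_preserving_toLp (Fin (d + 1))).comp (h1.comp h2)
  convert h3 using 1
  ext p i
  refine Fin.lastCases ?_ (fun j => ?_) i
  · simp [MeasurableEquiv.piFinSuccAbove, Fin.insertNthEquiv]
  · simp [MeasurableEquiv.piFinSuccAbove, Fin.insertNthEquiv]

theorem lintegral_snoc {d : ℕ} {H : EuclideanSpace ℝ (Fin (d + 1)) → ℝ≥0∞} (hH : Measurable H) :
    ∫⁻ x, H x = ∫⁻ y : EuclideanSpace ℝ (Fin d), ∫⁻ a : ℝ, H (snoc y a) := by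
  have hp := volume_preserving_snoc d
  rw [← hp.lintegral_comp hH, Measure.volume_eq_prod]
  exact lintegral_prod_symm _ (hH.comp hp.measurable).aemeasurable

/-- The Gibbs density on the line. -/
noncomputable def gibbsOne (f : ℝ → EReal) (c : ℝ) (x : ℝ) : ℝ≥0∞ :=
  EReal.exp (-((c : EReal) * f x)) / partitionFn f c

/-- The derivative of the distribution function of `f` under the measure `e^{-cf} dx`. -/
noncomputable def rawDensity (f : ℝ → EReal) (c : ℝ) (u : ℝ) : ℝ≥0∞ :=
  ENNReal.ofReal (Real.exp (-(c * u)) * (deriv (realPart f) (branchInv f u))⁻¹)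

/-- The density of the energy `f` under the Gibbs measure on the line. -/
noncomputable def energyDensity (f : ℝ → EReal) (c : ℝ) : ℝ → ℝ≥0∞ :=
  (Ioi 0).indicator fun u => (signs f).card * rawDensity f c u / partitionFn f c

namespace ClassF

variable {f : ℝ → EReal} (hf : ClassF f)
include hf

theorem exp_neg_mul {x : ℝ} (hx : x ∈ finSupport f) (c : ℝ) :
    EReal.exp (-((c : EReal) * f x)) = ENNReal.ofReal (Real.exp (-(c * realPart f x))) := by
  rw [← hf.coe_realPart hx, ← EReal.coe_mul, ← EReal.coe_neg, EReal.exp_coe]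

omit hf in
theorem exp_neg_mul_of_eq_top {x c : ℝ} (hc : 0 < c) (hx : f x = ⊤) :
    EReal.exp (-((c : EReal) * f x)) = 0 := by
  rw [hx, EReal.coe_mul_top_of_pos hc, EReal.neg_top, EReal.exp_bot]

theorem measurable_exp_neg_mul (c : ℝ) : Measurable fun x => EReal.exp (-((c : EReal) * f x)) := by
  classical
  have : (fun x => EReal.exp (-((c : EReal) * f x))) = (finSupport f).piecewise
      (fun x => ENNReal.ofReal (Real.exp (-(c * realPart f x))))
      (fun x => if x = 0 then EReal.exp (-((c : EReal) * 0)) else EReal.exp (-((c : EReal) * ⊤))) := by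
    ext x
    by_cases hx : x ∈ finSupport f
    · rw [piecewise_eq_of_mem _ _ _ hx, hf.exp_neg_mul hx]
    · rw [piecewise_eq_of_notMem _ _ _ hx]
      split_ifs with h0
      · rw [h0, hf.map_zero]
      · rw [show f x = ⊤ by by_contra h; exact hx ⟨h0, h⟩]
  rw [this]
  have := hf.measurable_realPart
  refine Measurable.piecewise hf.isOpen_finSupport.measurableSet (by fun_prop) ?_
  exact Measurable.ite (measurableSet_singleton 0) measurable_const measurable_const

theorem measurable_gibbsOne (c : ℝ) : Measurable (gibbsOne f c) :=
  (hf.measurable_exp_neg_mul c).div_const _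

theorem measurable_indicator_rawDensity (c : ℝ) :
    Measurable ((Ioi 0).indicator (rawDensity f c)) := by
  classical
  rw [← piecewise_eq_indicator]
  refine ContinuousOn.measurable_piecewise ?_ continuousOn_const measurableSet_Ioi
  refine ENNReal.continuous_ofReal.comp_continuousOn ?_
  refine ContinuousOn.mul (by fun_prop) (hf.continuousOn_deriv_branchInv.inv₀ fun u hu => ?_)
  exact (hf.deriv_branchInv_pos hu).ne'

theorem measurable_energyDensity (c : ℝ) : Measurable (energyDensity f c) := by
  have : energyDensity f c = fun u =>
      (signs f).card * (Ioi 0).indicator (rawDensity f c) u / partitionFn f c := by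
    ext u
    by_cases hu : u ∈ Ioi (0 : ℝ) <;> simp [energyDensity, hu]
  rw [this]
  exact ((hf.measurable_indicator_rawDensity c).const_mul _).div_const _

theorem lintegral_finSupport {h : ℝ → ℝ≥0∞} (hh : ∀ s ∈ signs f, ∀ y > 0, h (s * y) = h y) :
    ∫⁻ x in finSupport f, h x = (signs f).card * ∫⁻ x in Ioi 0, h x := by
  rcases hf.half_line_or_even' with ⟨h1, hs⟩ | ⟨h1, hs⟩
  · have : finSupport f = Ioi 0 := by
      ext x; rw [hf.mem_finSupport_iff, hs]; simp
    rw [this, hs]; simp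
  · have : finSupport f = Ioi 0 ∪ Iio 0 := by
      rcases hf.finSupport_eq with h2 | h2
      · exfalso
        have : (-1 : ℝ) ∈ finSupport f :=
          hf.mem_finSupport_iff.2 ⟨-1, by simp [hs], 1, one_pos, by norm_num⟩
        rw [h2, mem_Ioi] at this
        linarith
      · rw [h2, union_comm, Iio_union_Ioi]
    rw [this, lintegral_union measurableSet_Iio (by
      rw [Set.disjoint_left]; intro x hx hx'; exact lt_asymm (mem_Ioi.1 hx) hx')]
    have hneg : ∫⁻ x in Iio (0 : ℝ), h x = ∫⁻ x in Ioi (0 : ℝ), h x := by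
      have := (Measure.measurePreserving_neg (volume : Measure ℝ)).setLIntegral_comp_preimage_emb
        (MeasurableEquiv.neg ℝ).measurableEmbedding h (Iio 0)
      rw [← this]
      have hset : (Neg.neg : ℝ → ℝ) ⁻¹' Iio 0 = Ioi 0 := by ext; simp
      rw [hset]
      refine setLIntegral_congr_fun measurableSet_Ioi fun x hx => ?_
      simpa using hh (-1) (by simp [hs]) x hx
    rw [hneg, hs, Finset.card_pair (by norm_num)]
    push_cast
    rw [two_mul]

theorem lintegral_comp_mul_exp {c : ℝ} (hc : 0 < c) (Φ : ℝ → ℝ≥0∞) :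
    ∫⁻ x, Φ (realPart f x) * EReal.exp (-((c : EReal) * f x)) =
      (signs f).card * ∫⁻ u in Ioi 0, Φ u * rawDensity f c u := by
  have e1 : ∫⁻ x, Φ (realPart f x) * EReal.exp (-((c : EReal) * f x)) =
      ∫⁻ x in finSupport f, Φ (realPart f x) * EReal.exp (-((c : EReal) * f x)) := by
    rw [← lintegral_indicator hf.isOpen_finSupport.measurableSet]
    refine lintegral_congr_ae ?_
    have h0 : ∀ᵐ x : ℝ, x ≠ 0 := by
      rw [ae_iff]; simp
    filter_upwards [h0] with x hx
    by_cases hx' : x ∈ finSupport f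
    · rw [indicator_of_mem hx']
    · rw [indicator_of_notMem hx', exp_neg_mul_of_eq_top hc (by by_contra h; exact hx' ⟨hx, h⟩),
        mul_zero]
  rw [e1, hf.lintegral_finSupport fun s hs y _ => by
    rw [hf.realPart_sign_mul hs, hf.apply_sign_mul hs]]
  congr 1
  conv_lhs => rw [← hf.image_branchInv]
  rw [lintegral_image_eq_lintegral_abs_deriv_mul measurableSet_Ioi
    (fun u hu => (hf.hasStrictDerivAt_branchInv hu).hasDerivAt.hasDerivWithinAt)
    (fun u hu v hv h => by
      rw [← hf.realPart_branchInv hu, ← hf.realPart_branchInv hv, h])]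
  refine setLIntegral_congr_fun measurableSet_Ioi fun u hu => ?_
  have hu : 0 < u := hu
  have hpos := inv_pos.2 (hf.deriv_branchInv_pos hu)
  rw [hf.realPart_branchInv hu, hf.exp_neg_mul ⟨(hf.branchInv_pos hu).ne',
    (hf.finite_pos _ (hf.branchInv_pos hu)).1⟩, hf.realPart_branchInv hu, rawDensity,
    abs_of_pos hpos, ENNReal.ofReal_mul (Real.exp_nonneg _)]
  ring

theorem lintegral_rpow_mul_rawDensity_lt_top {c : ℝ} (hc : 0 < c) {k : ℝ} (hk : 0 ≤ k) :
    ∫⁻ u in Ioi 0, ENNReal.ofReal (u ^ k) * rawDensity f c u < ⊤ := by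
  obtain ⟨j, K, hK, hb⟩ := hf.exists_inv_deriv_le
  set α := 1 / (j + 1 : ℝ) with hα
  have hα0 : 0 < α := by positivity
  have i1 := integrableOn_rpow_mul_exp_neg_mul_rpow (p := 1) (s := k + (α - 1)) (b := c)
    (by linarith) one_pos hc
  have i2 := integrableOn_rpow_mul_exp_neg_mul_rpow (p := 1) (s := k) (b := c)
    (by linarith) one_pos hc
  have i3 : IntegrableOn (fun u : ℝ => K * (u ^ (k + (α - 1)) * Real.exp (-c * u ^ (1 : ℝ)) +
      u ^ k * Real.exp (-c * u ^ (1 : ℝ)))) (Ioi 0) := (i1.add i2).const_mul K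
  refine lt_of_le_of_lt (setLIntegral_mono' measurableSet_Ioi fun u hu => ?_) i3.lintegral_lt_top
  have hu : 0 < u := hu
  rw [rawDensity, ← ENNReal.ofReal_mul (by positivity)]
  refine ENNReal.ofReal_le_ofReal ?_
  rw [Real.rpow_one, Real.rpow_add hu, neg_mul]
  calc u ^ k * (Real.exp (-(c * u)) * (deriv (realPart f) (branchInv f u))⁻¹)
      ≤ u ^ k * (Real.exp (-(c * u)) * (K * (u ^ (α - 1) + 1))) := by
        gcongr
        exact hb u hu
    _ = _ := by ring

theorem partitionFn_eq {c : ℝ} (hc : 0 < c) :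
    partitionFn f c = (signs f).card * ∫⁻ u in Ioi 0, rawDensity f c u := by
  have := hf.lintegral_comp_mul_exp hc fun _ => 1
  simpa [partitionFn] using this

theorem partitionFn_ne_top {c : ℝ} (hc : 0 < c) : partitionFn f c ≠ ⊤ := by
  rw [hf.partitionFn_eq hc]
  refine ENNReal.mul_ne_top (by simp) ?_
  simpa using (hf.lintegral_rpow_mul_rawDensity_lt_top hc le_rfl).ne

theorem partitionFn_ne_zero {c : ℝ} (hc : 0 < c) : partitionFn f c ≠ 0 := by
  rw [hf.partitionFn_eq hc]
  refine mul_ne_zero hf.card_signs_ne_zero ?_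
  rw [← lintegral_indicator measurableSet_Ioi, Ne,
    lintegral_eq_zero_iff (hf.measurable_indicator_rawDensity c)]
  intro h
  have h2 : volume (Ioi (0 : ℝ)) = 0 := by
    refine measure_mono_null (fun u hu => ?_) (ae_iff.1 h)
    have hu' : 0 < u := hu
    simp only [mem_ofPred_eq, Pi.zero_apply, indicator_of_mem hu, rawDensity,
      ENNReal.ofReal_eq_zero, not_le]
    exact mul_pos (Real.exp_pos _) (inv_pos.2 (hf.deriv_branchInv_pos hu'))
  simp at h2

/-- The law of the energy under the Gibbs measure. -/
theorem lintegral_comp_mul_gibbsOne {c : ℝ} (hc : 0 < c) (Φ : ℝ → ℝ≥0∞) :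
    ∫⁻ x, Φ (realPart f x) * gibbsOne f c x = ∫⁻ u, Φ u * energyDensity f c u := by
  have hZ := hf.partitionFn_ne_zero hc
  have e1 : ∀ x, Φ (realPart f x) * gibbsOne f c x =
      Φ (realPart f x) * EReal.exp (-((c : EReal) * f x)) * (partitionFn f c)⁻¹ := fun x => by
    rw [gibbsOne, div_eq_mul_inv, mul_assoc]
  have e2 : ∀ u, Φ u * energyDensity f c u = (Ioi 0).indicator (fun u =>
      (signs f).card * (partitionFn f c)⁻¹ * (Φ u * rawDensity f c u)) u := fun u => by
    by_cases hu : u ∈ Ioi (0 : ℝ)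
    · simp only [energyDensity, indicator_of_mem hu, div_eq_mul_inv]; ring
    · simp [energyDensity, hu]
  simp_rw [e1, e2]
  rw [lintegral_mul_const' _ _ (ENNReal.inv_ne_top.2 hZ), hf.lintegral_comp_mul_exp hc,
    lintegral_indicator measurableSet_Ioi, lintegral_const_mul' _ _ (ENNReal.mul_ne_top (by simp)
      (ENNReal.inv_ne_top.2 hZ))]
  ring

theorem lintegral_gibbsOne {c : ℝ} (hc : 0 < c) : ∫⁻ x, gibbsOne f c x = 1 := by
  simp_rw [gibbsOne, div_eq_mul_inv]
  rw [lintegral_mul_const' _ _ (ENNReal.inv_ne_top.2 (hf.partitionFn_ne_zero hc))]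
  exact ENNReal.mul_inv_cancel (hf.partitionFn_ne_zero hc) (hf.partitionFn_ne_top hc)

theorem lintegral_energyDensity {c : ℝ} (hc : 0 < c) : ∫⁻ u, energyDensity f c u = 1 := by
  have := hf.lintegral_comp_mul_gibbsOne hc fun _ => 1
  simpa [hf.lintegral_gibbsOne hc] using this.symm

theorem integrable_cube_energyDensity {c : ℝ} (hc : 0 < c) :
    Integrable (fun u => |u| ^ 3) (volume.withDensity (energyDensity f c)) := by
  refine ⟨by fun_prop, ?_⟩
  rw [hasFiniteIntegral_iff_ofReal (ae_of_all _ fun u => by positivity),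
    lintegral_withDensity_eq_lintegral_mul _ (hf.measurable_energyDensity c) (by fun_prop)]
  have hZ := hf.partitionFn_ne_zero hc
  have e2 : ∀ u, (energyDensity f c * fun u => ENNReal.ofReal (|u| ^ 3)) u =
      (Ioi 0).indicator (fun u => (signs f).card * (partitionFn f c)⁻¹ *
        (ENNReal.ofReal (u ^ (3 : ℝ)) * rawDensity f c u)) u := fun u => by
    by_cases hu : u ∈ Ioi (0 : ℝ)
    · have hu' : 0 < u := hu
      have : u ^ (3 : ℝ) = u ^ 3 := by norm_cast
      simp only [energyDensity, Pi.mul_apply, indicator_of_mem hu, div_eq_mul_inv, abs_of_pos hu',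
        this]
      ring
    · simp [energyDensity, hu]
  simp_rw [e2]
  rw [lintegral_indicator measurableSet_Ioi, lintegral_const_mul' _ _ (ENNReal.mul_ne_top (by simp)
    (ENNReal.inv_ne_top.2 hZ))]
  exact ENNReal.mul_lt_top (ENNReal.mul_lt_top (by simp)
    (ENNReal.inv_ne_top.2 hZ).lt_top)
    (hf.lintegral_rpow_mul_rawDensity_lt_top hc (by norm_num))

omit hf in
theorem energyDensity_of_nonpos (c : ℝ) {u : ℝ} (hu : u ≤ 0) : energyDensity f c u = 0 := by
  simp [energyDensity, hu]

theorem exists_energyDensity_le : ∃ j : ℕ, ∀ c > 0, ∃ K : ℝ, 0 ≤ K ∧ ∀ u > 0,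
    energyDensity f c u ≤ ENNReal.ofReal (K * u ^ (1 / (j + 1 : ℝ) - 1)) := by
  obtain ⟨j, K, hK, hb⟩ := hf.exists_inv_deriv_le
  refine ⟨j, fun c hc => ?_⟩
  set α := 1 / (j + 1 : ℝ) with hα
  have hα0 : 0 < α := by positivity
  have hα1 : α ≤ 1 := by rw [hα, div_le_one (by positivity)]; linarith [Nat.cast_nonneg (α := ℝ) j]
  have hZ := hf.partitionFn_ne_zero hc
  have hZ' := hf.partitionFn_ne_top hc
  set A : ℝ := (signs f).card * (partitionFn f c).toReal⁻¹ with hA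
  refine ⟨A * (K * (2 + 1 / c)), by positivity, fun u hu => ?_⟩
  have hraw : Real.exp (-(c * u)) * (deriv (realPart f) (branchInv f u))⁻¹ ≤
      K * (2 + 1 / c) * u ^ (α - 1) := by
    have e1 : Real.exp (-(c * u)) ≤ (1 + 1 / c) * u ^ (α - 1) := by
      have hcu : u * Real.exp (-(c * u)) ≤ 1 / c := by
        have := Real.add_one_le_exp (c * u)
        rw [Real.exp_neg, ← div_eq_mul_inv, div_le_div_iff₀ (Real.exp_pos _) hc]
        linarith
      have hpow : u ^ (1 - α) ≤ 1 + u := by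
        rcases le_total u 1 with h | h
        · linarith [Real.rpow_le_one hu.le h (by linarith : 0 ≤ 1 - α)]
        · have := Real.rpow_le_rpow_of_exponent_le h (by linarith : 1 - α ≤ 1)
          rw [Real.rpow_one] at this
          linarith
      have hle1 : Real.exp (-(c * u)) ≤ 1 := Real.exp_le_one_iff.2 (by nlinarith)
      have h5 : u ^ (1 - α) * Real.exp (-(c * u)) ≤ 1 + 1 / c := by
        calc _ ≤ (1 + u) * Real.exp (-(c * u)) := by gcongr
          _ ≤ _ := by linarith
      have hsplit : u ^ (α - 1) * u ^ (1 - α) = 1 := by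
        rw [← Real.rpow_add hu]; simp
      calc Real.exp (-(c * u)) = u ^ (α - 1) * (u ^ (1 - α) * Real.exp (-(c * u))) := by
            rw [← mul_assoc, hsplit, one_mul]
        _ ≤ u ^ (α - 1) * (1 + 1 / c) := by gcongr
        _ = _ := mul_comm _ _
    have hle1 : Real.exp (-(c * u)) ≤ 1 := Real.exp_le_one_iff.2 (by nlinarith)
    have hup : 0 ≤ u ^ (α - 1) := by positivity
    calc Real.exp (-(c * u)) * (deriv (realPart f) (branchInv f u))⁻¹
        ≤ Real.exp (-(c * u)) * (K * (u ^ (α - 1) + 1)) := by gcongr; exact hb u hu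
      _ = K * (Real.exp (-(c * u)) * u ^ (α - 1) + Real.exp (-(c * u))) := by ring
      _ ≤ K * (1 * u ^ (α - 1) + (1 + 1 / c) * u ^ (α - 1)) := by gcongr
      _ = _ := by ring
  have hAE : ENNReal.ofReal A = (signs f).card / partitionFn f c := by
    rw [hA, ENNReal.ofReal_mul (by positivity), ENNReal.ofReal_natCast,
      ENNReal.ofReal_inv_of_pos (ENNReal.toReal_pos hZ hZ'), ENNReal.ofReal_toReal hZ',
      div_eq_mul_inv]
  rw [energyDensity, indicator_of_mem (mem_Ioi.2 hu), mul_assoc A,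
    ENNReal.ofReal_mul (by positivity), hAE, rawDensity, ENNReal.mul_div_right_comm]
  gcongr

/-- The mean energy under the Gibbs measure. -/
theorem integral_energyDensity {c t : ℝ} (hc : 0 < c) (ht : 0 < t)
    (h : energy f (gibbs f c (n := 1)) = ENNReal.ofReal t) :
    ∫ u, u ∂(volume.withDensity (energyDensity f c)) = t := by
  have hw0 : ∀ᵐ u ∂(volume.withDensity (energyDensity f c)), 0 ≤ u := by
    rw [ae_withDensity_iff (hf.measurable_energyDensity c)]
    refine ae_of_all _ fun u hu => ?_
    by_contra hneg
    exact hu (energyDensity_of_nonpos c (not_le.1 hneg).le)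
  have hmeas : Measurable fun x : EuclideanSpace ℝ (Fin 1) => x 0 := by fun_prop
  rw [integral_eq_lintegral_of_nonneg_ae hw0 (by fun_prop),
    lintegral_withDensity_eq_lintegral_mul _ (hf.measurable_energyDensity c) (by fun_prop)]
  have e1 : ∫⁻ u, (energyDensity f c * fun u => ENNReal.ofReal u) u =
      ∫⁻ x, ENNReal.ofReal (realPart f x) * gibbsOne f c x := by
    rw [hf.lintegral_comp_mul_gibbsOne hc]
    exact lintegral_congr fun u => mul_comm _ _
  rw [e1]
  have e2 : energy f (gibbs f c (n := 1)) = ∫⁻ x, ENNReal.ofReal (realPart f x) * gibbsOne f c x := by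
    have hm := hf.measurable_apply
    have hH : Measurable fun x : ℝ => gibbsOne f c x * (f x).toENNReal :=
      (hf.measurable_gibbsOne c).mul hm.ereal_toENNReal
    have : ∀ x : EuclideanSpace ℝ (Fin 1), gibbs f c x * (energySum f x).toENNReal =
        gibbsOne f c (x 0) * (f (x 0)).toENNReal := fun x => by
      simp [gibbs, gibbsOne, energySum]
    rw [energy]
    simp_rw [this]
    rw [show ∫⁻ x : EuclideanSpace ℝ (Fin 1), gibbsOne f c (x 0) * (f (x 0)).toENNReal = _ from
      lintegral_snoc (hH.comp hmeas)]
    have hl : ∀ (y : EuclideanSpace ℝ (Fin 0)) (a : ℝ), snoc y a 0 = a := fun y a => snoc_last y a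
    simp only [hl]
    rw [lintegral_const]
    have : volume (univ : Set (EuclideanSpace ℝ (Fin 0))) = 1 := by
      rw [← (PiLp.volume_preserving_toLp (Fin 0)).measure_preimage MeasurableSet.univ.nullMeasurableSet,
        preimage_univ, volume_pi, Measure.pi_univ]
      simp
    rw [this, mul_one]
    refine lintegral_congr fun x => ?_
    by_cases hx : f x = ⊤
    · rw [gibbsOne, exp_neg_mul_of_eq_top hc hx]; simp
    · have hb : f x ≠ ⊥ := fun hb => by
        have := hf.apply_nonneg x
        rw [hb] at this
        simp at this
      rw [mul_comm, realPart, EReal.toENNReal_of_ne_top hx]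
  rw [← e2, h, ENNReal.toReal_ofReal ht.le]

end ClassF

/-! ### The energy surfaces -/

/-- The points of `ℝⁿ` all of whose coordinates are nonzero and have finite energy. -/
def regular (f : ℝ → EReal) (n : ℕ) : Set (EuclideanSpace ℝ (Fin n)) :=
  {x | ∀ i, x i ∈ finSupport f}

/-- The real-valued total energy. -/
noncomputable def realSum (f : ℝ → EReal) {n : ℕ} (x : EuclideanSpace ℝ (Fin n)) : ℝ :=
  ∑ i, realPart f (x i)

theorem realSum_snoc (f : ℝ → EReal) {d : ℕ} (y : EuclideanSpace ℝ (Fin d)) (a : ℝ) :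
    realSum f (snoc y a) = realSum f y + realPart f a := by
  simp [realSum, Fin.sum_univ_castSucc]

theorem snoc_mem_regular {f : ℝ → EReal} {d : ℕ} {y : EuclideanSpace ℝ (Fin d)} {a : ℝ} :
    snoc y a ∈ regular f (d + 1) ↔ y ∈ regular f d ∧ a ∈ finSupport f := by
  simp only [regular, mem_ofPred_eq]
  constructor
  · exact fun h => ⟨fun i => by simpa using h i.castSucc, by simpa using h (Fin.last d)⟩
  · rintro ⟨h1, h2⟩ i
    refine Fin.lastCases ?_ (fun j => ?_) i
    · simpa using h2
    · simpa using h1 j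

theorem norm_grad_snoc_sq (f : ℝ → EReal) {d : ℕ} (y : EuclideanSpace ℝ (Fin d)) (a : ℝ) :
    ‖grad f (snoc y a)‖ ^ 2 = ‖grad f y‖ ^ 2 + deriv (realPart f) a ^ 2 := by
  simp [grad, EuclideanSpace.norm_sq_eq, Fin.sum_univ_castSucc]

theorem measurable_grad (f : ℝ → EReal) (n : ℕ) : Measurable (grad f (n := n)) := by
  have h := measurable_deriv (realPart f)
  unfold grad
  refine (PiLp.volume_preserving_toLp (Fin n)).measurable.comp (measurable_pi_lambda _ fun i => ?_)
  exact h.comp (by fun_prop)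

theorem energySum_snoc (f : ℝ → EReal) {d : ℕ} (y : EuclideanSpace ℝ (Fin d)) (a : ℝ) :
    energySum f (snoc y a) = energySum f y + f a := by
  simp [energySum, Fin.sum_univ_castSucc]

namespace ClassF

variable {f : ℝ → EReal} (hf : ClassF f) {n d : ℕ}
include hf

theorem coe_realSum {x : EuclideanSpace ℝ (Fin n)} (hx : x ∈ regular f n) :
    (realSum f x : EReal) = energySum f x := by
  rw [realSum, energySum]
  rw [show ((∑ i, realPart f (x i) : ℝ) : EReal) = ∑ i, (realPart f (x i) : EReal) from
    map_sum (⟨⟨(↑), EReal.coe_zero⟩, EReal.coe_add⟩ : ℝ →+ EReal) _ _]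
  exact Finset.sum_congr rfl fun i _ => hf.coe_realPart (hx i)

theorem isOpen_regular : IsOpen (regular f n) := by
  have : regular f n = ⋂ i, (fun x : EuclideanSpace ℝ (Fin n) => x i) ⁻¹' finSupport f := by
    ext x; simp [regular]
  rw [this]
  exact isOpen_iInter_of_finite fun i => hf.isOpen_finSupport.preimage (by fun_prop)

theorem measurable_realSum : Measurable (realSum f (n := n)) := by
  have := hf.measurable_realPart
  unfold realSum
  fun_prop

theorem measurable_energySum : Measurable (energySum f (n := n)) := by
  have := hf.measurable_apply
  unfold energySum
  exact Finset.measurable_sum _ fun i _ => this.comp (by fun_prop)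

theorem energySum_nonneg (x : EuclideanSpace ℝ (Fin n)) : 0 ≤ energySum f x :=
  Finset.sum_nonneg fun i _ => hf.apply_nonneg (x i)

theorem hasStrictFDerivAt_realSum {x : EuclideanSpace ℝ (Fin n)} (hx : x ∈ regular f n) :
    HasStrictFDerivAt (realSum f) (innerSL ℝ (grad f x)) x := by
  have h : ∀ i ∈ (Finset.univ : Finset (Fin n)),
      HasStrictFDerivAt (fun y : EuclideanSpace ℝ (Fin n) => realPart f (y i))
        (deriv (realPart f) (x i) • (EuclideanSpace.proj i : EuclideanSpace ℝ (Fin n) →L[ℝ] ℝ)) x := by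
    intro i _
    have hp : HasStrictFDerivAt (fun y : EuclideanSpace ℝ (Fin n) => y i)
      (EuclideanSpace.proj i : EuclideanSpace ℝ (Fin n) →L[ℝ] ℝ) x :=
        (EuclideanSpace.proj (𝕜 := ℝ) i : EuclideanSpace ℝ (Fin n) →L[ℝ] ℝ).hasStrictFDerivAt
    exact HasStrictDerivAt.comp_hasStrictFDerivAt (f := fun y : EuclideanSpace ℝ (Fin n) => y i) x
      (hf.hasStrictDerivAt (hx i)) hp
  have e : innerSL ℝ (grad f x) = ∑ i, deriv (realPart f) (x i) •
      (EuclideanSpace.proj i : EuclideanSpace ℝ (Fin n) →L[ℝ] ℝ) := by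
    ext v
    simp [grad, PiLp.inner_apply, mul_comm]
  rw [e]
  exact HasStrictFDerivAt.fun_sum h

theorem continuousOn_grad : ContinuousOn (grad f (n := n)) (regular f n) := by
  unfold grad
  refine (PiLp.continuous_toLp 2 _).comp_continuousOn (continuousOn_pi.2 fun i => ?_)
  exact hf.continuousOn_deriv_finSupport.comp (by fun_prop) fun x hx => hx i

theorem continuousOn_realSum : ContinuousOn (realSum f (n := n)) (regular f n) := fun _ hx =>
  (hf.hasStrictFDerivAt_realSum hx).continuousAt.continuousWithinAt

/-! #### The Jacobian -/

theorem realSum_smul_lt {x : EuclideanSpace ℝ (Fin (d + 1))} (hx : x ∈ regular f (d + 1)) {a b : ℝ}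
    (ha : 0 < a) (hab : a < b) : realSum f (a • x) < realSum f (b • x) := by
  refine Finset.sum_lt_sum_of_nonempty Finset.univ_nonempty fun i _ => ?_
  obtain ⟨s, hs, y, hy, h⟩ := hf.mem_finSupport_iff.1 (hx i)
  simp only [PiLp.smul_apply, smul_eq_mul, h]
  rw [show a * (s * y) = s * (a * y) by ring, show b * (s * y) = s * (b * y) by ring,
    hf.realPart_sign_mul hs, hf.realPart_sign_mul hs]
  exact hf.strictMonoOn (mul_pos ha hy).le (mul_pos (ha.trans hab) hy).le
    (mul_lt_mul_of_pos_right hab hy)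

theorem smul_mem_regular {x : EuclideanSpace ℝ (Fin n)} (hx : x ∈ regular f n) {κ : ℝ}
    (hκ : 0 < κ) : κ • x ∈ regular f n := fun i => hf.smul_mem_finSupport (hx i) hκ

theorem scale_realSum_smul {x : EuclideanSpace ℝ (Fin (d + 1))} (hx : x ∈ regular f (d + 1))
    {κ : ℝ} (hκ : 0 < κ) : scale f (realSum f (κ • x)) x = κ := by
  have : {κ' : ℝ | 0 < κ' ∧ energySum f (κ' • x) = (realSum f (κ • x) : EReal)} = {κ} := by
    ext κ'
    simp only [mem_ofPred_eq, mem_singleton_iff]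
    constructor
    · rintro ⟨h0, h⟩
      rw [← hf.coe_realSum (hf.smul_mem_regular hx h0)] at h
      have h : realSum f (κ' • x) = realSum f (κ • x) := by exact_mod_cast h
      rcases lt_trichotomy κ' κ with hlt | heq | hgt
      · exact absurd h (hf.realSum_smul_lt hx h0 hlt).ne
      · exact heq
      · exact absurd h (hf.realSum_smul_lt hx hκ hgt).ne'
    · rintro rfl
      exact ⟨hκ, (hf.coe_realSum (hf.smul_mem_regular hx hκ)).symm⟩
  rw [scale, this, csInf_singleton]

theorem inner_grad_pos {x : EuclideanSpace ℝ (Fin (d + 1))} (hx : x ∈ regular f (d + 1)) :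
    0 < ⟪grad f x, x⟫ := by
  simp only [PiLp.inner_apply, grad]
  refine Finset.sum_pos (fun i _ => ?_) Finset.univ_nonempty
  simpa [mul_comm] using hf.deriv_mul_self_pos (hx i)

theorem jacobian_eq {x : EuclideanSpace ℝ (Fin (d + 1))} (hx : x ∈ regular f (d + 1)) {r : ℝ}
    (hr : realSum f x = r) : jacobian f r x = ‖grad f x‖⁻¹ := by
  have hD := hf.inner_grad_pos hx
  have hg : grad f x ≠ 0 := fun h => by rw [h, inner_zero_left] at hD; exact lt_irrefl _ hD
  have h1 : HasStrictDerivAt (fun κ : ℝ => realSum f (κ • x)) ⟪grad f x, x⟫ 1 := by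
    have hs : HasStrictDerivAt (fun κ : ℝ => κ • x) x 1 := by
      simpa using (hasStrictDerivAt_id (1 : ℝ)).smul_const x
    have hR : HasStrictFDerivAt (realSum f) (innerSL ℝ (grad f x)) ((1 : ℝ) • x) := by
      rw [one_smul]; exact hf.hasStrictFDerivAt_realSum hx
    simpa using! hR.comp_hasStrictDerivAt (1 : ℝ) hs
  have h2 := h1.to_local_left_inverse hD.ne' (g := fun r => scale f r x) (by
    filter_upwards [Ioi_mem_nhds (zero_lt_one' ℝ)] with κ hκ using hf.scale_realSum_smul hx hκ)
  simp only [one_smul, hr] at h2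
  have h3 : scale f r x = 1 := by
    have := hf.scale_realSum_smul hx one_pos
    rwa [one_smul, hr] at this
  have h4 : deriv (fun r' => foliation f r' x) r = (⟪grad f x, x⟫)⁻¹ • x :=
    (h2.hasDerivAt.smul_const x).deriv
  rw [jacobian, h3, h4, one_pow, one_mul, normal, inner_smul_left, inner_smul_right]
  simp only [conj_trivial, real_inner_comm (grad f x) x]
  rw [mul_left_comm, inv_mul_cancel₀ hD.ne', mul_one, abs_of_nonneg (by positivity)]

/-! #### Negligible parts -/

theorem volume_level_eq_zero {τ : ℝ} (hτ : 0 < τ) :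
    volume {y : EuclideanSpace ℝ (Fin n) | energySum f y = (τ : EReal)} = 0 := by
  cases n with
  | zero =>
    have : {y : EuclideanSpace ℝ (Fin 0) | energySum f y = (τ : EReal)} = ∅ := by
      ext y
      simp only [energySum, Finset.univ_eq_empty, Finset.sum_empty, mem_ofPred_eq,
        mem_empty_iff_false, iff_false]
      exact_mod_cast hτ.ne
    rw [this, measure_empty]
  | succ d =>
    have hm : MeasurableSet {y : EuclideanSpace ℝ (Fin (d + 1)) | energySum f y = (τ : EReal)} :=
      hf.measurable_energySum (measurableSet_singleton _)
    rw [← lintegral_indicator_one hm, lintegral_snoc (measurable_one.indicator hm)]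
    refine (lintegral_congr fun y => ?_).trans lintegral_zero
    have hset : ∀ a, (({y : EuclideanSpace ℝ (Fin (d + 1)) | energySum f y = (τ : EReal)}.indicator
        1 (snoc y a)) : ℝ≥0∞) = {a : ℝ | energySum f y + f a = (τ : EReal)}.indicator 1 a := by
      intro a
      by_cases h : energySum f y + f a = (τ : EReal)
      · rw [indicator_of_mem (by simpa [energySum_snoc] using h), indicator_of_mem (by exact h)]
        rfl
      · rw [indicator_of_notMem (by simpa [energySum_snoc] using h),
          indicator_of_notMem (by exact h)]
    simp_rw [hset]
    have hm' : MeasurableSet {a : ℝ | energySum f y + f a = (τ : EReal)} :=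
      (measurable_const.add hf.measurable_apply) (measurableSet_singleton _)
    rw [lintegral_indicator_one hm']
    set v := τ - (energySum f y).toReal with hv
    refine measure_mono_null (t := {0, branchInv f v, -branchInv f v}) (fun a ha => ?_)
      (Set.Finite.measure_zero (by simp) _)
    have ha : energySum f y + f a = (τ : EReal) := ha
    by_cases h0 : a = 0
    · simp [h0]
    have hE := hf.energySum_nonneg y
    have hA := hf.apply_nonneg a
    have hat : f a ≠ ⊤ := fun h => by
      rw [h, EReal.add_top_of_ne_bot (ne_of_gt (lt_of_lt_of_le EReal.bot_lt_zero hE))] at ha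
      simp at ha
    have het : energySum f y ≠ ⊤ := fun h => by
      rw [h, EReal.top_add_of_ne_bot (ne_of_gt (lt_of_lt_of_le EReal.bot_lt_zero hA))] at ha
      simp at ha
    have hmem : a ∈ finSupport f := ⟨h0, hat⟩
    have hval : realPart f a = v := by
      rw [← hf.coe_realPart hmem, ← EReal.coe_toReal het
        (ne_of_gt (lt_of_lt_of_le EReal.bot_lt_zero hE)), ← EReal.coe_add] at ha
      have : (energySum f y).toReal + realPart f a = τ := by exact_mod_cast ha
      linarith
    obtain ⟨s, hs, z, hz, rfl⟩ := hf.mem_finSupport_iff.1 hmem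
    rw [hf.realPart_sign_mul hs] at hval
    rw [← hval, hf.branchInv_realPart hz]
    rcases hf.signs_eq hs with rfl | ⟨rfl, -⟩ <;> simp

theorem ne_top_of_mem_surface {t : ℝ} {x : EuclideanSpace ℝ (Fin n)} (hx : x ∈ surface f n t)
    (i : Fin n) : f (x i) ≠ ⊤ := fun h => by
  have h1 : f (x i) ≤ energySum f x :=
    Finset.single_le_sum (f := fun i => f (x i)) (fun i _ => hf.apply_nonneg (x i))
      (Finset.mem_univ i)
  have hx : energySum f x = _ := hx
  rw [h, hx, top_le_iff] at h1
  exact EReal.coe_ne_top _ h1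

theorem euclideanHausdorffMeasure_surface_diff_regular {t : ℝ} (ht : 0 < t) :
    Measure.euclideanHausdorffMeasure d (surface f (d + 1) t \ regular f (d + 1)) = 0 := by
  set τ : ℝ := (d + 1 : ℕ) * t with hτ
  have hτ0 : 0 < τ := by positivity
  let ι : Fin (d + 1) → EuclideanSpace ℝ (Fin d) → EuclideanSpace ℝ (Fin (d + 1)) :=
    fun i y => WithLp.toLp 2 (Fin.insertNth (α := fun _ => ℝ) i 0 y)
  have hι : ∀ i, Isometry (ι i) := fun i => by
    refine Isometry.of_dist_eq fun y z => ?_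
    rw [EuclideanSpace.dist_eq, EuclideanSpace.dist_eq, Fin.sum_univ_succAbove _ i]
    simp [ι]
  have hsub : surface f (d + 1) t \ regular f (d + 1) ⊆
      ⋃ i, ι i '' {y | energySum f y = (τ : EReal)} := by
    rintro x ⟨hx, hxr⟩
    simp only [regular, mem_ofPred_eq, not_forall] at hxr
    obtain ⟨i, hi⟩ := hxr
    have h0 : x i = 0 := by
      by_contra h
      exact hi ⟨h, hf.ne_top_of_mem_surface hx i⟩
    refine mem_iUnion.2 ⟨i, WithLp.toLp 2 fun j => x (i.succAbove j), ?_, ?_⟩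
    · have hx : energySum f x = _ := hx
      rw [energySum, Fin.sum_univ_succAbove _ i, h0, hf.map_zero, zero_add] at hx
      exact hx
    · ext j
      refine Fin.succAboveCases i ?_ (fun j => ?_) j <;> simp [ι, h0]
  refine measure_mono_null hsub (measure_iUnion_null fun i => ?_)
  rw [(hι i).euclideanHausdorffMeasure_image, EuclideanSpace.euclideanHausdorffMeasure_eq_volume,
    hf.volume_level_eq_zero hτ0]

end ClassF

/-! ### Projections of the microcanonical measure -/

/-- The regular points of energy less than `τ`. -/
def below (f : ℝ → EReal) (d : ℕ) (τ : ℝ) : Set (EuclideanSpace ℝ (Fin d)) :=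
  {y | y ∈ regular f d ∧ realSum f y < τ}

/-- The point of energy `τ` over `y` whose last coordinate has sign `s`. -/
noncomputable def branch (f : ℝ → EReal) {d : ℕ} (τ s : ℝ) (y : EuclideanSpace ℝ (Fin d)) :
    EuclideanSpace ℝ (Fin (d + 1)) :=
  snoc y (s * branchInv f (τ - realSum f y))

theorem measurable_proj {n k : ℕ} (h : k ≤ n) : Measurable (proj h) := by
  unfold proj
  exact (PiLp.volume_preserving_toLp (Fin k)).measurable.comp
    (measurable_pi_lambda _ fun i => by fun_prop)

namespace ClassF

variable {f : ℝ → EReal} (hf : ClassF f) {n d : ℕ}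
include hf

theorem gibbs_snoc {c : ℝ} (hc : 0 < c) (y : EuclideanSpace ℝ (Fin d)) (a : ℝ) :
    gibbs f c (snoc y a) = gibbs f c y * gibbsOne f c a := by
  have hZ := hf.partitionFn_ne_zero hc
  have hZ' := hf.partitionFn_ne_top hc
  have hcE : (0 : EReal) ≤ c := by exact_mod_cast hc.le
  have h1 := mul_nonneg hcE (hf.energySum_nonneg y)
  have h2 := mul_nonneg hcE (hf.apply_nonneg a)
  rw [gibbs, gibbs, gibbsOne, energySum_snoc,
    EReal.left_distrib_of_nonneg (hf.energySum_nonneg y) (hf.apply_nonneg a),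
    EReal.neg_add (.inl (EReal.bot_lt_zero.trans_le h1).ne')
      (.inr (EReal.bot_lt_zero.trans_le h2).ne'), sub_eq_add_neg, EReal.exp_add, pow_succ,
    div_eq_mul_inv, div_eq_mul_inv, div_eq_mul_inv, ENNReal.mul_inv (.inr hZ') (.inr hZ)]
  ring

theorem gibbs_eq_zero {c : ℝ} (hc : 0 < c) {y : EuclideanSpace ℝ (Fin d)} {i : Fin d}
    (h : f (y i) = ⊤) : gibbs f c y = 0 := by
  have hE : energySum f y = ⊤ := by
    rw [← top_le_iff, ← h]
    exact Finset.single_le_sum (f := fun i => f (y i)) (fun i _ => hf.apply_nonneg (y i))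
      (Finset.mem_univ i)
  rw [gibbs, hE, EReal.coe_mul_top_of_pos hc, EReal.neg_top, EReal.exp_bot, ENNReal.zero_div]

theorem measurable_gibbs {c : ℝ} (hc : 0 < c) : Measurable (gibbs f c (n := d)) := by
  induction d with
  | zero =>
    have : gibbs f c (n := 0) = fun _ => gibbs f c (0 : EuclideanSpace ℝ (Fin 0)) :=
      funext fun x => by rw [Subsingleton.elim x 0]
    rw [this]
    exact measurable_const
  | succ d ih =>
    have : gibbs f c (n := d + 1) = fun x => gibbs f c (dropLast x) * gibbsOne f c (x (Fin.last d)) :=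
      funext fun x => by rw [← hf.gibbs_snoc hc, snoc_dropLast]
    rw [this]
    exact (ih.comp measurable_dropLast).mul ((hf.measurable_gibbsOne c).comp (by fun_prop))

theorem lintegral_gibbs {c : ℝ} (hc : 0 < c) :
    ∫⁻ x : EuclideanSpace ℝ (Fin d), gibbs f c x = 1 := by
  induction d with
  | zero =>
    have : ∀ x : EuclideanSpace ℝ (Fin 0), gibbs f c x = 1 := fun x => by
      simp [gibbs, energySum]
    simp only [this, lintegral_const, one_mul]
    rw [← (PiLp.volume_preserving_toLp (Fin 0)).measure_preimage MeasurableSet.univ.nullMeasurableSet,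
      preimage_univ, volume_pi, Measure.pi_univ]
    simp
  | succ d ih =>
    rw [lintegral_snoc (hf.measurable_gibbs hc)]
    simp_rw [hf.gibbs_snoc hc]
    simp_rw [lintegral_const_mul _ (hf.measurable_gibbsOne c), hf.lintegral_gibbsOne hc, mul_one]
    exact ih

/-! #### The graph representation of the surface -/

theorem isOpen_below (τ : ℝ) : IsOpen (below f d τ) :=
  hf.continuousOn_realSum.isOpen_inter_preimage hf.isOpen_regular isOpen_Iio

theorem measurable_branch (τ s : ℝ) : Measurable (branch f (d := d) τ s) := by
  have h1 := hf.measurable_branchInv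
  have h2 := hf.measurable_realSum (n := d)
  exact (volume_preserving_snoc d).measurable.comp
    (show Measurable fun y => (s * branchInv f (τ - realSum f y), y) by fun_prop)

theorem sign_mul_self {s : ℝ} (hs : s ∈ signs f) : s * s = 1 := by
  rcases hf.signs_eq hs with rfl | ⟨rfl, -⟩ <;> norm_num

theorem sign_mul_mem_finSupport {s : ℝ} (hs : s ∈ signs f) {y : ℝ} (hy : 0 < y) :
    s * y ∈ finSupport f := hf.mem_finSupport_iff.2 ⟨s, hs, y, hy, rfl⟩

theorem image_branch {s : ℝ} (hs : s ∈ signs f) (τ : ℝ) :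
    branch f (d := d) τ s '' below f d τ =
      {x | x ∈ regular f (d + 1) ∧ realSum f x = τ ∧ 0 < s * x (Fin.last d)} := by
  have hss := hf.sign_mul_self hs
  ext x
  constructor
  · rintro ⟨y, ⟨hy, hyτ⟩, rfl⟩
    have hpos := hf.branchInv_pos (sub_pos.2 hyτ)
    refine ⟨snoc_mem_regular.2 ⟨hy, hf.sign_mul_mem_finSupport hs hpos⟩, ?_, ?_⟩
    · rw [branch, realSum_snoc, hf.realPart_sign_mul hs, hf.realPart_branchInv (sub_pos.2 hyτ)]
      ring
    · rw [branch, snoc_last, ← mul_assoc, hss, one_mul]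
      exact hpos
  · rintro ⟨hx, hxτ, hpos⟩
    rw [← snoc_dropLast x] at hx hxτ
    rw [realSum_snoc] at hxτ
    obtain ⟨hy, ha⟩ := snoc_mem_regular.1 hx
    have hxl : x (Fin.last d) = s * (s * x (Fin.last d)) := by rw [← mul_assoc, hss, one_mul]
    have hr : realPart f (s * x (Fin.last d)) = realPart f (x (Fin.last d)) :=
      hf.realPart_sign_mul hs _
    refine ⟨dropLast x, ⟨hy, by linarith [hf.realPart_pos ha]⟩, ?_⟩
    rw [branch, ← hxτ, add_sub_cancel_left, ← hr, hf.branchInv_realPart hpos, ← hxl, snoc_dropLast]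

theorem measurableSet_image_branch {s : ℝ} (hs : s ∈ signs f) (τ : ℝ) :
    MeasurableSet (branch f (d := d) τ s '' below f d τ) := by
  rw [hf.image_branch hs]
  refine hf.isOpen_regular.measurableSet.inter (MeasurableSet.inter
    (hf.measurable_realSum (measurableSet_singleton τ)) ?_)
  exact measurableSet_lt measurable_const
    (show Measurable fun x : EuclideanSpace ℝ (Fin (d + 1)) => s * x (Fin.last d) by fun_prop)

theorem surface_inter_regular (t : ℝ) : surface f (d + 1) t ∩ regular f (d + 1) =
    ⋃ s ∈ signs f, branch f ((d + 1 : ℕ) * t) s '' below f d ((d + 1 : ℕ) * t) := by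
  ext x
  simp only [mem_iUnion]
  constructor
  · rintro ⟨hx, hr⟩
    obtain ⟨s, hs, y, hy, h⟩ := hf.mem_finSupport_iff.1 (hr (Fin.last d))
    refine ⟨s, hs, ?_⟩
    rw [hf.image_branch hs]
    refine ⟨hr, ?_, ?_⟩
    · have hx : energySum f x = _ := hx
      rw [← hf.coe_realSum hr] at hx
      exact_mod_cast hx
    · rw [h, ← mul_assoc, hf.sign_mul_self hs, one_mul]
      exact hy
  · rintro ⟨s, hs, hx⟩
    rw [hf.image_branch hs] at hx
    obtain ⟨hr, he, -⟩ := hx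
    refine ⟨?_, hr⟩
    show energySum f x = _
    rw [← hf.coe_realSum hr, he]

theorem pairwiseDisjoint_image_branch (τ : ℝ) : (signs f : Set ℝ).PairwiseDisjoint
    fun s => branch f (d := d) τ s '' below f d τ := by
  intro s hs s' hs' hne
  have hs : s ∈ signs f := hs
  have hs' : s' ∈ signs f := hs'
  simp only [Function.onFun]
  rw [hf.image_branch hs, hf.image_branch hs', Set.disjoint_left]
  rintro x ⟨-, -, h1⟩ ⟨-, -, h2⟩
  rcases hf.signs_eq hs with rfl | ⟨rfl, -⟩ <;> rcases hf.signs_eq hs' with rfl | ⟨rfl, -⟩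
  · exact hne rfl
  · linarith
  · linarith
  · exact hne rfl

theorem map_dropLast_branch {s : ℝ} (hs : s ∈ signs f) (τ : ℝ) :
    ((Measure.euclideanHausdorffMeasure d).restrict (branch f τ s '' below f d τ)).map dropLast =
      (volume.restrict (below f d τ)).withDensity fun y => ENNReal.ofReal
        (‖grad f (branch f τ s y)‖ * (deriv (realPart f) (branchInv f (τ - realSum f y)))⁻¹) := by
  set b : EuclideanSpace ℝ (Fin d) → ℝ := fun y =>
    (deriv (realPart f) (branchInv f (τ - realSum f y)))⁻¹ with hb
  have hsub : ∀ y ∈ below f d τ, 0 < τ - realSum f y := fun y hy => sub_pos.2 hy.2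
  have hbc : ContinuousOn b (below f d τ) := by
    refine ContinuousOn.inv₀ ?_ fun y hy => (hf.deriv_branchInv_pos (hsub y hy)).ne'
    exact hf.continuousOn_deriv_branchInv.comp
      (continuousOn_const.sub (hf.continuousOn_realSum.mono fun y hy => hy.1)) hsub
  have key := map_dropLast_graph (φ := fun y => s * branchInv f (τ - realSum f y))
    (g := fun y => (-(s * b y)) • grad f y) (hf.isOpen_below τ) (fun y hy => ?_) ?_
  · rw [show branch f (d := d) τ s = fun y => snoc y (s * branchInv f (τ - realSum f y)) from rfl,
      key]
    refine withDensity_congr_ae ?_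
    filter_upwards [ae_restrict_mem (hf.isOpen_below τ).measurableSet] with y hy
    have hd := hf.deriv_branchInv_pos (hsub y hy)
    have hbpos : 0 < b y := inv_pos.2 hd
    congr 1
    rw [Real.sqrt_eq_iff_mul_self_eq (by positivity) (by positivity)]
    have h1 : ‖grad f (snoc y (s * branchInv f (τ - realSum f y)))‖ ^ 2 =
        ‖grad f y‖ ^ 2 + (deriv (realPart f) (branchInv f (τ - realSum f y))) ^ 2 := by
      rw [norm_grad_snoc_sq, hf.deriv_sign_mul hs, mul_pow, pow_two s, hf.sign_mul_self hs, one_mul]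
    have h2 : deriv (realPart f) (branchInv f (τ - realSum f y)) * b y = 1 :=
      mul_inv_cancel₀ hd.ne'
    have h3 : ‖(-(s * b y)) • grad f y‖ ^ 2 = b y ^ 2 * ‖grad f y‖ ^ 2 := by
      rw [norm_smul, mul_pow, Real.norm_eq_abs, sq_abs, neg_sq, mul_pow, pow_two s,
        hf.sign_mul_self hs, one_mul]
    rw [h3]
    show _ = ‖grad f (snoc y (s * branchInv f (τ - realSum f y)))‖ * b y *
      (‖grad f (snoc y (s * branchInv f (τ - realSum f y)))‖ * b y)
    rw [← pow_two, mul_pow, h1, add_mul,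
      ← mul_pow (deriv (realPart f) _), h2]
    ring
  · have h1 := (hf.hasStrictFDerivAt_realSum hy.1).const_sub τ
    have h2 := (hf.hasStrictDerivAt_branchInv (hsub y hy)).comp_hasStrictFDerivAt y h1
    have h3 := h2.const_mul s
    have e : innerSL ℝ ((-(s * b y)) • grad f y) = s • (b y • -innerSL ℝ (grad f y)) := by
      rw [map_smul, smul_neg, smul_neg, smul_smul, neg_smul]
    rw [e]
    exact h3
  · exact ((continuousOn_const.mul hbc).neg).smul (hf.continuousOn_grad.mono fun y hy => hy.1)

theorem lintegral_image_branch {s : ℝ} (hs : s ∈ signs f) (τ : ℝ)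
    {Φ : EuclideanSpace ℝ (Fin d) → ℝ≥0∞} (hΦ : Measurable Φ) :
    ∫⁻ x in branch f τ s '' below f d τ, Φ (dropLast x) * ENNReal.ofReal ‖grad f x‖⁻¹
        ∂(Measure.euclideanHausdorffMeasure d) =
      ∫⁻ y in below f d τ, Φ y *
        ENNReal.ofReal (deriv (realPart f) (branchInv f (τ - realSum f y)))⁻¹ := by
  have hgm := measurable_grad f (d + 1)
  have hbm := hf.measurable_branch (d := d) τ s
  have hm : Measurable fun y => Φ y * ENNReal.ofReal ‖grad f (branch f τ s y)‖⁻¹ :=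
    hΦ.mul (by fun_prop)
  have e1 : ∫⁻ x in branch f τ s '' below f d τ, Φ (dropLast x) * ENNReal.ofReal ‖grad f x‖⁻¹
        ∂(Measure.euclideanHausdorffMeasure d) =
      ∫⁻ x in branch f τ s '' below f d τ, (fun y => Φ y *
        ENNReal.ofReal ‖grad f (branch f τ s y)‖⁻¹) (dropLast x)
        ∂(Measure.euclideanHausdorffMeasure d) := by
    refine setLIntegral_congr_fun (hf.measurableSet_image_branch hs τ) ?_
    rintro x ⟨y, hy, rfl⟩
    have : dropLast (branch f τ s y) = y := dropLast_snoc _ _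
    simp only [this]
  rw [e1, ← lintegral_map hm measurable_dropLast, hf.map_dropLast_branch hs,
    lintegral_withDensity_eq_lintegral_mul₀ ?_ hm.aemeasurable]
  · refine setLIntegral_congr_fun (hf.isOpen_below τ).measurableSet fun y hy => ?_
    have hd := hf.deriv_branchInv_pos (sub_pos.2 hy.2)
    have hg : 0 < ‖grad f (branch f τ s y)‖ := by
      refine norm_pos_iff.2 fun h => ?_
      have hmem : branch f τ s y ∈ regular f (d + 1) := snoc_mem_regular.2
        ⟨hy.1, hf.sign_mul_mem_finSupport hs (hf.branchInv_pos (sub_pos.2 hy.2))⟩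
      have := hf.inner_grad_pos hmem
      rw [h, inner_zero_left] at this
      exact lt_irrefl _ this
    simp only [Pi.mul_apply]
    rw [mul_left_comm, ← ENNReal.ofReal_mul (by positivity)]
    congr 2
    field_simp
  · refine (Measurable.ennreal_ofReal ?_).aemeasurable
    have h1 := hf.measurable_branchInv
    have h2 := hf.measurable_realSum (n := d)
    have h3 := measurable_deriv (realPart f)
    fun_prop

/-! #### The microcanonical measure -/

theorem ae_mem_regular {t : ℝ} (ht : 0 < t) : ∀ᵐ x ∂(surfaceMeasure f (d + 1) t),
    x ∈ regular f (d + 1) ∧ realSum f x = (d + 1 : ℕ) * t := by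
  have hm : MeasurableSet (surface f (d + 1) t) :=
    hf.measurable_energySum (measurableSet_singleton _)
  have h0 := hf.euclideanHausdorffMeasure_surface_diff_regular (d := d) ht
  have h1 : ∀ᵐ x ∂(surfaceMeasure f (d + 1) t), x ∈ regular f (d + 1) := by
    rw [surfaceMeasure, ae_restrict_iff' hm, ae_iff]
    refine measure_mono_null (fun x hx => ?_) h0
    simpa using! hx
  filter_upwards [h1, ae_restrict_mem hm] with x hx hs
  refine ⟨hx, ?_⟩
  have hs : energySum f x = _ := hs
  rw [← hf.coe_realSum hx] at hs
  exact_mod_cast hs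

theorem ae_ofReal_jacobian {t : ℝ} (ht : 0 < t) : ∀ᵐ x ∂(surfaceMeasure f (d + 1) t),
    ENNReal.ofReal (jacobian f ((d + 1 : ℕ) * t) x) = ENNReal.ofReal ‖grad f x‖⁻¹ := by
  filter_upwards [hf.ae_mem_regular ht] with x hx
  rw [hf.jacobian_eq hx.1 hx.2]

theorem aemeasurable_ofReal_jacobian {t : ℝ} (ht : 0 < t) :
    AEMeasurable (fun x => ENNReal.ofReal (jacobian f ((d + 1 : ℕ) * t) x))
      (surfaceMeasure f (d + 1) t) := by
  have := measurable_grad f (d + 1)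
  exact ⟨_, show Measurable fun x => ENNReal.ofReal ‖grad f x‖⁻¹ by fun_prop,
    hf.ae_ofReal_jacobian ht⟩

theorem ae_ofReal_jacobian_ne_zero {t : ℝ} (ht : 0 < t) : ∀ᵐ x ∂(surfaceMeasure f (d + 1) t),
    ENNReal.ofReal (jacobian f ((d + 1 : ℕ) * t) x) ≠ 0 := by
  filter_upwards [hf.ae_mem_regular ht] with x hx
  rw [hf.jacobian_eq hx.1 hx.2, Ne, ENNReal.ofReal_eq_zero, not_le, inv_pos, norm_pos_iff]
  intro h
  have := hf.inner_grad_pos hx.1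
  rw [h, inner_zero_left] at this
  exact lt_irrefl _ this

omit hf in
theorem ae_ne_zero : ∀ᵐ y : EuclideanSpace ℝ (Fin d), ∀ i, y i ≠ 0 :=
  ae_all_iff.2 fun i => (PiLp.volume_preserving_ofLp (Fin d)).quasiMeasurePreserving.ae
    (Measure.ae_eval_ne (fun _ => (volume : Measure ℝ)) i 0)

theorem gibbs_of_mem_regular {c : ℝ} {y : EuclideanSpace ℝ (Fin d)} (hy : y ∈ regular f d) :
    gibbs f c y = ENNReal.ofReal (Real.exp (-(c * realSum f y))) / partitionFn f c ^ d := by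
  rw [gibbs, ← hf.coe_realSum hy, ← EReal.coe_mul, ← EReal.coe_neg, EReal.exp_coe]

theorem ae_gibbs_mul_energyDensity {c : ℝ} (hc : 0 < c) (τ : ℝ) :
    ∀ᵐ y : EuclideanSpace ℝ (Fin d),
      partitionFn f c ^ (d + 1) * ENNReal.ofReal (Real.exp (c * τ)) * gibbs f c y *
        energyDensity f c (τ - realSum f y) =
      (below f d τ).indicator (fun y => (signs f).card *
        ENNReal.ofReal (deriv (realPart f) (branchInv f (τ - realSum f y)))⁻¹) y := by
  have hZ := hf.partitionFn_ne_zero hc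
  have hZ' := hf.partitionFn_ne_top hc
  filter_upwards [ae_ne_zero] with y hy
  by_cases hreg : y ∈ regular f d
  swap
  · rw [indicator_of_notMem fun h => hreg h.1]
    simp only [regular, mem_ofPred_eq, not_forall] at hreg
    obtain ⟨i, hi⟩ := hreg
    rw [hf.gibbs_eq_zero hc (i := i) (by by_contra h; exact hi ⟨hy i, h⟩), mul_zero, zero_mul]
  by_cases hlt : realSum f y < τ
  swap
  · rw [indicator_of_notMem fun h => hlt h.2, energyDensity_of_nonpos c (by linarith), mul_zero]
  rw [indicator_of_mem (show y ∈ below f d τ from ⟨hreg, hlt⟩), hf.gibbs_of_mem_regular hreg,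
    energyDensity, indicator_of_mem (mem_Ioi.2 (sub_pos.2 hlt)), rawDensity,
    ENNReal.ofReal_mul (Real.exp_nonneg _)]
  have hexp : ENNReal.ofReal (Real.exp (c * τ)) * ENNReal.ofReal (Real.exp (-(c * realSum f y))) *
      ENNReal.ofReal (Real.exp (-(c * (τ - realSum f y)))) = 1 := by
    rw [← ENNReal.ofReal_mul (Real.exp_nonneg _), ← ENNReal.ofReal_mul (by positivity),
      ← Real.exp_add, ← Real.exp_add]
    ring_nf
    simp
  have hpow : partitionFn f c ^ (d + 1) * (partitionFn f c ^ d)⁻¹ * (partitionFn f c)⁻¹ = 1 := by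
    rw [mul_assoc, ← ENNReal.mul_inv (.inr hZ') (.inr hZ), ← pow_succ,
      ENNReal.mul_inv_cancel (pow_ne_zero _ hZ) (ENNReal.pow_ne_top hZ')]
  set D := ENNReal.ofReal (deriv (realPart f) (branchInv f (τ - realSum f y)))⁻¹
  rw [div_eq_mul_inv, div_eq_mul_inv]
  calc _ = (partitionFn f c ^ (d + 1) * (partitionFn f c ^ d)⁻¹ * (partitionFn f c)⁻¹) *
        (ENNReal.ofReal (Real.exp (c * τ)) * ENNReal.ofReal (Real.exp (-(c * realSum f y))) *
          ENNReal.ofReal (Real.exp (-(c * (τ - realSum f y))))) * ((signs f).card * D) := by ring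
    _ = _ := by rw [hexp, hpow, one_mul, one_mul]

theorem lintegral_dropLast_mul_jacobian {c t : ℝ} (hc : 0 < c) (ht : 0 < t)
    {Φ : EuclideanSpace ℝ (Fin d) → ℝ≥0∞} (hΦ : Measurable Φ) :
    ∫⁻ x, Φ (dropLast x) * ENNReal.ofReal (jacobian f ((d + 1 : ℕ) * t) x)
        ∂(surfaceMeasure f (d + 1) t) =
      ∫⁻ y, Φ y * (partitionFn f c ^ (d + 1) * ENNReal.ofReal (Real.exp (c * ((d + 1 : ℕ) * t))) *
        gibbs f c y * energyDensity f c ((d + 1 : ℕ) * t - realSum f y)) := by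
  set τ : ℝ := (d + 1 : ℕ) * t with hτ
  have e1 : surfaceMeasure f (d + 1) t = (Measure.euclideanHausdorffMeasure d).restrict
      (⋃ s ∈ signs f, branch f τ s '' below f d τ) := by
    rw [← hf.surface_inter_regular, surfaceMeasure]
    refine Measure.restrict_congr_set ?_
    rw [Nat.add_sub_cancel]
    refine (ae_eq_set.2 ⟨?_, ?_⟩)
    · rw [sdiff_self_inter]
      exact hf.euclideanHausdorffMeasure_surface_diff_regular ht
    · rw [show (surface f (d + 1) t ∩ regular f (d + 1)) \ surface f (d + 1) t = ∅ from
        sdiff_eq_empty.2 inter_subset_left, measure_empty]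
  calc _ = ∫⁻ x, Φ (dropLast x) * ENNReal.ofReal ‖grad f x‖⁻¹ ∂(surfaceMeasure f (d + 1) t) := by
        refine lintegral_congr_ae ?_
        filter_upwards [hf.ae_ofReal_jacobian ht] with x hx
        rw [hx]
    _ = ∑ s ∈ signs f, ∫⁻ y in below f d τ, Φ y *
        ENNReal.ofReal (deriv (realPart f) (branchInv f (τ - realSum f y)))⁻¹ := by
        rw [e1, lintegral_biUnion_finset (hf.pairwiseDisjoint_image_branch τ)
          fun s hs => hf.measurableSet_image_branch hs τ]
        exact Finset.sum_congr rfl fun s hs => hf.lintegral_image_branch hs τ hΦ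
    _ = _ := by
        rw [Finset.sum_const, nsmul_eq_mul, ← lintegral_const_mul' _ _ (by simp),
          ← lintegral_indicator (hf.isOpen_below τ).measurableSet]
        refine lintegral_congr_ae ?_
        filter_upwards [hf.ae_gibbs_mul_energyDensity (d := d) hc τ] with y hy
        rw [hy]
        by_cases hyb : y ∈ below f d τ
        · rw [indicator_of_mem hyb, indicator_of_mem hyb]; ring
        · rw [indicator_of_notMem hyb, indicator_of_notMem hyb, mul_zero]

theorem lintegral_dropLast_mul_gibbs {c : ℝ} (hc : 0 < c) (K : ℝ≥0∞) (τ : ℝ) (m : ℕ)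
    {Φ : EuclideanSpace ℝ (Fin d) → ℝ≥0∞} (hΦ : Measurable Φ) :
    ∫⁻ x, Φ (dropLast x) * (K * gibbs f c x * convPow (energyDensity f c) m (τ - realSum f x)) =
      ∫⁻ y, Φ y * (K * gibbs f c y * convPow (energyDensity f c) (m + 1) (τ - realSum f y)) := by
  have hw := measurable_convPow (hf.measurable_energyDensity c) m
  have hR : ∀ n, Measurable (realSum f (n := n)) := fun n => hf.measurable_realSum
  have hF := hf.measurable_realPart
  have hm : Measurable fun x : EuclideanSpace ℝ (Fin (d + 1)) => Φ (dropLast x) *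
      (K * gibbs f c x * convPow (energyDensity f c) m (τ - realSum f x)) := by
    refine (hΦ.comp measurable_dropLast).mul (((hf.measurable_gibbs hc).const_mul K).mul ?_)
    exact hw.comp (measurable_const.sub (hR _))
  rw [lintegral_snoc hm]
  refine lintegral_congr fun y => ?_
  have e : ∀ a, Φ (dropLast (snoc y a)) * (K * gibbs f c (snoc y a) *
      convPow (energyDensity f c) m (τ - realSum f (snoc y a))) = Φ y * (K * gibbs f c y) *
      ((fun u => convPow (energyDensity f c) m (-u + (τ - realSum f y))) (realPart f a) *
        gibbsOne f c a) := fun a => by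
    rw [dropLast_snoc, hf.gibbs_snoc hc, realSum_snoc,
      show τ - (realSum f y + realPart f a) = -realPart f a + (τ - realSum f y) by ring]
    ring
  have hm' : Measurable fun a => (fun u => convPow (energyDensity f c) m
      (-u + (τ - realSum f y))) (realPart f a) * gibbsOne f c a :=
    Measurable.mul (by fun_prop) (hf.measurable_gibbsOne c)
  rw [lintegral_congr e, lintegral_const_mul _ hm', mul_assoc (Φ y)]
  rw [hf.lintegral_comp_mul_gibbsOne hc
    (fun u => convPow (energyDensity f c) m (-u + (τ - realSum f y)))]
  congr 2
  exact lintegral_congr fun u => mul_comm _ _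

theorem lintegral_proj_mul_jacobian {c t : ℝ} (hc : 0 < c) (ht : 0 < t) (m : ℕ) :
    ∀ {k : ℕ} (h : k + m = d) {Φ : EuclideanSpace ℝ (Fin k) → ℝ≥0∞} (_ : Measurable Φ),
    ∫⁻ x, Φ (proj (show k ≤ d + 1 by omega) x) *
        ENNReal.ofReal (jacobian f ((d + 1 : ℕ) * t) x) ∂(surfaceMeasure f (d + 1) t) =
      ∫⁻ y, Φ y * (partitionFn f c ^ (d + 1) * ENNReal.ofReal (Real.exp (c * ((d + 1 : ℕ) * t))) *
        gibbs f c y * convPow (energyDensity f c) m ((d + 1 : ℕ) * t - realSum f y)) := by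
  induction m with
  | zero =>
    intro k h Φ hΦ
    obtain rfl : k = d := h
    exact hf.lintegral_dropLast_mul_jacobian hc ht hΦ
  | succ m ih =>
    intro k h Φ hΦ
    rw [← hf.lintegral_dropLast_mul_gibbs hc _ _ m hΦ]
    exact ih (k := k + 1) (by omega) (hΦ.comp measurable_dropLast)

end ClassF

/-! ### Relative entropy -/

theorem klFun_mul_add_le {a b B : ℝ} (ha : 0 ≤ a) (hb : 0 ≤ b) (hB : b ≤ B) :
    klFun (a * b) + b ≤ b * klFun a + 1 + a * b * Real.log B := by
  rcases ha.eq_or_lt with rfl | ha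
  · simp [klFun]; linarith
  rcases hb.eq_or_lt with rfl | hb
  · simp [klFun]
  have hlog : Real.log b ≤ Real.log B := Real.log_le_log hb hB
  have h2 : a * b * Real.log b ≤ a * b * Real.log B := by gcongr
  rw [klFun, klFun, Real.log_mul ha.ne' hb.ne']
  linarith

theorem klDiv_le_add_log_of_le_smul {α : Type*} [MeasurableSpace α] {μ ν ν' : Measure α}
    [IsProbabilityMeasure μ] [IsProbabilityMeasure ν] [IsProbabilityMeasure ν'] {B : ℝ}
    (hB : 1 ≤ B) (h : ν ≤ ENNReal.ofReal B • ν') :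
    klDiv μ ν' ≤ klDiv μ ν + ENNReal.ofReal (Real.log B) := by
  by_cases hμν : μ ≪ ν
  swap
  · simp [klDiv_of_not_ac hμν]
  have hνν' : ν ≪ ν' := Measure.absolutelyContinuous_of_le_smul h
  have hμν' := hμν.trans hνν'
  have hlogB : 0 ≤ Real.log B := Real.log_nonneg hB
  have hb : ∀ᵐ x ∂ν', ν.rnDeriv ν' x ≤ ENNReal.ofReal B := by
    refine ae_le_of_forall_setLIntegral_le_of_sigmaFinite (Measure.measurable_rnDeriv _ _)
      fun s hs _ => ?_
    rw [Measure.setLIntegral_rnDeriv hνν', setLIntegral_const]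
    exact h s
  have hpt : ∀ᵐ x ∂ν', ENNReal.ofReal (klFun (μ.rnDeriv ν' x).toReal) + ν.rnDeriv ν' x ≤
      ν.rnDeriv ν' x * ENNReal.ofReal (klFun (μ.rnDeriv ν x).toReal) + 1 +
        μ.rnDeriv ν' x * ENNReal.ofReal (Real.log B) := by
    have hfin : ∀ᵐ x ∂ν', ν.rnDeriv ν' x = 0 ∨ μ.rnDeriv ν x ≠ ⊤ := by
      have h1 : ∀ᵐ x ∂(ν'.withDensity (ν.rnDeriv ν')), μ.rnDeriv ν x ≠ ⊤ := by
        rw [Measure.withDensity_rnDeriv_eq _ _ hνν']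
        exact Measure.rnDeriv_ne_top μ ν
      rw [ae_withDensity_iff (Measure.measurable_rnDeriv _ _)] at h1
      filter_upwards [h1] with x hx
      by_cases h0 : ν.rnDeriv ν' x = 0
      · exact Or.inl h0
      · exact Or.inr (hx h0)
    filter_upwards [hb, Measure.rnDeriv_mul_rnDeriv (κ := ν') hμν, hfin, Measure.rnDeriv_ne_top μ ν',
      Measure.rnDeriv_ne_top ν ν'] with x hxB hmul hfx hμt hνt
    simp only [Pi.mul_apply] at hmul
    set b := ν.rnDeriv ν' x
    set a := μ.rnDeriv ν x
    rcases hfx with h0 | hat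
    · have : μ.rnDeriv ν' x = 0 := by rw [← hmul, h0, mul_zero]
      simp [this, h0, klFun]
    · rw [← hmul]
      have hbB : b.toReal ≤ B := ENNReal.toReal_le_of_le_ofReal (by linarith) hxB
      have key := klFun_mul_add_le (a := a.toReal) (b := b.toReal) ENNReal.toReal_nonneg
        ENNReal.toReal_nonneg hbB
      have ka : 0 ≤ klFun a.toReal := klFun_nonneg ENNReal.toReal_nonneg
      have kab : 0 ≤ klFun (a.toReal * b.toReal) := klFun_nonneg (by positivity)
      have e := ENNReal.ofReal_le_ofReal key
      rw [ENNReal.ofReal_add kab ENNReal.toReal_nonneg,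
        ENNReal.ofReal_add (by positivity) (by positivity),
        ENNReal.ofReal_add (by positivity) (by positivity), ENNReal.ofReal_mul ENNReal.toReal_nonneg,
        ENNReal.ofReal_mul (by positivity), ENNReal.ofReal_mul ENNReal.toReal_nonneg,
        ENNReal.ofReal_toReal hνt, ENNReal.ofReal_toReal hat, ENNReal.ofReal_one] at e
      rw [ENNReal.toReal_mul]
      exact e
  have hmk : Measurable fun x => ENNReal.ofReal (klFun (μ.rnDeriv ν x).toReal) := by fun_prop
  have hint := lintegral_mono_ae hpt
  rw [lintegral_add_right _ (Measure.measurable_rnDeriv _ _),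
    lintegral_add_right _ ((Measure.measurable_rnDeriv _ _).mul_const _),
    lintegral_add_right _ measurable_const, lintegral_mul_const _ (Measure.measurable_rnDeriv _ _),
    Measure.lintegral_rnDeriv hνν', Measure.lintegral_rnDeriv hμν',
    lintegral_rnDeriv_mul hνν' hmk.aemeasurable, ← klDiv_eq_lintegral_klFun_of_ac hμν',
    ← klDiv_eq_lintegral_klFun_of_ac hμν] at hint
  simp only [measure_univ, lintegral_const, one_mul, mul_one] at hint
  rw [add_right_comm] at hint
  exact (ENNReal.add_le_add_iff_right ENNReal.one_ne_top).1 hint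

theorem one_add_div_sqrt_le {m n C : ℝ} (hm : 0 < m) (hmn : m ≤ n) (hC : 0 < C) (hn : C < √n) :
    1 / √m * (1 + C / √m) ≤ n / m * ((1 + C / √n) / (1 - C / √n)) * (1 / √n * (1 - C / √n)) := by
  have hn0 : 0 < n := hm.trans_le hmn
  have hsm : 0 < √m := Real.sqrt_pos.2 hm
  have hsn : 0 < √n := Real.sqrt_pos.2 hn0
  have hle : √m ≤ √n := Real.sqrt_le_sqrt hmn
  have h1 : √n - C ≠ 0 := (sub_pos.2 hn).ne'
  have e : n / m * ((1 + C / √n) / (1 - C / √n)) * (1 / √n * (1 - C / √n)) =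
      1 / m * (√n + C) := by
    have h2 := Real.sq_sqrt hn0.le
    field_simp
    rw [h2]
  have e' : 1 / √m * (1 + C / √m) = 1 / m * (√m + C) := by
    have h2 := Real.sq_sqrt hm.le
    field_simp
    rw [h2]
  rw [e, e']
  gcongr

theorem log_one_add_div_one_sub_le {x : ℝ} (hx : 0 < x) (hx1 : x < 1) :
    Real.log ((1 + x) / (1 - x)) ≤ 2 / (1 / x - 1) := by
  have h1 : 0 < 1 - x := by linarith
  have := Real.log_le_sub_one_of_pos (show 0 < (1 + x) / (1 - x) by positivity)
  refine this.trans (le_of_eq ?_)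
  have : 1 / x - 1 ≠ 0 := by
    rw [Ne, sub_eq_zero, div_eq_one_iff_eq hx.ne']
    exact hx1.ne'
  field_simp
  ring

namespace ClassF

variable {f : ℝ → EReal} (hf : ClassF f) {d : ℕ}
include hf

/-! ### Comparison of the microcanonical and the canonical measure -/

theorem setLIntegral_proj_jacobian {c t : ℝ} (hc : 0 < c) (ht : 0 < t) {k m : ℕ}
    (h : k + m = d) (hk : k ≤ d + 1) {A : Set (EuclideanSpace ℝ (Fin k))} (hA : MeasurableSet A) :
    ∫⁻ x in proj hk ⁻¹' A, ENNReal.ofReal (jacobian f ((d + 1 : ℕ) * t) x)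
        ∂(surfaceMeasure f (d + 1) t) =
      ∫⁻ y in A, partitionFn f c ^ (d + 1) * ENNReal.ofReal (Real.exp (c * ((d + 1 : ℕ) * t))) *
        gibbs f c y * convPow (energyDensity f c) m ((d + 1 : ℕ) * t - realSum f y) := by
  rw [← lintegral_indicator (measurable_proj hk hA), ← lintegral_indicator hA]
  have := hf.lintegral_proj_mul_jacobian hc ht m h (measurable_one.indicator hA)
  refine Eq.trans (lintegral_congr fun x => ?_) (this.trans (lintegral_congr fun y => ?_))
  · by_cases hx : proj hk x ∈ A
    · rw [indicator_of_mem (by exact hx), indicator_of_mem hx, Pi.one_apply, one_mul]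
    · rw [indicator_of_notMem (by exact hx), indicator_of_notMem hx, zero_mul]
  · by_cases hy : y ∈ A
    · rw [indicator_of_mem hy, indicator_of_mem hy, Pi.one_apply, one_mul]
    · rw [indicator_of_notMem hy, indicator_of_notMem hy, zero_mul]

theorem lintegral_jacobian {c t : ℝ} (hc : 0 < c) (ht : 0 < t) :
    ∫⁻ x, ENNReal.ofReal (jacobian f ((d + 1 : ℕ) * t) x) ∂(surfaceMeasure f (d + 1) t) =
      partitionFn f c ^ (d + 1) * ENNReal.ofReal (Real.exp (c * ((d + 1 : ℕ) * t))) *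
        convPow (energyDensity f c) d ((d + 1 : ℕ) * t) := by
  have := hf.setLIntegral_proj_jacobian (k := 0) (m := d) hc ht (zero_add d) (Nat.zero_le _)
    MeasurableSet.univ
  rw [preimage_univ, Measure.restrict_univ, Measure.restrict_univ] at this
  rw [this]
  have e : ∀ y : EuclideanSpace ℝ (Fin 0), (d + 1 : ℕ) * t - realSum f y = (d + 1 : ℕ) * t :=
    fun y => by simp [realSum]
  simp_rw [e]
  rw [lintegral_mul_const _ ((hf.measurable_gibbs hc).const_mul _),
    lintegral_const_mul _ (hf.measurable_gibbs hc), hf.lintegral_gibbs hc, mul_one]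

theorem map_proj_absolutelyContinuous {c t : ℝ} (hc : 0 < c) (ht : 0 < t) {k m : ℕ}
    (h : k + m = d) (hk : k ≤ d + 1) (p : EuclideanSpace ℝ (Fin (d + 1)) → ℝ≥0∞) :
    ((surfaceMeasure f (d + 1) t).withDensity p).map (proj hk) ≪ volume := by
  refine Measure.AbsolutelyContinuous.mk fun A hA h0 => ?_
  rw [Measure.map_apply (measurable_proj hk) hA]
  refine withDensity_absolutelyContinuous _ _ ?_
  have hI := hf.setLIntegral_proj_jacobian hc ht h hk hA
  rw [setLIntegral_measure_zero _ _ h0,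
    lintegral_eq_zero_iff' (hf.aemeasurable_ofReal_jacobian ht).restrict] at hI
  rw [← Measure.restrict_eq_zero, ← ae_eq_bot, ← Filter.eventually_false_iff_eq_bot]
  filter_upwards [hI, ae_restrict_of_ae (hf.ae_ofReal_jacobian_ne_zero ht)] with x h1 h2
  exact h2 h1

theorem isProbabilityMeasure_gibbs {c : ℝ} (hc : 0 < c) :
    IsProbabilityMeasure (volume.withDensity (gibbs f c (n := d))) :=
  ⟨by rw [withDensity_apply _ MeasurableSet.univ, Measure.restrict_univ, hf.lintegral_gibbs hc]⟩

theorem isProbabilityMeasure_uniformDensity {c t : ℝ} (hc : 0 < c) (ht : 0 < t)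
    (h0 : convPow (energyDensity f c) d ((d + 1 : ℕ) * t) ≠ 0)
    (h1 : convPow (energyDensity f c) d ((d + 1 : ℕ) * t) ≠ ⊤) :
    IsProbabilityMeasure
      ((surfaceMeasure f (d + 1) t).withDensity (uniformDensity f (d + 1) t)) := by
  have hI := hf.lintegral_jacobian (d := d) hc ht
  have hM0 : ∫⁻ x, ENNReal.ofReal (jacobian f ((d + 1 : ℕ) * t) x)
      ∂(surfaceMeasure f (d + 1) t) ≠ 0 := by
    rw [hI]
    exact mul_ne_zero (mul_ne_zero (pow_ne_zero _ (hf.partitionFn_ne_zero hc))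
      (ENNReal.ofReal_pos.2 (Real.exp_pos _)).ne') h0
  have hM1 : ∫⁻ x, ENNReal.ofReal (jacobian f ((d + 1 : ℕ) * t) x)
      ∂(surfaceMeasure f (d + 1) t) ≠ ⊤ := by
    rw [hI]
    exact ENNReal.mul_ne_top (ENNReal.mul_ne_top (ENNReal.pow_ne_top (hf.partitionFn_ne_top hc))
      ENNReal.ofReal_ne_top) h1
  refine ⟨?_⟩
  rw [withDensity_apply _ MeasurableSet.univ, Measure.restrict_univ]
  simp_rw [uniformDensity, div_eq_mul_inv]
  rw [lintegral_mul_const' _ _ (ENNReal.inv_ne_top.2 hM0), ENNReal.mul_inv_cancel hM0 hM1]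

theorem map_proj_uniformDensity_le {c t : ℝ} (hc : 0 < c) (ht : 0 < t) {k m : ℕ}
    (h : k + m = d) (hk : k ≤ d + 1)
    (h0 : convPow (energyDensity f c) d ((d + 1 : ℕ) * t) ≠ 0) {B : ℝ≥0∞}
    (hB : ∀ s, convPow (energyDensity f c) m s ≤
      B * convPow (energyDensity f c) d ((d + 1 : ℕ) * t)) :
    ((surfaceMeasure f (d + 1) t).withDensity (uniformDensity f (d + 1) t)).map (proj hk) ≤
      B • volume.withDensity (gibbs f c) := by
  have hI := hf.lintegral_jacobian (d := d) hc ht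
  set a := convPow (energyDensity f c) d ((d + 1 : ℕ) * t)
  set K := partitionFn f c ^ (d + 1) * ENNReal.ofReal (Real.exp (c * ((d + 1 : ℕ) * t))) with hK
  have hK0 : K ≠ 0 := mul_ne_zero (pow_ne_zero _ (hf.partitionFn_ne_zero hc))
      (ENNReal.ofReal_pos.2 (Real.exp_pos _)).ne'
  refine Measure.le_iff.2 fun A hA => ?_
  rw [Measure.map_apply (measurable_proj hk) hA,
    withDensity_apply _ (measurable_proj hk hA), Measure.smul_apply, withDensity_apply _ hA,
    smul_eq_mul]
  simp_rw [uniformDensity, div_eq_mul_inv]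
  rw [hI, lintegral_mul_const' _ _ (ENNReal.inv_ne_top.2 (mul_ne_zero hK0 h0)),
    hf.setLIntegral_proj_jacobian hc ht h hk hA, ← hK, ← div_eq_mul_inv]
  refine ENNReal.div_le_of_le_mul ?_
  calc ∫⁻ y in A, K * gibbs f c y *
        convPow (energyDensity f c) m ((d + 1 : ℕ) * t - realSum f y)
      ≤ ∫⁻ y in A, (K * (B * a)) * gibbs f c y := by
        refine lintegral_mono fun y => ?_
        calc _ ≤ K * gibbs f c y * (B * a) := by gcongr; exact hB _
          _ = _ := by ring
    _ = (B * ∫⁻ y in A, gibbs f c y) * (K * a) := by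
        rw [lintegral_const_mul _ (hf.measurable_gibbs hc)]
        ring

/-- The local limit theorem for the energy under the Gibbs measure, as a comparison of the
densities for `m + 1` and `d + 1` particles. -/
theorem exists_convPow_energyDensity_le : ∃ r : ℕ, ∀ t c : ℝ, 0 < t → 0 < c →
    energy f (gibbs f c (n := 1)) = ENNReal.ofReal t →
    ∃ C : ℝ, 0 < C ∧ ∀ m d : ℕ, r ≤ m → m ≤ d → C < √((d + 1 : ℕ) : ℝ) →
      convPow (energyDensity f c) d ((d + 1 : ℕ) * t) ≠ 0 ∧
      convPow (energyDensity f c) d ((d + 1 : ℕ) * t) ≠ ⊤ ∧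
      ∀ s, convPow (energyDensity f c) m s ≤
        ENNReal.ofReal (((d + 1 : ℕ) : ℝ) / (m + 1 : ℕ) *
          ((1 + C / √((d + 1 : ℕ) : ℝ)) / (1 - C / √((d + 1 : ℕ) : ℝ)))) *
        convPow (energyDensity f c) d ((d + 1 : ℕ) * t) := by
  obtain ⟨j, hj⟩ := hf.exists_energyDensity_le
  refine ⟨2 * j + 1, fun t c ht hc hE => ?_⟩
  obtain ⟨K, hK, hKu⟩ := hj c hc
  obtain ⟨S, hS, C, hC, hmain⟩ := exists_convPow_localLimit (hf.measurable_energyDensity c)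
    (hf.lintegral_energyDensity hc) hK (fun x hx => energyDensity_of_nonpos c hx) hKu
    (hf.integrable_cube_energyDensity hc) (hf.integral_energyDensity hc ht hE)
  refine ⟨C, hC, fun m d hm hmd hd => ?_⟩
  obtain ⟨hup, -⟩ := hmain m hm
  obtain ⟨hup', hlow⟩ := hmain d (hm.trans hmd)
  rw [← Nat.cast_add_one] at hlow
  rw [← Nat.cast_add_one] at hup
  have hsd : 0 < √((d + 1 : ℕ) : ℝ) := hC.trans hd
  have hx : C / √((d + 1 : ℕ) : ℝ) < 1 := (div_lt_one hsd).2 hd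
  have hL : 0 < S / √((d + 1 : ℕ) : ℝ) * (1 - C / √((d + 1 : ℕ) : ℝ)) :=
    mul_pos (div_pos hS hsd) (sub_pos.2 hx)
  refine ⟨((ENNReal.ofReal_pos.2 hL).trans_le hlow).ne',
    ((hup' _).trans_lt ENNReal.ofReal_lt_top).ne, fun s => (hup s).trans ?_⟩
  have hB : 0 ≤ ((d + 1 : ℕ) : ℝ) / (m + 1 : ℕ) *
      ((1 + C / √((d + 1 : ℕ) : ℝ)) / (1 - C / √((d + 1 : ℕ) : ℝ))) :=
    mul_nonneg (by positivity) (div_nonneg (by positivity) (sub_pos.2 hx).le)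
  refine le_trans ?_ (mul_le_mul_right hlow _)
  rw [← ENNReal.ofReal_mul hB]
  refine ENNReal.ofReal_le_ofReal ?_
  have key := one_add_div_sqrt_le (m := ((m + 1 : ℕ) : ℝ)) (n := ((d + 1 : ℕ) : ℝ)) (by positivity)
    (by exact_mod_cast Nat.succ_le_succ hmd) hC hd
  calc S / √((m + 1 : ℕ) : ℝ) * (1 + C / √((m + 1 : ℕ) : ℝ))
      = S * (1 / √((m + 1 : ℕ) : ℝ) * (1 + C / √((m + 1 : ℕ) : ℝ))) := by ring
    _ ≤ S * _ := mul_le_mul_of_nonneg_left key hS.le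
    _ = _ := by ring

end ClassF
end GibbsSurface

open GibbsSurface in
theorem theorem1p3 (f : ℝ → EReal) (hf : GibbsSurface.ClassF f) :
    ∃ r : ℕ, 1 ≤ r ∧ ∀ t c : ℝ, 0 < t → 0 < c →
      GibbsSurface.energy f (GibbsSurface.gibbs f c (n := 1)) = ENNReal.ofReal t →
      ∃ C : ℝ, 0 < C ∧ ∀ (n k : ℕ) (hkn : k ≤ n), r ≤ n - k → C < √(n : ℝ) →
        ∀ {Ω : Type*} [MeasurableSpace Ω] (P : Measure Ω) [IsProbabilityMeasure P]
          (p : EuclideanSpace ℝ (Fin n) → ℝ≥0∞) (_ : Measurable p)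
          (X : Ω → EuclideanSpace ℝ (Fin n))
          (_ : HasLaw X ((GibbsSurface.surfaceMeasure f n t).withDensity p) P),
          HasPDF (fun ω => GibbsSurface.proj hkn (X ω)) P ∧
          klDiv (volume.withDensity (pdf (fun ω => GibbsSurface.proj hkn (X ω)) P))
              (volume.withDensity (GibbsSurface.gibbs f c (n := k))) ≤
            klDiv ((GibbsSurface.surfaceMeasure f n t).withDensity p)
                ((GibbsSurface.surfaceMeasure f n t).withDensity
                  (GibbsSurface.uniformDensity f n t)) +
              ENNReal.ofReal (Real.log ((n : ℝ) / ((n : ℝ) - k)) + 2 / (√(n : ℝ) / C - 1)) := by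
  obtain ⟨r, hr⟩ := hf.exists_convPow_energyDensity_le
  refine ⟨r + 1, Nat.le_add_left _ _, fun t c ht hc hE => ?_⟩
  obtain ⟨C, hC, hmain⟩ := hr t c ht hc hE
  refine ⟨C, hC, fun n k hkn hrn hCn Ω _ P _ p _ X hX => ?_⟩
  obtain ⟨m, rfl⟩ : ∃ m, n = k + m + 1 := ⟨n - k - 1, by omega⟩
  obtain ⟨h0, h1, hB⟩ := hmain m (k + m) (by omega) (by omega) hCn
  have hPX : IsProbabilityMeasure ((surfaceMeasure f (k + m + 1) t).withDensity p) := by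
    rw [← hX.map_eq]; exact Measure.isProbabilityMeasure_map hX.aemeasurable
  have hmap : P.map (fun ω => proj hkn (X ω)) =
      ((surfaceMeasure f (k + m + 1) t).withDensity p).map (proj hkn) := by
    rw [← hX.map_eq, AEMeasurable.map_map_of_aemeasurable (measurable_proj hkn).aemeasurable
      hX.aemeasurable]
    rfl
  have hae : AEMeasurable (fun ω => proj hkn (X ω)) P :=
    (measurable_proj hkn).comp_aemeasurable hX.aemeasurable
  have hpdf : HasPDF (fun ω => proj hkn (X ω)) P :=
    hasPDF_iff.2 ⟨hae, inferInstance, by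
      rw [hmap]; exact hf.map_proj_absolutelyContinuous hc ht rfl hkn p⟩
  refine ⟨hpdf, ?_⟩
  rw [← map_eq_withDensity_pdf (fun ω => proj hkn (X ω)) P volume, hmap]
  have hν := hf.isProbabilityMeasure_uniformDensity hc ht h0 h1
  have hG := hf.isProbabilityMeasure_gibbs (d := k) hc
  have hmν := Measure.isProbabilityMeasure_map
    (μ := (surfaceMeasure f (k + m + 1) t).withDensity (uniformDensity f (k + m + 1) t))
    (measurable_proj hkn).aemeasurable
  have hmμ := Measure.isProbabilityMeasure_map
    (μ := (surfaceMeasure f (k + m + 1) t).withDensity p) (measurable_proj hkn).aemeasurable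
  have hs : 0 < √((k + m + 1 : ℕ) : ℝ) := hC.trans hCn
  have hx0 : 0 < C / √((k + m + 1 : ℕ) : ℝ) := div_pos hC hs
  have hx1 : C / √((k + m + 1 : ℕ) : ℝ) < 1 := (div_lt_one hs).2 hCn
  have hq1 : 1 ≤ ((k + m + 1 : ℕ) : ℝ) / (m + 1 : ℕ) := by
    rw [one_le_div (by positivity)]
    exact_mod_cast (by omega)
  have hq2 : 1 ≤ (1 + C / √((k + m + 1 : ℕ) : ℝ)) / (1 - C / √((k + m + 1 : ℕ) : ℝ)) := by
    rw [one_le_div (sub_pos.2 hx1)]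
    linarith
  refine (klDiv_le_add_log_of_le_smul (one_le_mul_of_one_le_of_one_le hq1 hq2)
    (hf.map_proj_uniformDensity_le hc ht rfl hkn h0 hB)).trans ?_
  refine add_le_add (klDiv_map_le _ _ (measurable_proj hkn)) (ENNReal.ofReal_le_ofReal ?_)
  rw [Real.log_mul (by linarith) (by linarith)]
  have e : ((k + m + 1 : ℕ) : ℝ) - k = (m + 1 : ℕ) := by push_cast; ring
  rw [e]
  refine add_le_add le_rfl ((log_one_add_div_one_sub_le hx0 hx1).trans (le_of_eq ?_))
  rw [one_div_div]
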